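/- **Setting.** Let $h:S^1\to\mathbb R$ be smooth with $h(\bar z)=-h(z)$ for $z\in S^1$. *The $h$-bracket.* Give a finite measure $\tilde\mu=\sum_{s=1}^n\tilde\mu_s\delta_{z_s}$ on $S^1$ with $n$ atoms $z_s=e^{i\theta_s}$ the coordinates $\theta_s$ and $q_s=\tilde\mu_s\prod_{j\ne s}|z_s-z_j|$, and put $$\{f_1,f_2\}_h=\sum_{s=1}^n 2h(e^{i\theta_s})\,q_s\Big[\frac{\partial f_1}{\partial\theta_s}\frac{\partial f_2}{\partial q_s}-\frac{\partial f_1}{\partial q_s}\frac{\partial f_2}{\partial\theta_s}\Big].$$ Functions of probability measures are regarded as functions of all such measures through the normalization $\mu=\tilde\mu/|\tilde\mu|$. The restriction $\{\cdot,\cdot\}^{(1)}_h$ of this bracket to the conjugation-invariant probability measures is obtained by extending functions to smooth functions on the probability measures with $n$ atoms that are invariant under complex conjugation of the measure, taking their $h$-bracket, and evaluating it at conjugation-invariant measures. *The functions $m$, $H$ and $m_H$.* For a conjugation-invariant $\mu$ let $\nu$ be the measure on $[-2,2]$ with $\int f(z+z^{-1})\,d\mu(z)=\int f\,d\nu$.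 Put $$m(\lambda)=\int\frac{d\nu(t)}{t-\lambda},\qquad m_H(\lambda)=\int\frac{H(t)}{t-\lambda}\,d\nu(t),$$ where $H$ is the function on $[-2,2]$ with $H(2\cos\theta)=2\sin\theta\,h(e^{i\theta})$ (well defined because $h(\bar z)=-h(z)$). *The manifold $\mathcal P_N$.* For $N\ge1$ let $\mathcal P_N$ be the manifold of probability measures $\nu$ with exactly $N$ atoms, all in $(-2,2)$. A Poisson bracket on it is a bilinear skew-symmetric bracket on $C^\infty(\mathcal P_N)$ that satisfies the Leibniz rule and the Jacobi identity; it is extended complex-bilinearly to complex-valued functions. Two Poisson brackets are compatible if their sum is a Poisson bracket. *The Toda bracket.* On $M_N(\mathbb C)$ put $\langle X,Y\rangle=\operatorname{Im}\operatorname{Tr}(XY)$, let $R=\pi_{\mathfrak l}-\pi_{\mathfrak a}$ for the splitting into upper triangular matrices with real diagonal ($\mathfrak l$) and skew-Hermitian matrices ($\mathfrak a$), let $[X,Y]_R=\frac12[R(X),Y]+\frac12[X,R(Y)]$, and let $$\{\varphi,\psi\}_{LP}|_X=\tfrac12\langle[\nabla\varphi,\nabla\psi]_R,X\rangle$$ be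 the Lie–Poisson bracket, with gradients taken with respect to $\langle\cdot,\cdot\rangle$. The Toda bracket on $\mathcal P_N$ is the restriction of $\{\cdot,\cdot\}_{LP}$ to the matrices $iJ$, $J$ a Jacobi matrix (real symmetric tridiagonal with positive off-diagonal entries), carried over to $\mathcal P_N$ by sending $J$ to its spectral measure at $e_1$. *The Faybusovich–Gekhtman brackets.* For $k\ge0$, $\{\cdot,\cdot\}_k$ is the Poisson bracket on $\mathcal P_N$ with $$\{m(\lambda),m(\xi)\}_k=\big((\lambda^km(\lambda))_--(\xi^km(\xi))_-\big)\Big[\frac{m(\lambda)-m(\xi)}{\lambda-\xi}-m(\lambda)m(\xi)\Big]$$ for $\lambda\ne\xi$ in $\mathbb C\setminus\mathbb R$, where $r_-$ is the part of the Laurent expansion of $r$ at infinity with negative powers. **Proposition.** 1. For every $n$ and all $\lambda\neq\xi$ in $\mathbb C\setminus\mathbb R$, at every conjugation-invariant probability measure with $n$ atoms on $S^1$, $$\{m(\lambda),m(\xi)\}^{(1)}_h=(m_H(\lambda)-m_H(\xi))\Big[\frac{m(\lambda)-m(\xi)}{\lambda-\xi}-m(\lambda)m(\xi)\Big].\qquad(*)$$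 The functions $m(\lambda)$ have conjugation-invariant smooth extensions, and the value of the bracket does not depend on the choice of the extensions. 2. For every $N\ge1$ the right-hand side of $(*)$ defines a Poisson bracket on $\mathcal P_N$: there is exactly one Poisson bracket $\{\cdot,\cdot\}^{(0)}_H$ on $\mathcal P_N$ whose value on $m(\lambda),m(\xi)$ is the right-hand side of $(*)$ for all $\lambda\ne\xi$ in $\mathbb C\setminus\mathbb R$. The Toda bracket exists and is unique as a Poisson bracket on $\mathcal P_N$, and $\{\cdot,\cdot\}^{(0)}_H$ is compatible with it. 3. If $h$ is a trigonometric polynomial, then $H$ is (on $[-2,2]$) a real polynomial $\sum_kc_kt^k$, and for every $N\ge1$ each bracket $\{\cdot,\cdot\}_k$ exists and is unique, and $\{\cdot,\cdot\}^{(0)}_H=\sum_kc_k\{\cdot,\cdot\}_k$ on $\mathcal P_N$. -/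

import Mathlib

open scoped ContDiff Manifold Topology
open MeasureTheory

attribute [local instance] Matrix.normedAddCommGroup Matrix.normedSpace

namespace AblowitzLadik

noncomputable section

/-! ### Measures with finitely many atoms on the unit circle and the `h`-bracket -/

/-- Coordinates `(θ, q)` of a (not normalized) measure with `n` atoms on the unit circle. -/
abbrev CircleCoord (n : ℕ) : Type := (Fin n → ℝ) × (Fin n → ℝ)

/-- The open set of coordinates: the points `e^{iθ_s}` are distinct and the `q_s` are positive. -/
def circleDomain (n : ℕ) : Set (CircleCoord n) :=
  {c | Function.Injective (fun s => Circle.exp (c.1 s)) ∧ ∀ s, 0 < c.2 s}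

/-- The mass at `z_s = e^{iθ_s}`, determined by `q_s = mass_s * ∏_{j ≠ s} |z_s - z_j|`. -/
def circleMass {n : ℕ} (c : CircleCoord n) (s : Fin n) : ℝ :=
  c.2 s / ∏ j ∈ Finset.univ.erase s, ‖(Circle.exp (c.1 s) : ℂ) - (Circle.exp (c.1 j) : ℂ)‖

/-- The probability measure on the unit circle obtained by normalizing the measure with
coordinates `c`. -/
def circleMeasure {n : ℕ} (c : CircleCoord n) : Measure ℂ :=
  ∑ s, ENNReal.ofReal (circleMass c s / ∑ j, circleMass c j) •
    Measure.dirac (Circle.exp (c.1 s) : ℂ)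

/-- The `h`-bracket of two functions of the coordinates `(θ, q)`:
`∑_s 2 h(e^{iθ_s}) q_s (∂F/∂θ_s ∂G/∂q_s - ∂F/∂q_s ∂G/∂θ_s)`. -/
def hBracket {n : ℕ} (h : Circle → ℝ) (F G : CircleCoord n → ℂ) (c : CircleCoord n) : ℂ :=
  ∑ s, ((2 * h (Circle.exp (c.1 s)) * c.2 s : ℝ) : ℂ) *
    (fderiv ℝ F c (Pi.single s 1, 0) * fderiv ℝ G c (0, Pi.single s 1)
      - fderiv ℝ F c (0, Pi.single s 1) * fderiv ℝ G c (Pi.single s 1, 0))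

/-- The `h`-bracket of two functions of probability measures with `n` atoms on the circle, at the
normalization of the measure with coordinates `c`. Such functions are regarded as functions of
all measures with `n` atoms through normalization. -/
def probBracket (n : ℕ) (h : Circle → ℝ) (Φ Ψ : Measure ℂ → ℂ) (c : CircleCoord n) : ℂ :=
  hBracket h (fun c' => Φ (circleMeasure c')) (fun c' => Ψ (circleMeasure c')) c

/-- The image of a measure under complex conjugation. -/
def conjMeasure (μ : Measure ℂ) : Measure ℂ := μ.map (starRingEnd ℂ)

/-- `Φ` extends the function `φ`, given on the conjugation invariant probability measures with
`n` atoms on the circle, to a smooth function on all probability measures with `n` atoms which is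
invariant under the involution `conjMeasure`. The bracket of two functions on the fixed manifold
of the involution is the bracket of such extensions. -/
structure IsInvariantExtension (n : ℕ) (φ Φ : Measure ℂ → ℂ) : Prop where
  smooth : ContDiffOn ℝ ∞ (fun c : CircleCoord n => Φ (circleMeasure c)) (circleDomain n)
  invariant : ∀ c ∈ circleDomain n, Φ (conjMeasure (circleMeasure c)) = Φ (circleMeasure c)
  extends_ : ∀ c ∈ circleDomain n, conjMeasure (circleMeasure c) = circleMeasure c →
    Φ (circleMeasure c) = φ (circleMeasure c)

/-- The measure `ν` on `[-2, 2]` with `∫ f(z + z⁻¹) dμ(z) = ∫ f dν`. -/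
def szegoMeasure (μ : Measure ℂ) : Measure ℝ := μ.map (fun z => (z + z⁻¹).re)

/-! ### The `m`-function -/

/-- `m(z) = ∫ dν(t) / (t - z)`. -/
def mFun (ν : Measure ℝ) (z : ℂ) : ℂ := ∫ t, 1 / ((t : ℂ) - z) ∂ν

/-- `m_H(z) = ∫ H(t) dν(t) / (t - z)`. -/
def mFunH (H : ℝ → ℝ) (ν : Measure ℝ) (z : ℂ) : ℂ := ∫ t, (H t : ℂ) / ((t : ℂ) - z) ∂ν

/-- The function `H` on `[-2, 2]` with `H(2 cos θ) = 2 sin θ h(e^{iθ})` for `0 ≤ θ ≤ π`. -/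
def hTransform (h : Circle → ℝ) (t : ℝ) : ℝ :=
  2 * Real.sin (Real.arccos (t / 2)) * h (Circle.exp (Real.arccos (t / 2)))

/-- `(K(z) - K(w)) * ((m(z) - m(w)) / (z - w) - m(z) m(w))`. -/
def bracketRHS (K : ℂ → ℂ) (ν : Measure ℝ) (z w : ℂ) : ℂ :=
  (K z - K w) * ((mFun ν z - mFun ν w) / (z - w) - mFun ν z * mFun ν w)

/-- The polynomial part at infinity: the polynomial `P` such that `r - P` tends to zero at
infinity (and `0` if there is none). For `r(z) = ∑_{l ≤ d} c_l z^l` it is `∑_{0 ≤ l ≤ d} c_l z^l`. -/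
def polyPart (r : ℂ → ℂ) : Polynomial ℂ :=
  open Classical in
  if hr : ∃ P : Polynomial ℂ,
    Filter.Tendsto (fun z => r z - P.eval z) (Bornology.cobounded ℂ) (𝓝 0) then hr.choose else 0

/-- The part `r_- = r - r_+` of `r` consisting of negative powers at infinity. -/
def negPart (r : ℂ → ℂ) (z : ℂ) : ℂ := r z - (polyPart r).eval z

/-! ### Probability measures with `N` atoms in `(-2, 2)` and Poisson brackets on them -/

/-- A probability measure with exactly `N` atoms in `(-2, 2)`: the atoms in increasing order
and their masses. -/
@[ext]
structure SpectralData (N : ℕ) where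
  x : Fin N → ℝ
  w : Fin N → ℝ
  strictMono_x : StrictMono x
  mem_x : ∀ j, x j ∈ Set.Ioo (-2 : ℝ) 2
  pos_w : ∀ j, 0 < w j
  sum_w : ∑ j, w j = 1

/-- The probability measure `∑_j w_j δ_{x_j}`. -/
def SpectralData.measure {N : ℕ} (p : SpectralData N) : Measure ℝ :=
  ∑ j, ENNReal.ofReal (p.w j) • Measure.dirac (p.x j)

/-- The open set of `ℝ^N × ℝ^N` in which `SpectralData N` is the hypersurface `∑ w_j = 1`. -/
def spectralDomain (N : ℕ) : Set ((Fin N → ℝ) × (Fin N → ℝ)) :=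
  {y | StrictMono y.1 ∧ (∀ j, y.1 j ∈ Set.Ioo (-2 : ℝ) 2) ∧ ∀ j, 0 < y.2 j}

/-- The algebra of smooth real functions on the manifold `SpectralData N`, i.e. of restrictions of
smooth functions on `spectralDomain N` to the hypersurface `∑ w_j = 1`. -/
def smoothFunctions (N : ℕ) : Subalgebra ℝ (SpectralData N → ℝ) where
  carrier := {f | ∃ F : (Fin N → ℝ) × (Fin N → ℝ) → ℝ,
    ContDiffOn ℝ ∞ F (spectralDomain N) ∧ ∀ p : SpectralData N, F (p.x, p.w) = f p}
  mul_mem' := by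
    rintro f g ⟨F, hF, hf⟩ ⟨G, hG, hg⟩
    exact ⟨fun y => F y * G y, hF.mul hG, fun p => by simp [hf, hg]⟩
  add_mem' := by
    rintro f g ⟨F, hF, hf⟩ ⟨G, hG, hg⟩
    exact ⟨fun y => F y + G y, hF.add hG, fun p => by simp [hf, hg]⟩
  algebraMap_mem' := fun r => ⟨fun _ => r, contDiffOn_const, fun _ => rfl⟩

lemma mFun_measure {N : ℕ} (p : SpectralData N) (z : ℂ) :
    mFun p.measure z = ∑ j, (p.w j : ℂ) * (1 / ((p.x j : ℂ) - z)) := by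
  unfold mFun SpectralData.measure
  rw [integral_finsetSum_measure]
  · refine Finset.sum_congr rfl fun j _ => ?_
    rw [integral_smul_measure, integral_dirac, ENNReal.toReal_ofReal (p.pos_w j).le,
      Complex.real_smul]
  · intro j _
    exact (integrable_dirac (by simp [enorm_lt_top])).smul_measure ENNReal.ofReal_ne_top

lemma contDiffOn_mFun_aux {N : ℕ} (z : ℂ) (hz : z.im ≠ 0) (s : Set ((Fin N → ℝ) × (Fin N → ℝ))) :
    ContDiffOn ℝ ∞ (fun y : (Fin N → ℝ) × (Fin N → ℝ) =>
      ∑ j, (y.2 j : ℂ) * (1 / ((y.1 j : ℂ) - z))) s := by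
  apply ContDiff.contDiffOn
  refine ContDiff.sum fun j _ => ?_
  have h1 : ContDiff ℝ ∞ (fun y : (Fin N → ℝ) × (Fin N → ℝ) => (y.1 j : ℂ)) :=
    Complex.ofRealCLM.contDiff.comp ((contDiff_apply ℝ ℝ j).comp contDiff_fst)
  have h2 : ContDiff ℝ ∞ (fun y : (Fin N → ℝ) × (Fin N → ℝ) => (y.2 j : ℂ)) :=
    Complex.ofRealCLM.contDiff.comp ((contDiff_apply ℝ ℝ j).comp contDiff_snd)
  simp only [one_div]
  refine h2.mul ((h1.sub contDiff_const).inv fun y hy => hz ?_)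
  have := congrArg Complex.im hy
  simpa using this

/-- The real part of `m(z)`, as a smooth function on the manifold. -/
def mRe (N : ℕ) (z : ℂ) (hz : z.im ≠ 0) : smoothFunctions N :=
  ⟨fun p => (mFun p.measure z).re, _,
    Complex.reCLM.contDiff.comp_contDiffOn (contDiffOn_mFun_aux z hz _),
    fun p => by simp only [mFun_measure]; rfl⟩

/-- The imaginary part of `m(z)`, as a smooth function on the manifold. -/
def mIm (N : ℕ) (z : ℂ) (hz : z.im ≠ 0) : smoothFunctions N :=
  ⟨fun p => (mFun p.measure z).im, _,
    Complex.imCLM.contDiff.comp_contDiffOn (contDiffOn_mFun_aux z hz _),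
    fun p => by simp only [mFun_measure]; rfl⟩

/-- Bilinear brackets on the algebra of smooth functions. -/
abbrev Bracket (N : ℕ) : Type :=
  smoothFunctions N →ₗ[ℝ] smoothFunctions N →ₗ[ℝ] smoothFunctions N

/-- Poisson brackets: skew-symmetric, with the Leibniz rule and the Jacobi identity. -/
structure IsPoissonBracket {N : ℕ} (B : Bracket N) : Prop where
  skew : ∀ f g, B f g = -B g f
  leibniz : ∀ f g k, B f (g * k) = B f g * k + g * B f k
  jacobi : ∀ f g k, B f (B g k) + B g (B k f) + B k (B f g) = 0

/-- Two Poisson brackets are compatible if their sum is a Poisson bracket. -/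
def Compatible {N : ℕ} (B B' : Bracket N) : Prop :=
  IsPoissonBracket B ∧ IsPoissonBracket B' ∧ IsPoissonBracket (B + B')

/-- The value at `p` of the complex bilinear extension of the bracket, on `f₁ + i f₂` and
`g₁ + i g₂`. -/
def complexBracket {N : ℕ} (B : Bracket N) (f₁ f₂ g₁ g₂ : smoothFunctions N)
    (p : SpectralData N) : ℂ :=
  (((B f₁ g₁).1 p - (B f₂ g₂).1 p : ℝ) : ℂ) +
    (((B f₁ g₂).1 p + (B f₂ g₁).1 p : ℝ) : ℂ) * Complex.I

/-- `B` is a Poisson bracket with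
`{m(z), m(w)} = (K(z) - K(w)) * ((m(z) - m(w)) / (z - w) - m(z) m(w))` for nonreal `z ≠ w`, where
the function `K` may depend on the measure. -/
def IsBracketOf {N : ℕ} (K : Measure ℝ → ℂ → ℂ) (B : Bracket N) : Prop :=
  IsPoissonBracket B ∧
    ∀ (z w : ℂ) (hz : z.im ≠ 0) (hw : w.im ≠ 0), z ≠ w → ∀ p : SpectralData N,
      complexBracket B (mRe N z hz) (mIm N z hz) (mRe N w hw) (mIm N w hw) p =
        bracketRHS (K p.measure) p.measure z w

/-- The bracket `{·,·}_H` built from the function `H`. -/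
def IsHBracket {N : ℕ} (H : ℝ → ℝ) (B : Bracket N) : Prop :=
  IsBracketOf (fun ν => mFunH H ν) B

/-- The Faybusovich-Gekhtman bracket with index `k`, built from `(z^k m(z))_-`. -/
def IsFaybusovichGekhtmanBracket {N : ℕ} (k : ℕ) (B : Bracket N) : Prop :=
  IsBracketOf (fun ν => negPart (fun z => z ^ k * mFun ν z)) B

/-! ### The Lie-Poisson bracket on matrices and the Toda bracket -/

/-- The pairing `Im Tr(XY)`. -/
def imTracePairing {N : ℕ} (X Y : Matrix (Fin N) (Fin N) ℂ) : ℝ := (X * Y).trace.im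

/-- The skew-Hermitian component in the decomposition of a matrix into a skew-Hermitian matrix and
an upper triangular matrix with real diagonal. -/
def projSkew {N : ℕ} (X : Matrix (Fin N) (Fin N) ℂ) : Matrix (Fin N) (Fin N) ℂ :=
  Matrix.of fun i j =>
    if j < i then X i j else if i < j then -(starRingEnd ℂ) (X j i) else (X i i).im * Complex.I

/-- The upper triangular component, with real diagonal. -/
def projUpper {N : ℕ} (X : Matrix (Fin N) (Fin N) ℂ) : Matrix (Fin N) (Fin N) ℂ := X - projSkew X

lemma projSkew_conjTranspose {N : ℕ} (X : Matrix (Fin N) (Fin N) ℂ) :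
    (projSkew X).conjTranspose = -projSkew X := by
  ext i j
  rcases lt_trichotomy i j with h | h | h
  · simp [projSkew, h, h.not_gt]
  · simp [projSkew, h]
  · simp [projSkew, h, h.not_gt]

lemma projUpper_apply_of_lt {N : ℕ} (X : Matrix (Fin N) (Fin N) ℂ) {i j : Fin N} (h : j < i) :
    projUpper X i j = 0 := by
  simp [projUpper, projSkew, h]

lemma projUpper_diag_im {N : ℕ} (X : Matrix (Fin N) (Fin N) ℂ) (i : Fin N) :
    (projUpper X i i).im = 0 := by
  simp [projUpper, projSkew]

/-- The `R`-matrix: the upper triangular component minus the skew-Hermitian one. -/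
def rMatrix {N : ℕ} (X : Matrix (Fin N) (Fin N) ℂ) : Matrix (Fin N) (Fin N) ℂ :=
  projUpper X - projSkew X

/-- The second Lie bracket `[X, Y]_R = ½ [R(X), Y] + ½ [X, R(Y)]`. -/
def rLieBracket {N : ℕ} (X Y : Matrix (Fin N) (Fin N) ℂ) : Matrix (Fin N) (Fin N) ℂ :=
  (1 / 2 : ℝ) • (rMatrix X * Y - Y * rMatrix X) + (1 / 2 : ℝ) • (X * rMatrix Y - rMatrix Y * X)

/-- The gradient with respect to the pairing `Im Tr(XY)`: its `(k, l)` entry is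
`∂φ/∂v_{l,k} + i ∂φ/∂u_{l,k}`, where `u + i v` are the entries of the matrix. -/
def matrixGradient {N : ℕ} (φ : Matrix (Fin N) (Fin N) ℂ → ℝ) (X : Matrix (Fin N) (Fin N) ℂ) :
    Matrix (Fin N) (Fin N) ℂ :=
  Matrix.of fun k l =>
    (fderiv ℝ φ X (Matrix.single l k Complex.I) : ℂ) +
      Complex.I * (fderiv ℝ φ X (Matrix.single l k 1) : ℂ)

/-- The Lie-Poisson bracket `½ ⟨[∇φ, ∇ψ]_R, X⟩`. -/
def liePoissonBracket {N : ℕ} (φ ψ : Matrix (Fin N) (Fin N) ℂ → ℝ)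
    (X : Matrix (Fin N) (Fin N) ℂ) : ℝ :=
  1 / 2 * imTracePairing (rLieBracket (matrixGradient φ X) (matrixGradient ψ X)) X

/-- Jacobi matrices: real symmetric tridiagonal with positive off-diagonal entries. -/
structure IsJacobi {N : ℕ} (J : Matrix (Fin N) (Fin N) ℝ) : Prop where
  symm : J.IsSymm
  tridiagonal : ∀ i j : Fin N, (i : ℕ) + 1 < j → J i j = 0
  offdiag_pos : ∀ i j : Fin N, (i : ℕ) + 1 = j → 0 < J i j

/-- The embedding `J ↦ iJ` of real matrices. -/
def iEmbed {N : ℕ} (J : Matrix (Fin N) (Fin N) ℝ) : Matrix (Fin N) (Fin N) ℂ :=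
  J.map fun t => Complex.I * (t : ℂ)

/-- `p` is the spectral measure of the Jacobi matrix `J` and the first basis vector. -/
def IsSpectralMeasure {N : ℕ} [NeZero N] (J : Matrix (Fin N) (Fin N) ℝ) (p : SpectralData N) :
    Prop :=
  IsJacobi J ∧ ∀ k : ℕ, (J ^ k) 0 0 = ∫ t, t ^ k ∂p.measure

/-- The function `φ`, defined on the open set `U` of matrices, is smooth and extends the function
`f` of the spectral measure from the set of the matrices `iJ`, with `J` a Jacobi matrix. -/
structure IsMatrixExtension {N : ℕ} [NeZero N] (U : Set (Matrix (Fin N) (Fin N) ℂ))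
    (f : smoothFunctions N) (φ : Matrix (Fin N) (Fin N) ℂ → ℝ) : Prop where
  smooth : ContDiffOn ℝ ∞ φ U
  extends_ : ∀ J p, IsSpectralMeasure J p → iEmbed J ∈ U → φ (iEmbed J) = f.1 p

/-- `T` is the Toda bracket: the restriction of the Lie-Poisson bracket to Jacobi matrices (as
matrices `iJ`), carried over to spectral measures. -/
def IsTodaBracket {N : ℕ} [NeZero N] (T : Bracket N) : Prop :=
  IsPoissonBracket T ∧
    ∀ (U : Set (Matrix (Fin N) (Fin N) ℂ)) (f g : smoothFunctions N)
      (φ ψ : Matrix (Fin N) (Fin N) ℂ → ℝ),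
      IsOpen U → IsMatrixExtension U f φ → IsMatrixExtension U g ψ →
        ∀ J p, IsSpectralMeasure J p → iEmbed J ∈ U →
          (T f g).1 p = liePoissonBracket φ ψ (iEmbed J)

/-- `h` is (the restriction to the circle of) a trigonometric polynomial. -/
def IsTrigPolynomial (h : Circle → ℝ) : Prop :=
  ∃ c : ℤ →₀ ℂ, ∀ z : Circle, (h z : ℂ) = c.sum fun j a => a * (z : ℂ) ^ j

end

end AblowitzLadik

open AblowitzLadik

namespace AblowitzLadik

noncomputable section

section

/-! ### Derivatives of normalized weighted sums -/

/-! All brackets in the statement come from one computation. Choose coordinates in which the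
logarithm of a mass is a free coordinate minus the sum of the logarithms of its distances to the
other nodes. Moving a node changes `m` through a double pole and through an antisymmetric kernel,
the logarithmic derivative of the distance. In the bracket of `m(z)` and `m(w)` the contribution of
a pair of nodes is the difference of the nodes times `stieltjesKernel` (`stieltjesKernel_offdiag`).
The difference cancels the pole of the antisymmetric kernel, the double poles supply the diagonal
(`stieltjesKernel_diag`), and the complete double sum factors as the right-hand side of (*)
(`sum_stieltjesKernel`).

On the circle the kernel is half the cotangent of half the angle. At a conjugation-invariant measure
the atoms come in conjugate pairs of equal mass, and the two cotangents of a pair add up to `2 sin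
θ_s / (x_j - x_s)` with `x = 2 cos θ`; the factor `2 sin θ_s` turns `h` into `H`
(`hBracket_circleStieltjes`). The choice of extensions is irrelevant because at a fixed point of an
involution the differential of an invariant function is determined by its restriction to the fixed
set.

On the manifold of spectral measures the kernel is `1 / (x_s - x_j)`, and the bracket is built from
the commuting fields `-H(x_s) ∂/∂x_s` and `∂/∂u_s`, whence the Jacobi identity
(`derivationBracket_jacobi`). It is linear in `H`, so any two members of the family are compatible.
Uniqueness holds because a derivation at a point is a vector (Hadamard's lemma), and this vector is
read off from the simple and double poles of the variation of `m` (`poles_eq_zero`,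
`IsBracketOf.unique`). Since `(z^k m)_-` is `m_H` for `H = t^k` (`negPart_pow_mul_mFun`), the
Faybusovich-Gekhtman brackets are the members for monomials, and linearity gives the last claim.

The Toda bracket is the member for `H = 1`. At `iJ` the Lie-Poisson bracket differentiates only
along symmetric tridiagonal matrices; `m` is a resolvent entry with gradient of rank one, and the
bracket of two such entries is a telescoping sum (`wronskian_identity`). The passage to arbitrary
functions and extensions rests on the fact that a symmetric tridiagonal direction is determined by
its effect on resolvent entries (`symmTridiagonal_eq_zero_of_resolventVector`). -/

lemma hasDerivAt_comp_line {E F : Type*} [NormedAddCommGroup E] [NormedSpace ℝ E]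
    [NormedAddCommGroup F] [NormedSpace ℝ F] {f : E → F} {c : E} (hf : DifferentiableAt ℝ f c)
    (v : E) : HasDerivAt (fun t : ℝ => f (c + t • v)) (fderiv ℝ f c v) 0 := by
  have h1 : HasDerivAt (fun t : ℝ => c + t • v) v 0 := by
    simpa using ((hasDerivAt_id (0 : ℝ)).smul_const v).const_add c
  have h2 : HasFDerivAt f (fderiv ℝ f c) (c + (0 : ℝ) • v) := by simpa using hf.hasFDerivAt
  exact h2.comp_hasDerivAt (0 : ℝ) h1

lemma fderiv_apply_eq_of_hasDerivAt {E F : Type*} [NormedAddCommGroup E] [NormedSpace ℝ E]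
    [NormedAddCommGroup F] [NormedSpace ℝ F] {f : E → F} {c v : E} {L : F}
    (hf : DifferentiableAt ℝ f c) (h : HasDerivAt (fun t : ℝ => f (c + t • v)) L 0) :
    fderiv ℝ f c v = L :=
  (hasDerivAt_comp_line hf v).unique h

lemma eventually_add_smul_mem {E : Type*} [NormedAddCommGroup E] [NormedSpace ℝ E] {U : Set E}
    (hU : IsOpen U) {c : E} (hc : c ∈ U) (v : E) : ∀ᶠ t : ℝ in 𝓝 0, c + t • v ∈ U := by
  have : ContinuousAt (fun t : ℝ => c + t • v) 0 := by fun_prop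
  exact this.preimage_mem_nhds (by simpa using hU.mem_nhds hc)

/-- With logarithmic derivatives `l j` of the masses, a weighted mean changes by the covariance of
`l` and `g` plus the mean of `γ`. Centring `g` shows that a constant added to all `l j` drops out.
-/
lemma hasDerivAt_weightedAverage {ι : Type*} [Fintype ι] {m : ι → ℝ → ℝ} {g : ι → ℝ → ℂ}
    {l : ι → ℝ} {γ : ι → ℂ} {t₀ : ℝ} (hm : ∀ j, HasDerivAt (m j) (m j t₀ * l j) t₀)
    (hg : ∀ j, HasDerivAt (g j) (γ j) t₀) (hM : ∑ i, m i t₀ ≠ 0) :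
    HasDerivAt (fun t => ∑ j, ((m j t / ∑ i, m i t : ℝ) : ℂ) * g j t)
      (∑ j, ((m j t₀ / ∑ i, m i t₀ : ℝ) : ℂ) *
        ((l j : ℂ) * (g j t₀ - ∑ k, ((m k t₀ / ∑ i, m i t₀ : ℝ) : ℂ) * g k t₀) + γ j)) t₀ := by
  have hS : HasDerivAt (fun t => ∑ i, m i t) (∑ i, m i t₀ * l i) t₀ :=
    HasDerivAt.fun_sum fun i _ => hm i
  have h1 : ∀ j, HasDerivAt (fun t => ((m j t / ∑ i, m i t : ℝ) : ℂ) * g j t)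
      (((((m j t₀ * l j) * (∑ i, m i t₀) - m j t₀ * ∑ i, m i t₀ * l i) / (∑ i, m i t₀) ^ 2 : ℝ) : ℂ)
        * g j t₀ + ((m j t₀ / ∑ i, m i t₀ : ℝ) : ℂ) * γ j) t₀ := fun j =>
    (((hm j).div hS hM).ofReal_comp).mul (hg j)
  refine (HasDerivAt.fun_sum fun j _ => h1 j).congr_deriv ?_
  set M := ∑ i, m i t₀ with hMdef
  have hM' : (M : ℂ) ≠ 0 := by exact_mod_cast hM
  have h2 : ∀ j, ((((m j t₀ * l j) * M - m j t₀ * ∑ i, m i t₀ * l i) / M ^ 2 : ℝ) : ℂ)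
        * g j t₀ + ((m j t₀ / M : ℝ) : ℂ) * γ j =
      ((m j t₀ / M : ℝ) : ℂ) * ((l j : ℂ) * g j t₀ + γ j) -
        ((∑ i, m i t₀ * l i : ℝ) : ℂ) / M * (((m j t₀ / M : ℝ) : ℂ) * g j t₀) := by
    intro j
    push_cast
    field_simp
    ring
  have h3 : ∀ j, ((m j t₀ / M : ℝ) : ℂ) *
        ((l j : ℂ) * (g j t₀ - ∑ k, ((m k t₀ / M : ℝ) : ℂ) * g k t₀) + γ j) =
      ((m j t₀ / M : ℝ) : ℂ) * ((l j : ℂ) * g j t₀ + γ j) -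
        (((m j t₀ : ℂ) * l j) / M) * ∑ k, ((m k t₀ / M : ℝ) : ℂ) * g k t₀ := by
    intro j
    push_cast
    field_simp
    ring
  rw [Finset.sum_congr rfl fun j _ => h2 j, Finset.sum_congr rfl fun j _ => h3 j,
    Finset.sum_sub_distrib, Finset.sum_sub_distrib, ← Finset.mul_sum, ← Finset.sum_mul,
    ← Finset.sum_div]
  push_cast
  rfl

/-- Logarithmic differentiation. Both `circleMass` and `chartDensity` are quotients of this form. -/
lemma hasDerivAt_div_prod {ι : Type*} {s : Finset ι} {q : ℝ → ℝ} {d : ι → ℝ → ℝ}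
    {r : ℝ} {k : ι → ℝ} {t₀ : ℝ} (hq : HasDerivAt q (q t₀ * r) t₀)
    (hd : ∀ i ∈ s, HasDerivAt (d i) (d i t₀ * k i) t₀) (hd0 : ∀ i ∈ s, d i t₀ ≠ 0) :
    HasDerivAt (fun t => q t / ∏ i ∈ s, d i t)
      ((q t₀ / ∏ i ∈ s, d i t₀) * (r - ∑ i ∈ s, k i)) t₀ := by
  classical
  induction s using Finset.induction_on with
  | empty => simpa using hq
  | insert a s ha ih =>
    have h1 := ih (fun i hi => hd i (Finset.mem_insert_of_mem hi))
      fun i hi => hd0 i (Finset.mem_insert_of_mem hi)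
    have ha0 := hd0 a (Finset.mem_insert_self a s)
    have h2 := h1.div (hd a (Finset.mem_insert_self a s)) ha0
    have h3 : (fun t => q t / ∏ i ∈ insert a s, d i t) =
        fun t => (q t / ∏ i ∈ s, d i t) / d a t := by
      funext t
      rw [Finset.prod_insert ha, div_div, mul_comm]
    have hP : ∏ i ∈ s, d i t₀ ≠ 0 :=
      Finset.prod_ne_zero_iff.2 fun i hi => hd0 i (Finset.mem_insert_of_mem hi)
    rw [h3]
    refine h2.congr_deriv ?_
    rw [Finset.prod_insert ha, Finset.sum_insert ha]
    field_simp
    ring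

/-! ### Algebra of the bracket of two Stieltjes transforms -/

section Algebra

variable {ι : Type*}

/-- When only node `s` moves, the mass at `j` reacts with logarithmic derivative `-∑ i, (δ_js -
δ_is) κ j i`. Antisymmetry merges the reaction at `s` with the reactions elsewhere into one sum over
the pairs containing `s`. -/
lemma sum_mul_antisymm_direction [Fintype ι] [DecidableEq ι] (μ G : ι → ℂ) (κ : ι → ι → ℂ)
    (hκ : ∀ i j, κ i j = -κ j i) (s : ι) :
    ∑ j, μ j * (-(∑ i, ((if j = s then 1 else 0) - (if i = s then 1 else 0)) * κ j i) * G j) =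
      -∑ j, κ s j * (μ s * G s + μ j * G j) := by
  have h1 : ∀ j, ∑ i, (((if j = s then 1 else 0) - (if i = s then 1 else 0)) * κ j i : ℂ) =
      (if j = s then ∑ i, κ s i else 0) - κ j s := by
    intro j
    simp only [sub_mul, Finset.sum_sub_distrib, ite_mul, one_mul, zero_mul, Finset.sum_ite_eq',
      Finset.mem_univ, if_true]
    split_ifs with h
    · rw [h]
    · simp
  simp only [h1]
  have h2 : ∀ j, μ j * (-((if j = s then ∑ i, κ s i else 0) - κ j s) * G j) =
      (if j = s then -(μ s * (∑ i, κ s i) * G s) else 0) - κ s j * (μ j * G j) := by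
    intro j
    rw [hκ j s]
    split_ifs with h
    · rw [h]; ring
    · ring
  rw [Finset.sum_congr rfl fun j _ => h2 j, Finset.sum_sub_distrib]
  simp only [Finset.sum_ite_eq', Finset.mem_univ, if_true, mul_add, Finset.sum_add_distrib]
  rw [← Finset.sum_mul]
  ring

/-- The factors `Γ - ∑ κ …` and `μ G` are the derivatives of a transform along a node and along its
conjugate coordinate. In the `κ` part the products with both factors at `s` cancel, so only mixed
pairs survive. -/
lemma sum_canonical_bracket [Fintype ι] (A μ Γ Γ' G G' : ι → ℂ) (κ : ι → ι → ℂ) :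
    ∑ s, A s * ((Γ s - ∑ j, κ s j * (μ s * G s + μ j * G j)) * (μ s * G' s)
      - (μ s * G s) * (Γ' s - ∑ j, κ s j * (μ s * G' s + μ j * G' j))) =
    ∑ s, A s * μ s * (Γ s * G' s - Γ' s * G s) -
      ∑ s, ∑ j, A s * κ s j * (μ s * μ j * (G j * G' s - G' j * G s)) := by
  rw [← Finset.sum_sub_distrib]
  refine Finset.sum_congr rfl fun s _ => ?_
  have : ∑ j, A s * κ s j * (μ s * μ j * (G j * G' s - G' j * G s)) =
      A s * μ s * (G' s * (∑ j, κ s j * (μ s * G s + μ j * G j)) -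
        G s * ∑ j, κ s j * (μ s * G' s + μ j * G' j)) := by
    rw [Finset.mul_sum, Finset.mul_sum, ← Finset.sum_sub_distrib, Finset.mul_sum]
    refine Finset.sum_congr rfl fun j _ => ?_
    ring
  rw [this]
  ring

/-- The kernel of the bracket of two Stieltjes transforms. -/
def stieltjesKernel (d ma mb : ℂ) (a b : ι → ℂ) (s j : ι) : ℂ :=
  d * (a s * a j * (b s * b j)) + ma * (b s * b j) - mb * (a s * a j)

/-- Each term of the kernel separates the variables `s` and `j`, so the inner sum is explicit. The
relation `hab` turns `∑ μ a b` into `(ma - mb) / d`, and its version weighted by `H` produces the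
first factor. -/
lemma sum_stieltjesKernel [Fintype ι] (H μ a b : ι → ℂ) {d : ℂ} (hd : d ≠ 0)
    (hab : ∀ s, a s - b s = d * (a s * b s)) :
    ∑ s, ∑ j, H s * μ s * μ j *
        stieltjesKernel d (∑ i, μ i * a i) (∑ i, μ i * b i) a b s j =
      (∑ s, H s * μ s * a s - ∑ s, H s * μ s * b s) *
        ((∑ i, μ i * a i - ∑ i, μ i * b i) / d - (∑ i, μ i * a i) * ∑ i, μ i * b i) := by
  set ma := ∑ i, μ i * a i with hma
  set mb := ∑ i, μ i * b i with hmb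
  have h1 : ma - mb = d * ∑ i, μ i * (a i * b i) := by
    rw [hma, hmb, ← Finset.sum_sub_distrib, Finset.mul_sum]
    refine Finset.sum_congr rfl fun i _ => ?_
    rw [← mul_sub, hab]; ring
  have h2 : ∑ s, H s * μ s * a s - ∑ s, H s * μ s * b s = d * ∑ s, H s * μ s * (a s * b s) := by
    rw [← Finset.sum_sub_distrib, Finset.mul_sum]
    refine Finset.sum_congr rfl fun i _ => ?_
    rw [← mul_sub, hab]; ring
  have h3 : ∀ s, ∑ j, H s * μ s * μ j * stieltjesKernel d ma mb a b s j =
      H s * μ s * (a s * b s) * (ma - mb) - ma * mb * (H s * μ s * a s - H s * μ s * b s) := by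
    intro s
    have : ∀ j, H s * μ s * μ j * stieltjesKernel d ma mb a b s j =
        H s * μ s * (a s * b s) * d * (μ j * (a j * b j)) +
          H s * μ s * ma * b s * (μ j * b j) - H s * μ s * mb * a s * (μ j * a j) := by
      intro j; unfold stieltjesKernel; ring
    rw [Finset.sum_congr rfl fun j _ => this j, Finset.sum_sub_distrib, Finset.sum_add_distrib,
      ← Finset.mul_sum, ← Finset.mul_sum, ← Finset.mul_sum, ← hma, ← hmb, h1]
    ring
  rw [Finset.sum_congr rfl fun s _ => h3 s, Finset.sum_sub_distrib, ← Finset.sum_mul,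
    ← Finset.mul_sum, Finset.sum_sub_distrib, h2, h1]
  field_simp

/-- All three hypotheses are partial fractions. In the applications `δ` is the difference of two
nodes; it factors out and later cancels the pole of the interaction kernel. -/
lemma stieltjesKernel_offdiag {d ma mb δ : ℂ} {a b : ι → ℂ} {s j : ι}
    (has : a s - b s = d * (a s * b s))
    (ha : a s - a j = δ * (a s * a j)) (hb : b s - b j = δ * (b s * b j)) :
    (a j - ma) * (b s - mb) - (b j - mb) * (a s - ma) =
      -(δ * stieltjesKernel d ma mb a b s j) := by
  unfold stieltjesKernel
  linear_combination (a j - ma) * hb + (mb - b j) * ha - δ * a j * b j * has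

/-- The confluent case: the double poles caused by the motion of the node itself fill the diagonal
of the double sum. -/
lemma stieltjesKernel_diag {d ma mb : ℂ} {a b : ι → ℂ} {s : ι}
    (has : a s - b s = d * (a s * b s)) :
    a s ^ 2 * (b s - mb) - b s ^ 2 * (a s - ma) = stieltjesKernel d ma mb a b s s := by
  unfold stieltjesKernel
  linear_combination (a s * b s) * has

end Algebra

end

section

/-! ### The `h`-bracket on the circle -/

lemma integral_sum_dirac {ι α E : Type*} [Fintype ι] [MeasurableSpace α]
    [MeasurableSingletonClass α] [NormedAddCommGroup E] [NormedSpace ℝ E] [CompleteSpace E]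
    {r : ι → ℝ} (hr : ∀ j, 0 ≤ r j) (x : ι → α) (f : α → E) :
    ∫ t, f t ∂(∑ j, ENNReal.ofReal (r j) • Measure.dirac (x j)) = ∑ j, r j • f (x j) := by
  rw [integral_finsetSum_measure]
  · refine Finset.sum_congr rfl fun j _ => ?_
    rw [integral_smul_measure, integral_dirac, ENNReal.toReal_ofReal (hr j)]
  · intro j _
    exact (integrable_dirac (by simp [enorm_lt_top])).smul_measure ENNReal.ofReal_ne_top

/-- `arccos (cos θ)` is `θ` or `-θ` modulo `2π`, and the signs of `sin` and of `h` change together.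
-/
lemma hTransform_two_mul_cos {h : Circle → ℝ} (h_odd : ∀ z : Circle, h z⁻¹ = -h z) (θ : ℝ) :
    hTransform h (2 * Real.cos θ) = 2 * Real.sin θ * h (Circle.exp θ) := by
  unfold hTransform
  rw [mul_div_cancel_left₀ _ (two_ne_zero)]
  have h1 : Real.cos (Real.arccos (Real.cos θ)) = Real.cos θ :=
    Real.cos_arccos (Real.neg_one_le_cos θ) (Real.cos_le_one θ)
  obtain ⟨k, hk | hk⟩ := Real.cos_eq_cos_iff.1 h1
  · have e : θ = Real.arccos (Real.cos θ) + k * (2 * Real.pi) := by linarith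
    have hs : Real.sin θ = Real.sin (Real.arccos (Real.cos θ)) := by
      conv_lhs => rw [e]
      rw [Real.sin_add_int_mul_two_pi]
    have he : Circle.exp θ = Circle.exp (Real.arccos (Real.cos θ)) := by
      conv_lhs => rw [e]
      rw [Circle.exp_add, Circle.exp_int_mul_two_pi, mul_one]
    rw [hs, he]
  · have e : θ = -Real.arccos (Real.cos θ) + k * (2 * Real.pi) := by linarith
    have hs : Real.sin θ = -Real.sin (Real.arccos (Real.cos θ)) := by
      conv_lhs => rw [e]
      rw [Real.sin_add_int_mul_two_pi, Real.sin_neg]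
    have he : Circle.exp θ = (Circle.exp (Real.arccos (Real.cos θ)))⁻¹ := by
      conv_lhs => rw [e]
      rw [Circle.exp_add, Circle.exp_int_mul_two_pi, mul_one, Circle.exp_neg]
    rw [hs, he, h_odd]
    ring

variable {n : ℕ}

lemma isOpen_circleDomain (n : ℕ) : IsOpen (circleDomain n) := by
  have : circleDomain n = (⋂ i : Fin n, ⋂ j : Fin n, {c : CircleCoord n | i ≠ j →
      Circle.exp (c.1 i) ≠ Circle.exp (c.1 j)}) ∩ ⋂ i : Fin n, {c : CircleCoord n | 0 < c.2 i} := by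
    ext c
    simp only [circleDomain, Set.mem_ofPred_eq, Set.mem_inter_iff, Set.mem_iInter]
    exact and_congr ⟨fun h i j hij hc => hij (h hc), fun h i j hc => by_contra fun hij => h i j hij hc⟩
      Iff.rfl
  rw [this]
  refine IsOpen.inter (isOpen_iInter_of_finite fun i => isOpen_iInter_of_finite fun j => ?_)
    (isOpen_iInter_of_finite fun i => ?_)
  · by_cases hij : i = j
    · simp [hij]
    · simp only [ne_eq, hij, not_false_eq_true, forall_const]
      exact (isClosed_eq (by fun_prop) (by fun_prop)).isOpen_compl
  · exact isOpen_lt continuous_const (by fun_prop)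

lemma circleExp_sub_ne_zero {c : CircleCoord n} (hc : c ∈ circleDomain n) {i j : Fin n}
    (hij : i ≠ j) : (Circle.exp (c.1 i) : ℂ) - (Circle.exp (c.1 j) : ℂ) ≠ 0 := by
  rw [sub_ne_zero]
  exact fun h => hij (hc.1 (Circle.ext h))

lemma circleMass_pos {c : CircleCoord n} (hc : c ∈ circleDomain n) (s : Fin n) :
    0 < circleMass c s :=
  div_pos (hc.2 s) (Finset.prod_pos fun _ hj =>
    norm_pos_iff.2 (circleExp_sub_ne_zero hc (Finset.ne_of_mem_erase hj).symm))

lemma sum_circleMass_pos {c : CircleCoord n} (hc : c ∈ circleDomain n) (s : Fin n) :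
    0 < ∑ j, circleMass c j :=
  Finset.sum_pos (fun j _ => circleMass_pos hc j) ⟨s, Finset.mem_univ s⟩

lemma circleWeight_pos {c : CircleCoord n} (hc : c ∈ circleDomain n) (s : Fin n) :
    0 < circleMass c s / ∑ j, circleMass c j :=
  div_pos (circleMass_pos hc s) (sum_circleMass_pos hc s)

lemma circleExp_add_inv_re (θ : ℝ) :
    ((Circle.exp θ : ℂ) + (Circle.exp θ : ℂ)⁻¹).re = 2 * Real.cos θ := by
  rw [← Circle.coe_inv, ← Circle.exp_neg, Circle.coe_exp, Circle.coe_exp, Complex.add_re,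
    Complex.exp_ofReal_mul_I_re, Complex.exp_ofReal_mul_I_re, Real.cos_neg]
  ring

lemma szegoMeasure_circleMeasure (c : CircleCoord n) :
    szegoMeasure (circleMeasure c) =
      ∑ s, ENNReal.ofReal (circleMass c s / ∑ j, circleMass c j) •
        Measure.dirac (2 * Real.cos (c.1 s)) := by
  have hm : Measurable fun z : ℂ => (z + z⁻¹).re := by fun_prop
  unfold szegoMeasure circleMeasure
  rw [Measure.map_finset_sum hm.aemeasurable]
  refine Finset.sum_congr rfl fun s _ => ?_
  rw [Measure.map_smul, Measure.map_dirac' hm, circleExp_add_inv_re]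

/-- The function `m(z)` in the coordinates `(θ, q)`. -/
def circleStieltjes (z : ℂ) (c : CircleCoord n) : ℂ :=
  ∑ s, ((circleMass c s / ∑ j, circleMass c j : ℝ) : ℂ) * (1 / (((2 * Real.cos (c.1 s) : ℝ) : ℂ) - z))

lemma mFun_circleMeasure (z : ℂ) {c : CircleCoord n} (hc : c ∈ circleDomain n) :
    mFun (szegoMeasure (circleMeasure c)) z = circleStieltjes z c := by
  unfold mFun circleStieltjes
  rw [szegoMeasure_circleMeasure, integral_sum_dirac fun s => (circleWeight_pos hc s).le]
  simp only [Complex.real_smul]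

lemma mFunH_circleMeasure (H : ℝ → ℝ) (z : ℂ) {c : CircleCoord n} (hc : c ∈ circleDomain n) :
    mFunH H (szegoMeasure (circleMeasure c)) z =
      ∑ s, ((circleMass c s / ∑ j, circleMass c j : ℝ) : ℂ) *
        ((H (2 * Real.cos (c.1 s)) : ℂ) / (((2 * Real.cos (c.1 s) : ℝ) : ℂ) - z)) := by
  unfold mFunH
  rw [szegoMeasure_circleMeasure, integral_sum_dirac fun s => (circleWeight_pos hc s).le]
  simp only [Complex.real_smul]

lemma ofReal_sub_ne_zero {z : ℂ} (hz : z.im ≠ 0) (t : ℝ) : (t : ℂ) - z ≠ 0 := fun h => hz (by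
  simpa using congrArg Complex.im h)

lemma contDiffOn_circleStieltjes {z : ℂ} (hz : z.im ≠ 0) :
    ContDiffOn ℝ ∞ (circleStieltjes z : CircleCoord n → ℂ) (circleDomain n) := by
  have hθ : ∀ s : Fin n, ContDiff ℝ ∞ fun c : CircleCoord n => c.1 s := fun s => by fun_prop
  have hexp : ∀ s : Fin n, ContDiff ℝ ∞ fun c : CircleCoord n => (Circle.exp (c.1 s) : ℂ) := by
    intro s
    simp only [Circle.coe_exp]
    exact ((Complex.ofRealCLM.contDiff.comp (hθ s)).mul contDiff_const).cexp
  have hmass : ∀ s, ContDiffOn ℝ ∞ (fun c : CircleCoord n => circleMass c s) (circleDomain n) := by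
    intro s
    refine ContDiffOn.div (by fun_prop) ?_ ?_
    · refine contDiffOn_prod fun j hj => ?_
      intro c hc
      exact (ContDiffAt.norm ℝ ((hexp s).sub (hexp j)).contDiffAt
        (circleExp_sub_ne_zero hc (Finset.ne_of_mem_erase hj).symm)).contDiffWithinAt
    · intro c hc
      exact Finset.prod_ne_zero_iff.2 fun j hj =>
        norm_ne_zero_iff.2 (circleExp_sub_ne_zero hc (Finset.ne_of_mem_erase hj).symm)
  unfold circleStieltjes
  refine ContDiffOn.sum fun s _ => ContDiffOn.mul ?_ ?_
  · exact Complex.ofRealCLM.contDiff.comp_contDiffOn ((hmass s).div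
      (ContDiffOn.sum fun j _ => hmass j) fun c hc => (sum_circleMass_pos hc s).ne')
  · refine ContDiff.contDiffOn ?_
    simp only [one_div]
    refine ContDiff.inv (ContDiff.sub (Complex.ofRealCLM.contDiff.comp
      (contDiff_const.mul (Real.contDiff_cos.comp (hθ s)))) contDiff_const)
      fun c => ofReal_sub_ne_zero hz _

/-! ### Conjugation-invariant measures and invariant extensions -/

lemma circleMeasure_singleton {c : CircleCoord n} (hc : c ∈ circleDomain n) (s : Fin n) :
    circleMeasure c {(Circle.exp (c.1 s) : ℂ)} =
      ENNReal.ofReal (circleMass c s / ∑ j, circleMass c j) := by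
  unfold circleMeasure
  rw [Measure.finsetSum_apply, Finset.sum_eq_single s]
  · simp
  · intro j _ hj
    have : (Circle.exp (c.1 j) : ℂ) ≠ Circle.exp (c.1 s) :=
      sub_ne_zero.1 (circleExp_sub_ne_zero hc hj)
    simp only [Measure.smul_apply, Measure.dirac_apply, Set.mem_singleton_iff, this,
        Set.indicator_of_notMem, not_false_eq_true, smul_zero]
  · simp

lemma conjMeasure_circleMeasure (c : CircleCoord n) :
    conjMeasure (circleMeasure c) = ∑ s, ENNReal.ofReal (circleMass c s / ∑ j, circleMass c j) •
      Measure.dirac (((Circle.exp (c.1 s))⁻¹ : Circle) : ℂ) := by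
  have hm : Measurable (starRingEnd ℂ) := Complex.continuous_conj.measurable
  unfold conjMeasure circleMeasure
  rw [Measure.map_finset_sum hm.aemeasurable]
  refine Finset.sum_congr rfl fun s _ => ?_
  rw [Measure.map_smul, Measure.map_dirac' hm, Circle.coe_inv_eq_conj]

/-- By invariance the conjugate of an atom carries the same positive mass, hence is an atom.
Distinctness of the atoms makes the resulting choice of indices an involution. -/
lemma exists_perm_of_conjMeasure_eq {c : CircleCoord n} (hc : c ∈ circleDomain n)
    (hinv : conjMeasure (circleMeasure c) = circleMeasure c) :
    ∃ σ : Equiv.Perm (Fin n), (∀ s, σ (σ s) = s) ∧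
      (∀ s, Circle.exp (c.1 (σ s)) = (Circle.exp (c.1 s))⁻¹) ∧
      ∀ s, circleMass c (σ s) = circleMass c s := by
  have hconj : ∀ s, circleMeasure c {(((Circle.exp (c.1 s))⁻¹ : Circle) : ℂ)} =
      ENNReal.ofReal (circleMass c s / ∑ j, circleMass c j) := by
    intro s
    rw [← hinv, conjMeasure, Measure.map_apply Complex.continuous_conj.measurable
      (measurableSet_singleton _), ← circleMeasure_singleton hc s]
    congr 1
    ext w
    simp only [Set.mem_preimage, Set.mem_singleton_iff, Circle.coe_inv_eq_conj]
    exact (starRingEnd ℂ).injective.eq_iff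
  have hex : ∀ s, ∃ s', Circle.exp (c.1 s') = (Circle.exp (c.1 s))⁻¹ := by
    intro s
    by_contra! hne
    have h0 : circleMeasure c {(((Circle.exp (c.1 s))⁻¹ : Circle) : ℂ)} = 0 := by
      unfold circleMeasure
      rw [Measure.finsetSum_apply]
      refine Finset.sum_eq_zero fun j _ => ?_
      have : (Circle.exp (c.1 j) : ℂ) ≠ ((Circle.exp (c.1 s))⁻¹ : Circle) :=
        fun h => hne j (Circle.ext h)
      simp only [Measure.smul_apply, Measure.dirac_apply, Set.mem_singleton_iff, this,
        Set.indicator_of_notMem, not_false_eq_true, smul_zero]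
    rw [hconj s] at h0
    exact (ENNReal.ofReal_pos.2 (circleWeight_pos hc s)).ne' h0
  choose σ hσ using hex
  have hσσ : Function.Involutive σ := fun s => hc.1 (by simp only [hσ, inv_inv])
  refine ⟨hσσ.toPerm, hσσ, hσ, fun s => ?_⟩
  have h1 := circleMeasure_singleton hc (σ s)
  rw [hσ, hconj, ENNReal.ofReal_eq_ofReal_iff (circleWeight_pos hc _).le
    (circleWeight_pos hc _).le, div_left_inj' (sum_circleMass_pos hc s).ne'] at h1
  exact h1.symm

/-- The lift to coordinates of complex conjugation, near a conjugation invariant measure. -/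
def circleReflection (c₀ : CircleCoord n) (σ : Equiv.Perm (Fin n)) (c : CircleCoord n) :
    CircleCoord n :=
  (fun s => -c.1 (σ s) + (c₀.1 s + c₀.1 (σ s)), fun s => c.2 (σ s))

/-- The derivative of `circleReflection`. -/
def circleReflectionDeriv (σ : Equiv.Perm (Fin n)) : CircleCoord n →L[ℝ] CircleCoord n :=
  LinearMap.toContinuousLinearMap
    { toFun := fun c => (fun s => -c.1 (σ s), fun s => c.2 (σ s))
      map_add' := fun a b => by ext <;> simp [add_comm]
      map_smul' := fun r a => by ext <;> simp }

lemma circleReflectionDeriv_apply (σ : Equiv.Perm (Fin n)) (c : CircleCoord n) :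
    circleReflectionDeriv σ c = (fun s => -c.1 (σ s), fun s => c.2 (σ s)) := rfl

lemma norm_inv_sub_inv_circle (a b : Circle) :
    ‖((a⁻¹ : Circle) : ℂ) - ((b⁻¹ : Circle) : ℂ)‖ = ‖(a : ℂ) - (b : ℂ)‖ := by
  rw [Circle.coe_inv_eq_conj, Circle.coe_inv_eq_conj, ← map_sub, Complex.norm_conj]

lemma prod_erase_perm (σ : Equiv.Perm (Fin n)) (s : Fin n) (f : Fin n → ℝ) :
    ∏ j ∈ Finset.univ.erase s, f (σ j) = ∏ j ∈ Finset.univ.erase (σ s), f j :=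
  Finset.prod_equiv σ (by simp) (by simp)

/-- The constant `c₀.1 s + c₀.1 (σ s)` is a multiple of `2π` by `hexp`, hence invisible on the
circle, and conjugation preserves the distances that relate `q` to the masses. -/
lemma circleMeasure_circleReflection {c₀ : CircleCoord n} {σ : Equiv.Perm (Fin n)}
    (hexp : ∀ s, Circle.exp (c₀.1 (σ s)) = (Circle.exp (c₀.1 s))⁻¹) (c : CircleCoord n) :
    circleMeasure (circleReflection c₀ σ c) = conjMeasure (circleMeasure c) := by
  have he : ∀ s, Circle.exp ((circleReflection c₀ σ c).1 s) = (Circle.exp (c.1 (σ s)))⁻¹ := by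
    intro s
    simp only [circleReflection, Circle.exp_add, Circle.exp_neg, hexp, mul_inv_cancel, mul_one]
  have hmass : ∀ s, circleMass (circleReflection c₀ σ c) s = circleMass c (σ s) := by
    intro s
    unfold circleMass
    simp only [he, norm_inv_sub_inv_circle]
    rw [prod_erase_perm σ s fun j => ‖(Circle.exp (c.1 (σ s)) : ℂ) - (Circle.exp (c.1 j) : ℂ)‖]
    rfl
  rw [conjMeasure_circleMeasure, circleMeasure]
  simp only [he, hmass]
  rw [Equiv.sum_comp σ (circleMass c)]
  exact Equiv.sum_comp σ fun s => ENNReal.ofReal (circleMass c s / ∑ j, circleMass c j) •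
      Measure.dirac (((Circle.exp (c.1 s))⁻¹ : Circle) : ℂ)

/-- The constant in `circleReflection` is chosen to fix the angles of `c₀`. Equal masses and equal
products of distances give equal `q`. -/
lemma circleReflection_self {c₀ : CircleCoord n} (hc : c₀ ∈ circleDomain n)
    {σ : Equiv.Perm (Fin n)}
    (hexp : ∀ s, Circle.exp (c₀.1 (σ s)) = (Circle.exp (c₀.1 s))⁻¹)
    (hmass : ∀ s, circleMass c₀ (σ s) = circleMass c₀ s) : circleReflection c₀ σ c₀ = c₀ := by
  refine Prod.ext (funext fun s => ?_) (funext fun s => ?_)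
  · simp [circleReflection]
  · have h1 := hmass s
    unfold circleMass at h1
    rw [← prod_erase_perm σ s fun j => ‖(Circle.exp (c₀.1 (σ s)) : ℂ) - (Circle.exp (c₀.1 j) : ℂ)‖] at h1
    simp only [hexp, norm_inv_sub_inv_circle] at h1
    exact (div_left_inj' (Finset.prod_ne_zero_iff.2 fun j hj =>
      norm_ne_zero_iff.2 (circleExp_sub_ne_zero hc (Finset.ne_of_mem_erase hj).symm))).1 h1

/-- All invariant extensions have the same differential at a conjugation invariant measure. -/
lemma IsInvariantExtension.fderiv_eq {φ Φ Ψ : Measure ℂ → ℂ} (hΦ : IsInvariantExtension n φ Φ)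
    (hΨ : IsInvariantExtension n φ Ψ) {c : CircleCoord n} (hc : c ∈ circleDomain n)
    (hinv : conjMeasure (circleMeasure c) = circleMeasure c) :
    fderiv ℝ (fun c' : CircleCoord n => Φ (circleMeasure c')) c =
      fderiv ℝ (fun c' : CircleCoord n => Ψ (circleMeasure c')) c := by
  obtain ⟨σ, hσ, hexp, hmass⟩ := exists_perm_of_conjMeasure_eq hc hinv
  have hfix := circleReflection_self hc hexp hmass
  have hnhds := (isOpen_circleDomain n).mem_nhds hc
  have hdiff : ∀ {X}, IsInvariantExtension n φ X →
      DifferentiableAt ℝ (fun c' : CircleCoord n => X (circleMeasure c')) c := fun hX =>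
    (hX.smooth.contDiffAt hnhds).differentiableAt (by simp)
  have hline := eventually_add_smul_mem (isOpen_circleDomain n) hc
  -- Invariance of the function passes to its differential at the fixed point, in every direction.
  have hderiv : ∀ {X}, IsInvariantExtension n φ X → ∀ v,
      fderiv ℝ (fun c' : CircleCoord n => X (circleMeasure c')) c (circleReflectionDeriv σ v) =
        fderiv ℝ (fun c' : CircleCoord n => X (circleMeasure c')) c v := by
    intro X hX v
    refine fderiv_apply_eq_of_hasDerivAt (hdiff hX) ?_
    refine (hasDerivAt_comp_line (hdiff hX) v).congr_of_eventuallyEq ?_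
    filter_upwards [hline v] with t ht
    rw [← hX.invariant _ ht, ← circleMeasure_circleReflection hexp]
    congr 2
    conv_lhs => rw [← hfix]
    rw [circleReflectionDeriv_apply]
    refine Prod.ext (funext fun s => ?_) (funext fun s => ?_)
    · simp only [circleReflection, Prod.fst_add, Prod.smul_fst, Pi.add_apply, Pi.smul_apply,
        smul_eq_mul]
      ring
    · simp [circleReflection]
  refine ContinuousLinearMap.ext fun v => ?_
  -- Even and odd parts under the reflection. Invariant differentials kill the odd part; along the
  -- even part the line through `c` consists of conjugation-invariant measures, where both
  -- extensions equal `φ`.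
  have hpm : v = (1 / 2 : ℝ) • (v + circleReflectionDeriv σ v) +
      (1 / 2 : ℝ) • (v - circleReflectionDeriv σ v) := by
    module
  have hinvol : circleReflectionDeriv σ (circleReflectionDeriv σ v) = v := by
    simp [circleReflectionDeriv_apply, hσ]
  have hplus : fderiv ℝ (fun c' : CircleCoord n => Φ (circleMeasure c')) c
      (v + circleReflectionDeriv σ v) = fderiv ℝ (fun c' : CircleCoord n => Ψ (circleMeasure c')) c
      (v + circleReflectionDeriv σ v) := by
    set u := v + circleReflectionDeriv σ v with hu
    have huu : circleReflectionDeriv σ u = u := by rw [hu, map_add, hinvol, add_comm]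
    refine fderiv_apply_eq_of_hasDerivAt (hdiff hΦ) ?_
    refine (hasDerivAt_comp_line (hdiff hΨ) u).congr_of_eventuallyEq ?_
    filter_upwards [hline u] with t ht
    have hft : conjMeasure (circleMeasure (c + t • u)) = circleMeasure (c + t • u) := by
      rw [← circleMeasure_circleReflection hexp]
      congr 1
      conv_rhs => rw [← huu, ← hfix]
      rw [circleReflectionDeriv_apply]
      refine Prod.ext (funext fun s => ?_) (funext fun s => ?_)
      · simp only [circleReflection, Prod.fst_add, Prod.smul_fst, Pi.add_apply, Pi.smul_apply,
          smul_eq_mul]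
        ring
      · simp [circleReflection]
    rw [hΦ.extends_ _ ht hft, hΨ.extends_ _ ht hft]
  have hminus : ∀ {X}, IsInvariantExtension n φ X →
      fderiv ℝ (fun c' : CircleCoord n => X (circleMeasure c')) c
        (v - circleReflectionDeriv σ v) = 0 := fun hX => by
    rw [map_sub, hderiv hX, sub_self]
  have hsplit : ∀ L : CircleCoord n →L[ℝ] ℂ, L v = (1 / 2 : ℝ) • L (v + circleReflectionDeriv σ v) +
      (1 / 2 : ℝ) • L (v - circleReflectionDeriv σ v) := fun L => by
    rw [← map_smul, ← map_smul, ← map_add, ← hpm]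
  rw [hsplit (fderiv ℝ (fun c' : CircleCoord n => Φ (circleMeasure c')) c), hplus, hminus hΦ,
    hsplit (fderiv ℝ (fun c' : CircleCoord n => Ψ (circleMeasure c')) c), hminus hΨ]

/-- `m` serves as its own extension, because conjugation does not change the real part of `z + z⁻¹`.
-/
lemma isInvariantExtension_mFun (n : ℕ) {z : ℂ} (hz : z.im ≠ 0) :
    IsInvariantExtension n (fun μ => mFun (szegoMeasure μ) z) fun μ => mFun (szegoMeasure μ) z where
  smooth := (contDiffOn_circleStieltjes hz).congr fun c hc => mFun_circleMeasure z hc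
  invariant := fun c _ => by
    congr 1
    unfold szegoMeasure conjMeasure
    rw [Measure.map_map (by fun_prop) Complex.continuous_conj.measurable]
    congr 1
    funext w
    simp only [Function.comp_apply]
    rw [← map_inv₀, ← map_add, Complex.conj_re]
  extends_ := fun _ _ _ => rfl

end

/-! ### The cotangent kernel and the bracket (*) on the circle -/

section

/-- Half the cotangent of half the difference. -/
def halfCot (a b : ℝ) : ℝ := Real.sin (a - b) / (2 - 2 * Real.cos (a - b))

lemma halfCot_antisymm (a b : ℝ) : halfCot a b = -halfCot b a := by
  unfold halfCot
  rw [← neg_sub b a, Real.sin_neg, Real.cos_neg, neg_div]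

lemma norm_circleExp_sub (a b : ℝ) :
    ‖(Circle.exp a : ℂ) - (Circle.exp b : ℂ)‖ = √(2 - 2 * Real.cos (a - b)) := by
  rw [Complex.norm_eq_sqrt_sq_add_sq]
  congr 1
  simp only [Circle.coe_exp, Complex.sub_re, Complex.sub_im, Complex.exp_ofReal_mul_I_re,
    Complex.exp_ofReal_mul_I_im, Real.cos_sub]
  linear_combination Real.sin_sq_add_cos_sq a + Real.sin_sq_add_cos_sq b

lemma two_sub_cos_pos {a b : ℝ} (hab : (Circle.exp a : ℂ) - (Circle.exp b : ℂ) ≠ 0) :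
    0 < 2 - 2 * Real.cos (a - b) := by
  have := norm_pos_iff.2 hab
  rw [norm_circleExp_sub] at this
  exact Real.sqrt_pos.1 this

/-- The chord length is `2 |sin ((a - b) / 2)|`, whose logarithmic derivative is half the cotangent
of half the angle. -/
lemma hasDerivAt_norm_circleExp_sub {a b : ℝ → ℝ} {a' b' t : ℝ} (ha : HasDerivAt a a' t)
    (hb : HasDerivAt b b' t) (hab : (Circle.exp (a t) : ℂ) - (Circle.exp (b t) : ℂ) ≠ 0) :
    HasDerivAt (fun t => ‖(Circle.exp (a t) : ℂ) - (Circle.exp (b t) : ℂ)‖)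
      (‖(Circle.exp (a t) : ℂ) - (Circle.exp (b t) : ℂ)‖ * ((a' - b') * halfCot (a t) (b t))) t := by
  simp only [norm_circleExp_sub]
  have hpos := two_sub_cos_pos hab
  refine ((((ha.sub hb).cos.const_mul 2).const_sub 2).sqrt hpos.ne').congr_deriv ?_
  unfold halfCot
  simp only [Pi.sub_apply]
  rw [show 2 - 2 * Real.cos (a t - b t) = √(2 - 2 * Real.cos (a t - b t)) ^ 2 from
    (Real.sq_sqrt hpos.le).symm]
  have h1 : √(2 - 2 * Real.cos (a t - b t)) ≠ 0 := (Real.sqrt_pos.2 hpos).ne'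
  rw [Real.sqrt_sq (Real.sqrt_nonneg _)]
  field_simp

/-- The involution of the atoms negates angles only modulo `2π`, so the kernel has to be a function
of points of the circle. -/
lemma halfCot_congr {a b b' : ℝ} (h : Circle.exp b = Circle.exp b') : halfCot a b = halfCot a b' := by
  have h1 : (Circle.exp (a - b) : ℂ) = Circle.exp (a - b') := by
    rw [Circle.exp_sub, Circle.exp_sub, h]
  have h2 := congrArg Complex.re h1
  have h3 := congrArg Complex.im h1
  simp only [Circle.coe_exp, Complex.exp_ofReal_mul_I_re, Complex.exp_ofReal_mul_I_im] at h2 h3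
  unfold halfCot
  rw [h2, h3]

/-- Halving the cotangent sum formula over a pair of conjugate points. -/
lemma halfCot_add_halfCot_neg {a b : ℝ} (hab : (Circle.exp a : ℂ) - (Circle.exp b : ℂ) ≠ 0)
    (hab' : (Circle.exp a : ℂ) - (Circle.exp (-b) : ℂ) ≠ 0) :
    (halfCot a b + halfCot a (-b)) * (2 * Real.cos b - 2 * Real.cos a) = 2 * Real.sin a := by
  have h1 := two_sub_cos_pos hab
  have h2 := two_sub_cos_pos hab'
  unfold halfCot
  rw [sub_neg_eq_add] at *
  rw [div_add_div _ _ h1.ne' h2.ne']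
  -- The left side is the product of the squared distances from `e^{ia}` to the conjugate pair; its
  -- positivity gives `cos a ≠ cos b` below.
  have h4 : (2 - 2 * Real.cos (a - b)) * (2 - 2 * Real.cos (a + b)) =
      4 * (Real.cos a - Real.cos b) ^ 2 := by
    rw [Real.cos_sub, Real.cos_add]
    linear_combination (-4 * Real.sin b ^ 2) * Real.sin_sq_add_cos_sq a +
      (4 * Real.cos a ^ 2 - 4) * Real.sin_sq_add_cos_sq b
  have h5 : Real.cos a - Real.cos b ≠ 0 := by
    intro h
    rw [h] at h4
    have := mul_pos h1 h2
    rw [h4] at this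
    norm_num at this
  have h6 : Real.sin (a - b) * (2 - 2 * Real.cos (a + b)) +
      (2 - 2 * Real.cos (a - b)) * Real.sin (a + b) = 4 * Real.sin a * (Real.cos b - Real.cos a) := by
    rw [Real.cos_sub, Real.cos_add, Real.sin_sub, Real.sin_add]
    linear_combination (-4 * Real.sin a * Real.cos a) * Real.sin_sq_add_cos_sq b
  rw [h4, h6]
  field_simp
  ring

variable {n : ℕ}

lemma fderiv_circleStieltjes_apply {z : ℂ} (hz : z.im ≠ 0) {c : CircleCoord n}
    (hc : c ∈ circleDomain n) (v : CircleCoord n) :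
    fderiv ℝ (circleStieltjes z) c v =
      ∑ j, ((circleMass c j / ∑ i, circleMass c i : ℝ) : ℂ) *
        ((((v.2 j / c.2 j - ∑ i, (v.1 j - v.1 i) * halfCot (c.1 j) (c.1 i) : ℝ)) : ℂ) *
          (1 / (((2 * Real.cos (c.1 j) : ℝ) : ℂ) - z) - circleStieltjes z c) +
          2 * Real.sin (c.1 j) * v.1 j * (1 / (((2 * Real.cos (c.1 j) : ℝ) : ℂ) - z)) ^ 2) := by
  refine fderiv_apply_eq_of_hasDerivAt (((contDiffOn_circleStieltjes hz).contDiffAt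
    ((isOpen_circleDomain n).mem_nhds hc)).differentiableAt (by simp)) ?_
  have hθ : ∀ j, HasDerivAt (fun t : ℝ => (c + t • v).1 j) (v.1 j) 0 := fun j => by
    simpa using ((hasDerivAt_id (0 : ℝ)).mul_const (v.1 j)).const_add (c.1 j)
  have hm : ∀ j, HasDerivAt (fun t : ℝ => circleMass (c + t • v) j)
      (circleMass (c + (0 : ℝ) • v) j *
        (v.2 j / c.2 j - ∑ i, (v.1 j - v.1 i) * halfCot (c.1 j) (c.1 i))) 0 := by
    intro j
    have hq : HasDerivAt (fun t : ℝ => (c + t • v).2 j)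
        ((c + (0 : ℝ) • v).2 j * (v.2 j / c.2 j)) 0 := by
      have h0 := (hc.2 j).ne'
      have h1 : HasDerivAt (fun t : ℝ => (c + t • v).2 j) (v.2 j) 0 := by
        simpa using ((hasDerivAt_id (0 : ℝ)).mul_const (v.2 j)).const_add (c.2 j)
      refine h1.congr_deriv ?_
      simp only [zero_smul, add_zero]
      field_simp
    have hne : ∀ i ∈ Finset.univ.erase j, (Circle.exp ((c + (0 : ℝ) • v).1 j) : ℂ) -
        (Circle.exp ((c + (0 : ℝ) • v).1 i) : ℂ) ≠ 0 := fun i hi => by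
      simpa only [zero_smul, add_zero] using circleExp_sub_ne_zero hc (Finset.ne_of_mem_erase hi).symm
    refine (hasDerivAt_div_prod hq
      (fun i hi => hasDerivAt_norm_circleExp_sub (hθ j) (hθ i) (hne i hi))
      fun i hi => norm_ne_zero_iff.2 (hne i hi)).congr_deriv ?_
    unfold circleMass
    -- The sum in the statement also contains `i = j`, which is harmless since the factor `v.1 j -
    -- v.1 j` is zero.
    rw [← Finset.sum_erase (Finset.univ) (a := j)
      (f := fun i => (v.1 j - v.1 i) * halfCot (c.1 j) (c.1 i)) (by simp)]
    simp only [zero_smul, add_zero]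
  have hg : ∀ j, HasDerivAt (fun t : ℝ => 1 / (((2 * Real.cos ((c + t • v).1 j) : ℝ) : ℂ) - z))
      (2 * Real.sin (c.1 j) * v.1 j * (1 / (((2 * Real.cos (c.1 j) : ℝ) : ℂ) - z)) ^ 2) 0 := by
    intro j
    have h0 := ofReal_sub_ne_zero hz (2 * Real.cos (c.1 j))
    have h1 := (((hθ j).cos.const_mul 2).ofReal_comp.sub_const z).inv
      (ofReal_sub_ne_zero hz (2 * Real.cos ((c + (0 : ℝ) • v).1 j)))
    simp only [one_div]
    refine h1.congr_deriv ?_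
    simp only [zero_smul, add_zero]
    push_cast at h0 ⊢
    field_simp
  -- For `n = 0` the total mass is zero and the differentiation of the quotient is not available;
  -- both sides vanish.
  rcases isEmpty_or_nonempty (Fin n) with hn | ⟨⟨s⟩⟩
  · simpa [circleStieltjes] using hasDerivAt_const (0 : ℝ) (0 : ℂ)
  have hM : ∑ i, circleMass (c + (0 : ℝ) • v) i ≠ 0 := by
    simpa only [zero_smul, add_zero] using (sum_circleMass_pos hc s).ne'
  refine (hasDerivAt_weightedAverage hm hg hM).congr_deriv ?_
  simp only [zero_smul, add_zero]
  rfl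

/-- `sum_canonical_bracket` leaves double poles and a double sum with the cotangent kernel.
Averaging the inner sum over `j` and its conjugate index `σ j` replaces the cotangents by `2 sin θ_s
/ (x_j - x_s)`, and this denominator cancels against `stieltjesKernel_offdiag`. -/
lemma hBracket_circleStieltjes {h : Circle → ℝ} (h_odd : ∀ z : Circle, h z⁻¹ = -h z) {z w : ℂ}
    (hz : z.im ≠ 0) (hw : w.im ≠ 0) (hzw : z ≠ w) {c : CircleCoord n} (hc : c ∈ circleDomain n)
    (hinv : conjMeasure (circleMeasure c) = circleMeasure c) :
    hBracket h (circleStieltjes z) (circleStieltjes w) c =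
      bracketRHS (mFunH (hTransform h) (szegoMeasure (circleMeasure c)))
        (szegoMeasure (circleMeasure c)) z w := by
  obtain ⟨σ, hσ, hexp, hmass⟩ := exists_perm_of_conjMeasure_eq hc hinv
  set μ : Fin n → ℂ := fun s => ((circleMass c s / ∑ j, circleMass c j : ℝ) : ℂ) with hμ
  set x : Fin n → ℝ := fun s => 2 * Real.cos (c.1 s) with hx
  set a : Fin n → ℂ := fun s => 1 / ((x s : ℂ) - z) with ha
  set b : Fin n → ℂ := fun s => 1 / ((x s : ℂ) - w) with hb
  set κ : Fin n → Fin n → ℂ := fun i j => (halfCot (c.1 i) (c.1 j) : ℂ) with hκ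
  set A : Fin n → ℂ := fun s => (2 * h (Circle.exp (c.1 s)) : ℂ) with hA
  set H : Fin n → ℂ := fun s => (hTransform h (x s) : ℂ) with hH
  have hma : circleStieltjes z c = ∑ i, μ i * a i := rfl
  have hmb : circleStieltjes w c = ∑ i, μ i * b i := rfl
  have hHA : ∀ s, H s = A s * Real.sin (c.1 s) := fun s => by
    simp only [hH, hx, hA, hTransform_two_mul_cos h_odd]
    push_cast
    ring
  have hRHS : bracketRHS (mFunH (hTransform h) (szegoMeasure (circleMeasure c)))
        (szegoMeasure (circleMeasure c)) z w =
      (∑ s, H s * μ s * a s - ∑ s, H s * μ s * b s) *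
        ((∑ i, μ i * a i - ∑ i, μ i * b i) / (z - w) - (∑ i, μ i * a i) * ∑ i, μ i * b i) := by
    unfold bracketRHS
    rw [mFun_circleMeasure _ hc, mFun_circleMeasure _ hc, mFunH_circleMeasure _ _ hc,
      mFunH_circleMeasure _ _ hc, hma, hmb]
    congr 1
    congr 1 <;>
    · refine Finset.sum_congr rfl fun s _ => ?_
      simp only [hH, hμ, ha, hb, hx]
      ring
  -- The bracket contains `q ∂/∂q`, the derivative with respect to `log q`; before normalization
  -- only the mass at `s` reacts.
  have hqderiv : ∀ {u : ℂ}, u.im ≠ 0 → ∀ s, (c.2 s : ℂ) * fderiv ℝ (circleStieltjes u) c (0, Pi.single s 1) =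
      μ s * (1 / ((x s : ℂ) - u) - circleStieltjes u c) := by
    intro u hu s
    have h0 : (c.2 s : ℂ) ≠ 0 := by exact_mod_cast (hc.2 s).ne'
    rw [fderiv_circleStieltjes_apply hu hc, Finset.sum_eq_single s]
    · simp [hμ, hx]
      field_simp
    · intro j _ hj
      simp [hj]
    · simp
  have hθderiv : ∀ {u : ℂ}, u.im ≠ 0 → ∀ s, fderiv ℝ (circleStieltjes u) c (Pi.single s 1, 0) =
      2 * Real.sin (c.1 s) * μ s * (1 / ((x s : ℂ) - u)) ^ 2 -
        ∑ j, κ s j * (μ s * (1 / ((x s : ℂ) - u) - circleStieltjes u c) +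
          μ j * (1 / ((x j : ℂ) - u) - circleStieltjes u c)) := by
    intro u hu s
    have key := sum_mul_antisymm_direction μ (fun j => 1 / ((x j : ℂ) - u) - circleStieltjes u c) κ
      (fun i j => by simp only [hκ]; rw [halfCot_antisymm]; push_cast; rfl) s
    rw [fderiv_circleStieltjes_apply hu hc]
    simp only [mul_add, Finset.sum_add_distrib] at key ⊢
    rw [sub_eq_neg_add]
    refine congrArg₂ (· + ·) (Eq.trans (Finset.sum_congr rfl fun j _ => ?_) key) ?_
    · congr 2
      simp only [hκ, Pi.single_apply, Pi.zero_apply, zero_div, zero_sub]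
      push_cast
      simp only [apply_ite (fun r : ℝ => (r : ℂ)), Complex.ofReal_one, Complex.ofReal_zero]
    · rw [Finset.sum_eq_single s]
      · simp [hμ, hx]
        ring
      · intro j _ hj
        simp [hj]
      · simp
  have hab : ∀ s, a s - b s = (z - w) * (a s * b s) := fun s => by
    have h1 := ofReal_sub_ne_zero hz (x s)
    have h2 := ofReal_sub_ne_zero hw (x s)
    simp only [ha, hb]
    field_simp
    ring
  have haa : ∀ {u : ℂ}, u.im ≠ 0 → ∀ s j, 1 / ((x s : ℂ) - u) - 1 / ((x j : ℂ) - u) =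
      ((x j : ℂ) - x s) * (1 / ((x s : ℂ) - u) * (1 / ((x j : ℂ) - u))) := fun hu s j => by
    have h1 := ofReal_sub_ne_zero hu (x s)
    have h2 := ofReal_sub_ne_zero hu (x j)
    field_simp
    ring
  have hxσ : ∀ s, x (σ s) = x s := fun s => by
    have h1 := congrArg (fun v : Circle => (v : ℂ).re) (hexp s)
    simp only [← Circle.exp_neg, Circle.coe_exp, Complex.exp_ofReal_mul_I_re, Real.cos_neg] at h1
    simp only [hx, h1]
  have hμσ : ∀ s, μ (σ s) = μ s := fun s => by simp only [hμ, hmass]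
  set D := stieltjesKernel (z - w) (∑ i, μ i * a i) (∑ i, μ i * b i) a b with hD
  rw [hRHS, ← sum_stieltjesKernel H μ a b (sub_ne_zero.2 hzw) hab]
  have hLHS : hBracket h (circleStieltjes z) (circleStieltjes w) c =
      ∑ s, A s * ((2 * Real.sin (c.1 s) * μ s * a s ^ 2 -
          ∑ j, κ s j * (μ s * (a s - circleStieltjes z c) + μ j * (a j - circleStieltjes z c))) *
            (μ s * (b s - circleStieltjes w c)) -
        (μ s * (a s - circleStieltjes z c)) * (2 * Real.sin (c.1 s) * μ s * b s ^ 2 -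
          ∑ j, κ s j * (μ s * (b s - circleStieltjes w c) + μ j * (b j - circleStieltjes w c)))) := by
    unfold hBracket
    refine Finset.sum_congr rfl fun s _ => ?_
    rw [hθderiv hz, hθderiv hw, ← hqderiv hz, ← hqderiv hw]
    simp only [hA]
    push_cast
    ring
  rw [hLHS, sum_canonical_bracket, hma, hmb]
  set ma := ∑ i, μ i * a i
  set mb := ∑ i, μ i * b i
  -- `E s j` sees `j` only through `μ j` and `x j`, so replacing `j` by `σ j` changes the kernel `κ`
  -- alone.
  set E : Fin n → Fin n → ℂ := fun s j =>
    μ s * μ j * ((a j - ma) * (b s - mb) - (b j - mb) * (a s - ma)) with hE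
  have hED : ∀ s j, E s j = -(((x j : ℂ) - x s) * (μ s * μ j * D s j)) := fun s j => by
    have hoff := stieltjesKernel_offdiag (ma := ma) (mb := mb) (hab s) (haa hz s j) (haa hw s j)
    simp only [hE]
    rw [hoff]
    ring
  have hEσ : ∀ s j, E s (σ j) = E s j := fun s j => by simp only [hE, hμσ, ha, hb, hxσ]
  have hDσ : ∀ s, D s (σ s) = D s s := fun s => by
    simp only [hD, stieltjesKernel, ha, hb, hxσ]
  -- An atom without a distinct partner is real, and there the oddness of `h` forces it to vanish.
  have hHσ : ∀ s, σ s = s → H s = 0 := fun s hs => by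
    have h1 := hexp s
    rw [hs] at h1
    have h2 := h_odd (Circle.exp (c.1 s))
    rw [← h1, self_eq_neg] at h2
    simp [hHA, hA, h2]
  -- The cotangent formula excludes `j = s` and `j = σ s`. There `E` is zero, and the two correction
  -- terms account for this; they overlap only at a fixed atom, where `H s = 0`.
  have hpair : ∀ s j, A s * (κ s j + κ s (σ j)) * E s j =
      -(2 * (H s * μ s * μ j * D s j)) + (if j = s then 2 * (H s * μ s * μ j * D s j) else 0) +
        (if j = σ s then 2 * (H s * μ s * μ j * D s j) else 0) := by
    intro s j
    by_cases hjs : j = s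
    · subst hjs
      by_cases hs : j = σ j
      · simp [hED, hHσ j hs.symm]
      · simp [hED, hs]
    · by_cases hjσ : j = σ s
      · simp [hED, hjσ, hxσ, show σ s ≠ s from fun h => hjs (hjσ.trans h)]
      · have hκσ : κ s (σ j) = (halfCot (c.1 s) (-c.1 j) : ℂ) := by
          simp only [hκ]
          rw [halfCot_congr (b := c.1 (σ j)) (b' := -c.1 j) (by rw [hexp, Circle.exp_neg])]
        have h1 := halfCot_add_halfCot_neg (circleExp_sub_ne_zero hc (Ne.symm hjs)) (by
          rw [Circle.exp_neg, ← hexp]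
          exact circleExp_sub_ne_zero hc fun h => hjσ (by rw [h, hσ]))
        have h2 := congrArg (fun r : ℝ => (r : ℂ)) h1
        rw [hED, hκσ, if_neg hjs, if_neg hjσ, hHA]
        simp only [hκ, hx]
        push_cast at h2 ⊢
        linear_combination (-(A s * μ s * μ j * D s j)) * h2
  -- Reindexing by `σ` doubles the sum. The two exceptional indices contribute equal corrections,
  -- and after halving these cancel the double poles of `hdiag`.
  have hsum : ∀ s, 2 * ∑ j, A s * κ s j * E s j =
      -(2 * ∑ j, H s * μ s * μ j * D s j) + 4 * (H s * μ s * μ s * D s s) := by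
    intro s
    have h1 : ∑ j, A s * κ s j * E s j = ∑ j, A s * κ s (σ j) * E s j := by
      rw [← Equiv.sum_comp σ]
      simp only [hEσ]
    rw [two_mul]
    nth_rewrite 2 [h1]
    rw [← Finset.sum_add_distrib]
    have h2 : ∀ j, A s * κ s j * E s j + A s * κ s (σ j) * E s j =
        A s * (κ s j + κ s (σ j)) * E s j := fun j => by ring
    rw [Finset.sum_congr rfl fun j _ => (h2 j).trans (hpair s j), Finset.sum_add_distrib,
      Finset.sum_add_distrib, Finset.sum_ite_eq', Finset.sum_ite_eq', Finset.sum_neg_distrib,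
      Finset.mul_sum]
    simp only [Finset.mem_univ, if_true, hμσ, hDσ]
    ring
  have hdiag : ∀ s, A s * μ s * (2 * Real.sin (c.1 s) * μ s * a s ^ 2 * (b s - mb) -
      2 * Real.sin (c.1 s) * μ s * b s ^ 2 * (a s - ma)) = 2 * (H s * μ s * μ s * D s s) := by
    intro s
    have h1 := stieltjesKernel_diag (ma := ma) (mb := mb) (hab s)
    rw [hHA, hD, ← h1]
    ring
  rw [Finset.sum_congr rfl fun s _ => hdiag s, ← Finset.sum_sub_distrib]
  refine Finset.sum_congr rfl fun s _ => ?_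
  linear_combination (-1 / 2 : ℂ) * hsum s

/-- The restriction of the `h`-bracket to conjugation invariant measures, on Stieltjes transforms. -/
lemma probBracket_mFun {h : Circle → ℝ} (h_odd : ∀ z : Circle, h z⁻¹ = -h z) {z w : ℂ}
    (hz : z.im ≠ 0) (hw : w.im ≠ 0) (hzw : z ≠ w) {Φ Ψ : Measure ℂ → ℂ}
    (hΦ : IsInvariantExtension n (fun μ => mFun (szegoMeasure μ) z) Φ)
    (hΨ : IsInvariantExtension n (fun μ => mFun (szegoMeasure μ) w) Ψ)
    {c : CircleCoord n} (hc : c ∈ circleDomain n)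
    (hinv : conjMeasure (circleMeasure c) = circleMeasure c) :
    probBracket n h Φ Ψ c = bracketRHS (mFunH (hTransform h) (szegoMeasure (circleMeasure c)))
      (szegoMeasure (circleMeasure c)) z w := by
  have hfd : ∀ {u : ℂ} {X : Measure ℂ → ℂ}, u.im ≠ 0 →
      IsInvariantExtension n (fun μ => mFun (szegoMeasure μ) u) X →
      fderiv ℝ (fun c' : CircleCoord n => X (circleMeasure c')) c =
        fderiv ℝ (circleStieltjes u) c := fun {u X} hu hX => by
    rw [hX.fderiv_eq (isInvariantExtension_mFun n hu) hc hinv]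
    refine Filter.EventuallyEq.fderiv_eq ?_
    filter_upwards [(isOpen_circleDomain n).mem_nhds hc] with c' hc'
    exact mFun_circleMeasure u hc'
  rw [← hBracket_circleStieltjes h_odd hz hw hzw hc hinv]
  unfold probBracket hBracket
  rw [hfd hz hΦ, hfd hw hΨ]

end

section

/-! ### A canonical chart on the manifold of spectral measures -/

/-- Canonical coordinates `(x, u)` on the cone over the manifold of spectral measures: the weights
are proportional to `e^{u_j} / ∏_{i ≠ j} |x_j - x_i|`. -/
abbrev ChartCoord (N : ℕ) : Type := (Fin N → ℝ) × (Fin N → ℝ)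

/-- The domain of the canonical coordinates. -/
def chartDomain (N : ℕ) : Set (ChartCoord N) :=
  {c | StrictMono c.1 ∧ ∀ j, c.1 j ∈ Set.Ioo (-2 : ℝ) 2}

variable {N : ℕ}

lemma isOpen_setOf_strictMono (N : ℕ) : IsOpen {c : ChartCoord N | StrictMono c.1} := by
  have : {c : ChartCoord N | StrictMono c.1} =
      ⋂ i : Fin N, ⋂ j : Fin N, {c : ChartCoord N | i < j → c.1 i < c.1 j} := by
    ext c
    simp only [Set.mem_iInter, Set.mem_ofPred_eq]
    exact ⟨fun h i j hij => h hij, fun h i j hij => h i j hij⟩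
  rw [this]
  refine isOpen_iInter_of_finite fun i => isOpen_iInter_of_finite fun j => ?_
  by_cases hij : i < j
  · simp only [hij, forall_const]
    exact isOpen_lt (by fun_prop) (by fun_prop)
  · simp [hij]

lemma isOpen_chartDomain (N : ℕ) : IsOpen (chartDomain N) := by
  have : chartDomain N = {c : ChartCoord N | StrictMono c.1} ∩
      ⋂ j : Fin N, {c : ChartCoord N | c.1 j ∈ Set.Ioo (-2 : ℝ) 2} := by
    ext c; simp [chartDomain]
  rw [this]
  exact (isOpen_setOf_strictMono N).inter (isOpen_iInter_of_finite fun j =>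
    isOpen_Ioo.preimage (by fun_prop))

lemma isOpen_spectralDomain (N : ℕ) : IsOpen (spectralDomain N) := by
  have : spectralDomain N = chartDomain N ∩ ⋂ j : Fin N, {c : ChartCoord N | 0 < c.2 j} := by
    ext c; simp [chartDomain, spectralDomain, and_assoc]
  rw [this]
  exact (isOpen_chartDomain N).inter (isOpen_iInter_of_finite fun j =>
    isOpen_lt continuous_const (by fun_prop))

/-- Convexity is what Hadamard's lemma needs: every point is joined to the base point by a segment
inside the domain. -/
lemma convex_spectralDomain (N : ℕ) : Convex ℝ (spectralDomain N) := by
  intro a ha b hb s t hs ht hst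
  refine ⟨fun i j hij => ?_, fun j => ?_, fun j => ?_⟩
  · have h1 := ha.1 hij
    have h2 := hb.1 hij
    simp only [Prod.fst_add, Prod.smul_fst, Pi.add_apply, Pi.smul_apply, smul_eq_mul]
    rcases hs.eq_or_lt with rfl | hs
    · have : t = 1 := by linarith
      subst this; linarith
    · nlinarith [mul_lt_mul_of_pos_left h1 hs, mul_le_mul_of_nonneg_left h2.le ht]
  · exact (convex_Ioo (-2 : ℝ) 2) (ha.2.1 j) (hb.2.1 j) hs ht hst
  · exact (convex_Ioi (0 : ℝ)) (ha.2.2 j) (hb.2.2 j) hs ht hst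

lemma SpectralData.mem_spectralDomain (p : SpectralData N) : (p.x, p.w) ∈ spectralDomain N :=
  ⟨p.strictMono_x, p.mem_x, p.pos_w⟩

/-- The Vandermonde factor `∏_{i ≠ j} |x_j - x_i|`. -/
def nodeFactor (x : Fin N → ℝ) (j : Fin N) : ℝ := ∏ i ∈ Finset.univ.erase j, |x j - x i|

lemma nodeFactor_pos {x : Fin N → ℝ} (hx : StrictMono x) (j : Fin N) : 0 < nodeFactor x j :=
  Finset.prod_pos fun _ hi => abs_pos.2 (sub_ne_zero.2 (hx.injective.ne (Finset.ne_of_mem_erase hi).symm))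

/-- The unnormalized weights in the canonical coordinates. -/
def chartDensity (c : ChartCoord N) (j : Fin N) : ℝ := Real.exp (c.2 j) / nodeFactor c.1 j

lemma chartDensity_pos {c : ChartCoord N} (hc : c ∈ chartDomain N) (j : Fin N) :
    0 < chartDensity c j :=
  div_pos (Real.exp_pos _) (nodeFactor_pos hc.1 j)

lemma sum_chartDensity_pos {c : ChartCoord N} (hc : c ∈ chartDomain N) (j : Fin N) :
    0 < ∑ i, chartDensity c i :=
  Finset.sum_pos (fun i _ => chartDensity_pos hc i) ⟨j, Finset.mem_univ j⟩

/-- The map from the canonical coordinates to nodes and weights. -/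
def chartMap (c : ChartCoord N) : (Fin N → ℝ) × (Fin N → ℝ) :=
  (c.1, fun j => chartDensity c j / ∑ i, chartDensity c i)

/-- Canonical coordinates of a point given by nodes and weights. -/
def chartInv (y : (Fin N → ℝ) × (Fin N → ℝ)) : ChartCoord N :=
  (y.1, fun j => Real.log (y.2 j * nodeFactor y.1 j))

lemma chartMap_mem {c : ChartCoord N} (hc : c ∈ chartDomain N) : chartMap c ∈ spectralDomain N :=
  ⟨hc.1, hc.2, fun j => div_pos (chartDensity_pos hc j) (sum_chartDensity_pos hc j)⟩

lemma chartInv_mem {y : (Fin N → ℝ) × (Fin N → ℝ)} (hy : y ∈ spectralDomain N) :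
    chartInv y ∈ chartDomain N :=
  ⟨hy.1, hy.2.1⟩

/-- The spectral measure with given canonical coordinates. -/
def ofChart [NeZero N] (c : ChartCoord N) (hc : c ∈ chartDomain N) : SpectralData N where
  x := c.1
  w := (chartMap c).2
  strictMono_x := hc.1
  mem_x := hc.2
  pos_w := (chartMap_mem hc).2.2
  sum_w := by
    simp only [chartMap]
    rw [← Finset.sum_div, div_self (sum_chartDensity_pos hc 0).ne']

lemma chartDensity_chartInv {y : (Fin N → ℝ) × (Fin N → ℝ)} (hy : y ∈ spectralDomain N) (j : Fin N) :
    chartDensity (chartInv y) j = y.2 j := by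
  have h1 := nodeFactor_pos hy.1 j
  simp only [chartDensity, chartInv]
  rw [Real.exp_log (mul_pos (hy.2.2 j) h1), mul_div_cancel_right₀ _ h1.ne']

/-- The canonical coordinates of a spectral measure. -/
def SpectralData.chart (p : SpectralData N) : ChartCoord N := chartInv (p.x, p.w)

lemma SpectralData.chart_mem (p : SpectralData N) : p.chart ∈ chartDomain N :=
  chartInv_mem p.mem_spectralDomain

lemma SpectralData.chartDensity_chart (p : SpectralData N) (j : Fin N) :
    chartDensity p.chart j = p.w j :=
  chartDensity_chartInv p.mem_spectralDomain j

lemma ofChart_chart [NeZero N] (p : SpectralData N) : ofChart p.chart p.chart_mem = p := by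
  ext j
  · rfl
  · simp only [ofChart, chartMap, p.chartDensity_chart, p.sum_w, div_one]

/-- Translations along the diagonal of the `u` coordinates. -/
def diagShift (r : ℝ) : ChartCoord N := (0, fun _ => r)

/-- `ofChart` forgets the total mass, so the round trip recovers `c` only up to a diagonal shift of
the `u` coordinates. -/
lemma chart_ofChart [NeZero N] {c : ChartCoord N} (hc : c ∈ chartDomain N) :
    (ofChart c hc).chart = c + diagShift (-Real.log (∑ i, chartDensity c i)) := by
  have hS := sum_chartDensity_pos hc 0
  refine Prod.ext (by simp [SpectralData.chart, chartInv, ofChart, diagShift]) (funext fun j => ?_)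
  have h1 := nodeFactor_pos hc.1 j
  simp only [SpectralData.chart, chartInv, ofChart, chartMap, diagShift, Prod.snd_add, Pi.add_apply]
  rw [← Real.log_exp (c.2 j), ← sub_eq_add_neg, ← Real.log_div (Real.exp_pos _).ne' hS.ne']
  congr 1
  unfold chartDensity
  field_simp

lemma chartDensity_add_diagShift (c : ChartCoord N) (r : ℝ) (j : Fin N) :
    chartDensity (c + diagShift r) j = Real.exp r * chartDensity c j := by
  simp only [chartDensity, diagShift, Prod.snd_add, Pi.add_apply, Prod.fst_add, add_zero,
    Real.exp_add]
  ring

lemma add_diagShift_mem {c : ChartCoord N} (hc : c ∈ chartDomain N) (r : ℝ) :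
    c + diagShift r ∈ chartDomain N := by
  simpa [chartDomain, diagShift] using hc

lemma ofChart_add_diagShift [NeZero N] {c : ChartCoord N} (hc : c ∈ chartDomain N) (r : ℝ) :
    ofChart (c + diagShift r) (add_diagShift_mem hc r) = ofChart c hc := by
  ext j
  · simp [ofChart, diagShift]
  · simp only [ofChart, chartMap, chartDensity_add_diagShift]
    rw [← Finset.mul_sum, mul_div_mul_left _ _ (Real.exp_pos r).ne']

lemma contDiffOn_nodeFactor (j : Fin N) :
    ContDiffOn ℝ ∞ (fun c : ChartCoord N => nodeFactor c.1 j) {c | StrictMono c.1} :=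
  contDiffOn_prod fun i hi c hc => ContDiffAt.contDiffWithinAt <|
    (contDiffAt_abs (sub_ne_zero.2 (StrictMono.injective hc |>.ne
      (Finset.ne_of_mem_erase hi).symm))).comp (g := fun t : ℝ => |t|) c
      (f := fun c : ChartCoord N => c.1 j - c.1 i) (by fun_prop)

lemma contDiffOn_chartDensity (j : Fin N) :
    ContDiffOn ℝ ∞ (fun c : ChartCoord N => chartDensity c j) (chartDomain N) :=
  ContDiffOn.div (by fun_prop) ((contDiffOn_nodeFactor j).mono fun _ hc => hc.1)
    fun _ hc => (nodeFactor_pos hc.1 j).ne'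

lemma contDiffOn_chartMap : ContDiffOn ℝ ∞ (chartMap (N := N)) (chartDomain N) :=
  contDiffOn_fst.prodMk (contDiffOn_pi.2 fun j => (contDiffOn_chartDensity j).div
    (ContDiffOn.sum fun i _ => contDiffOn_chartDensity i)
    fun _ hc => (sum_chartDensity_pos hc j).ne')

lemma contDiffOn_chartInv : ContDiffOn ℝ ∞ (chartInv (N := N)) (spectralDomain N) := by
  refine contDiffOn_fst.prodMk (contDiffOn_pi.2 fun j => ContDiffOn.log (ContDiffOn.mul
    (by fun_prop) ((contDiffOn_nodeFactor j).mono fun _ hc => hc.1)) fun y hy => ?_)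
  exact (mul_pos (hy.2.2 j) (nodeFactor_pos hy.1 j)).ne'

/-- A function on the manifold in the canonical coordinates. -/
def pullback [NeZero N] (f : SpectralData N → ℝ) (c : ChartCoord N) : ℝ :=
  open Classical in if hc : c ∈ chartDomain N then f (ofChart c hc) else 0

lemma pullback_of_mem [NeZero N] (f : SpectralData N → ℝ) {c : ChartCoord N}
    (hc : c ∈ chartDomain N) : pullback f c = f (ofChart c hc) := dif_pos hc

lemma pullback_eqOn [NeZero N] {f : SpectralData N → ℝ} {F : (Fin N → ℝ) × (Fin N → ℝ) → ℝ}
    (hF : ∀ p : SpectralData N, F (p.x, p.w) = f p) :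
    Set.EqOn (pullback f) (F ∘ chartMap) (chartDomain N) := fun c hc => by
  rw [pullback_of_mem f hc, ← hF]
  rfl

lemma contDiffOn_pullback [NeZero N] (f : smoothFunctions N) :
    ContDiffOn ℝ ∞ (pullback f.1) (chartDomain N) := by
  obtain ⟨F, hF, hf⟩ := f.2
  exact (hF.comp contDiffOn_chartMap fun c hc => chartMap_mem hc).congr (pullback_eqOn hf)

lemma differentiableAt_pullback [NeZero N] (f : smoothFunctions N) {c : ChartCoord N}
    (hc : c ∈ chartDomain N) : DifferentiableAt ℝ (pullback f.1) c :=
  ((contDiffOn_pullback f).contDiffAt ((isOpen_chartDomain N).mem_nhds hc)).differentiableAt (by simp)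

lemma contDiffOn_fderiv_pullback [NeZero N] (f : smoothFunctions N) :
    ContDiffOn ℝ ∞ (fderiv ℝ (pullback f.1)) (chartDomain N) :=
  ((contDiffOn_pullback f).fderiv_of_isOpen (isOpen_chartDomain N) (by simp))

lemma pullback_chart [NeZero N] (f : SpectralData N → ℝ) (p : SpectralData N) :
    pullback f p.chart = f p := by
  rw [pullback_of_mem f p.chart_mem, ofChart_chart]

lemma pullback_add_diagShift [NeZero N] (f : SpectralData N → ℝ) (c : ChartCoord N) (r : ℝ) :
    pullback f (c + diagShift r) = pullback f c := by
  by_cases hc : c ∈ chartDomain N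
  · rw [pullback_of_mem f hc, pullback_of_mem f (add_diagShift_mem hc r), ofChart_add_diagShift]
  · have : c + diagShift r ∉ chartDomain N := by simpa [chartDomain, diagShift] using hc
    simp only [pullback, hc, this, dif_neg, not_false_eq_true]

/-- Functions on the manifold see the chart only modulo diagonal shifts, so their differentials
agree at all lifts of a point. This lets constant vector fields of the chart descend to derivations.
-/
lemma fderiv_pullback_add_diagShift [NeZero N] (f : SpectralData N → ℝ) (c : ChartCoord N) (r : ℝ) :
    fderiv ℝ (pullback f) (c + diagShift r) = fderiv ℝ (pullback f) c := by
  rw [← fderiv_comp_add_right]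
  simp only [pullback_add_diagShift]

/-- The smooth function given by a function of nodes and weights. -/
def smoothOf (F : (Fin N → ℝ) × (Fin N → ℝ) → ℝ) (hF : ContDiffOn ℝ ∞ F (spectralDomain N)) :
    smoothFunctions N :=
  ⟨fun p => F (p.x, p.w), F, hF, fun _ => rfl⟩

/-- The derivation of the algebra of smooth functions given by a constant vector in the canonical
coordinates. -/
def dirDeriv [NeZero N] (v : ChartCoord N) :
    Derivation ℝ (smoothFunctions N) (smoothFunctions N) :=
  Derivation.mk'
    { toFun := fun f => smoothOf (fun y => fderiv ℝ (pullback f.1) (chartInv y) v)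
        (((contDiffOn_fderiv_pullback f).comp contDiffOn_chartInv
          fun y hy => chartInv_mem hy).clm_apply contDiffOn_const)
      map_add' := fun f g => Subtype.ext <| funext fun p => by
        have h : pullback (f + g).1 = pullback f.1 + pullback g.1 := by
          funext c
          by_cases hc : c ∈ chartDomain N <;> simp [pullback, hc]
        change fderiv ℝ (pullback (f + g).1) p.chart v =
          fderiv ℝ (pullback f.1) p.chart v + fderiv ℝ (pullback g.1) p.chart v
        rw [h, fderiv_add (differentiableAt_pullback f p.chart_mem)
          (differentiableAt_pullback g p.chart_mem)]
        rfl
      map_smul' := fun r f => Subtype.ext <| funext fun p => by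
        have h : pullback (r • f).1 = r • pullback f.1 := by
          funext c
          by_cases hc : c ∈ chartDomain N <;> simp [pullback, hc]
        change fderiv ℝ (pullback (r • f).1) p.chart v = r * fderiv ℝ (pullback f.1) p.chart v
        rw [h, fderiv_const_smul (differentiableAt_pullback f p.chart_mem)]
        rfl }
    fun f g => Subtype.ext <| funext fun p => by
      have h : pullback (f * g).1 = pullback f.1 * pullback g.1 := by
        funext c
        by_cases hc : c ∈ chartDomain N <;> simp [pullback, hc]
      change fderiv ℝ (pullback (f * g).1) p.chart v =
        f.1 p * fderiv ℝ (pullback g.1) p.chart v + g.1 p * fderiv ℝ (pullback f.1) p.chart v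
      rw [h, fderiv_mul (differentiableAt_pullback f p.chart_mem)
        (differentiableAt_pullback g p.chart_mem)]
      simp [pullback_chart]

lemma dirDeriv_apply [NeZero N] (v : ChartCoord N) (f : smoothFunctions N) (p : SpectralData N) :
    (dirDeriv v f).1 p = fderiv ℝ (pullback f.1) p.chart v := rfl

lemma pullback_dirDeriv [NeZero N] (v : ChartCoord N) (f : smoothFunctions N) {c : ChartCoord N}
    (hc : c ∈ chartDomain N) :
    pullback (dirDeriv v f).1 c = fderiv ℝ (pullback f.1) c v := by
  rw [pullback_of_mem _ hc, dirDeriv_apply, chart_ofChart, fderiv_pullback_add_diagShift]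

/-- By `pullback_dirDeriv` the iterated derivation is a second derivative in the chart, which is
symmetric. -/
lemma dirDeriv_comm [NeZero N] (v w : ChartCoord N) (f : smoothFunctions N) :
    dirDeriv v (dirDeriv w f) = dirDeriv w (dirDeriv v f) := by
  refine Subtype.ext <| funext fun p => ?_
  have hnhds := (isOpen_chartDomain N).mem_nhds p.chart_mem
  have hd : DifferentiableAt ℝ (fderiv ℝ (pullback f.1)) p.chart :=
    ((contDiffOn_fderiv_pullback f).contDiffAt hnhds).differentiableAt (by simp)
  have key : ∀ a b : ChartCoord N, (dirDeriv a (dirDeriv b f)).1 p =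
      fderiv ℝ (fderiv ℝ (pullback f.1)) p.chart a b := by
    intro a b
    have h1 : pullback (dirDeriv b f).1 =ᶠ[𝓝 p.chart] fun c => fderiv ℝ (pullback f.1) c b := by
      filter_upwards [hnhds] with c hc using pullback_dirDeriv b f hc
    rw [dirDeriv_apply, h1.fderiv_eq, fderiv_clm_apply hd (differentiableAt_const _)]
    simp
  rw [key, key]
  exact (((contDiffOn_pullback f).contDiffAt hnhds).isSymmSndFDerivAt
    (by rw [minSmoothness_of_isRCLikeNormedField]; exact WithTop.coe_le_coe.2 (le_top (a := (2 : ℕ∞))))).eq v w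

end

section

/-! ### Poisson brackets from commuting derivations -/

section Derivations

variable {A ι : Type*} [CommRing A] [Algebra ℝ A] [Fintype ι]

/-- The bracket `∑_s (X_s f · Y_s g - Y_s f · X_s g)`. -/
def derivationBracket (X Y : ι → Derivation ℝ A A) : A →ₗ[ℝ] A →ₗ[ℝ] A :=
  LinearMap.mk₂ ℝ (fun f g => ∑ s, (X s f * Y s g - Y s f * X s g))
    (fun f f' g => by
      rw [← Finset.sum_add_distrib]
      exact Finset.sum_congr rfl fun s _ => by simp only [map_add]; ring)
    (fun r f g => by
      rw [Finset.smul_sum]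
      refine Finset.sum_congr rfl fun s _ => ?_
      simp only [Derivation.map_smul, smul_sub, smul_mul_assoc])
    (fun f g g' => by
      rw [← Finset.sum_add_distrib]
      exact Finset.sum_congr rfl fun s _ => by simp only [map_add]; ring)
    (fun r f g => by
      rw [Finset.smul_sum]
      refine Finset.sum_congr rfl fun s _ => ?_
      simp only [Derivation.map_smul, smul_sub, mul_smul_comm])

lemma derivationBracket_apply (X Y : ι → Derivation ℝ A A) (f g : A) :
    derivationBracket X Y f g = ∑ s, (X s f * Y s g - Y s f * X s g) := rfl

lemma derivationBracket_skew (X Y : ι → Derivation ℝ A A) (f g : A) :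
    derivationBracket X Y f g = -derivationBracket X Y g f := by
  simp only [derivationBracket_apply, ← Finset.sum_neg_distrib]
  exact Finset.sum_congr rfl fun s _ => by ring

lemma derivationBracket_leibniz (X Y : ι → Derivation ℝ A A) (f g k : A) :
    derivationBracket X Y f (g * k) =
      derivationBracket X Y f g * k + g * derivationBracket X Y f k := by
  simp only [derivationBracket_apply, Finset.sum_mul, Finset.mul_sum, ← Finset.sum_add_distrib]
  exact Finset.sum_congr rfl fun s _ => by simp only [Derivation.leibniz, smul_eq_mul]; ring

/-- After the Leibniz expansion the cyclic sum of the terms with index pair `(s, r)` is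
antisymmetric in `s` and `r`, once the commuting derivations are reordered. The double sum is
therefore its own negative. -/
lemma derivationBracket_jacobi {X Y : ι → Derivation ℝ A A}
    (hXX : ∀ s r f, X s (X r f) = X r (X s f)) (hYY : ∀ s r f, Y s (Y r f) = Y r (Y s f))
    (hXY : ∀ s r f, X s (Y r f) = Y r (X s f)) (f g k : A) :
    derivationBracket X Y f (derivationBracket X Y g k) +
      derivationBracket X Y g (derivationBracket X Y k f) +
        derivationBracket X Y k (derivationBracket X Y f g) = 0 := by
  set T : A → A → A → ι → ι → A := fun f g k s r =>
    X s f * (Y s (X r g) * Y r k + X r g * Y s (Y r k) - Y s (Y r g) * X r k -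
        Y r g * Y s (X r k)) -
      Y s f * (X s (X r g) * Y r k + X r g * X s (Y r k) - X s (Y r g) * X r k -
        Y r g * X s (X r k)) with hT
  have h1 : ∀ f g k : A, derivationBracket X Y f (derivationBracket X Y g k) =
      ∑ s, ∑ r, T f g k s r := by
    intro f g k
    simp only [derivationBracket_apply, map_sum, map_sub, Derivation.leibniz, smul_eq_mul,
      ← Finset.sum_sub_distrib]
    rw [Finset.sum_comm]
    exact Finset.sum_congr rfl fun s _ => Finset.sum_congr rfl fun r _ => by
      simp only [hT]; ring
  set S : ι → ι → A := fun s r => T f g k s r + T g k f s r + T k f g s r with hS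
  have h2 : ∑ s, ∑ r, S s r = 0 := by
    have hneg : ∀ s r, S s r = -S r s := by
      intro s r
      simp only [hS, hT]
      rw [hXX r s f, hXX r s g, hXX r s k, hYY r s f, hYY r s g, hYY r s k, hXY s r f, hXY s r g,
        hXY s r k, hXY r s f, hXY r s g, hXY r s k]
      ring
    have hswap : ∑ s, ∑ r, S s r = -∑ s, ∑ r, S s r := by
      conv_lhs => rw [Finset.sum_comm]
      simp only [← Finset.sum_neg_distrib]
      exact Finset.sum_congr rfl fun s _ => Finset.sum_congr rfl fun r _ => hneg r s
    have h3 : (2 : ℝ) • ∑ s, ∑ r, S s r = 0 := by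
      rw [two_smul]
      nth_rewrite 1 [hswap]
      exact neg_add_cancel _
    have h4 := congrArg (fun a => (1 / 2 : ℝ) • a) h3
    simpa [smul_smul] using h4
  simp only [h1, ← Finset.sum_add_distrib]
  exact h2

end Derivations

/-! ### The Poisson bracket attached to a function H -/

variable {N : ℕ} [NeZero N]

/-- The direction of the coordinate `x_s`. -/
def nodeDir (s : Fin N) : ChartCoord N := (Pi.single s 1, 0)

/-- The direction of the coordinate `u_s`. -/
def logDir (s : Fin N) : ChartCoord N := (0, Pi.single s 1)

omit [NeZero N] in
lemma contDiffOn_nodeFunction {H : ℝ → ℝ} (hH : ContDiffOn ℝ ∞ H (Set.Ioo (-2) 2)) (s : Fin N) :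
    ContDiffOn ℝ ∞ (fun y : (Fin N → ℝ) × (Fin N → ℝ) => H (y.1 s)) (spectralDomain N) :=
  hH.comp (by fun_prop) fun y hy => hy.2.1 s

/-- The function `H(x_s)`. -/
def nodeFunction {H : ℝ → ℝ} (hH : ContDiffOn ℝ ∞ H (Set.Ioo (-2) 2)) (s : Fin N) :
    smoothFunctions N :=
  smoothOf (fun y => H (y.1 s)) (contDiffOn_nodeFunction hH s)

lemma dirDeriv_nodeFunction {H : ℝ → ℝ} (hH : ContDiffOn ℝ ∞ H (Set.Ioo (-2) 2)) {s : Fin N}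
    {v : ChartCoord N} (hv : v.1 s = 0) : dirDeriv v (nodeFunction hH s) = 0 := by
  refine Subtype.ext <| funext fun p => ?_
  rw [dirDeriv_apply]
  refine fderiv_apply_eq_of_hasDerivAt (differentiableAt_pullback _ p.chart_mem) ?_
  refine (hasDerivAt_const (0 : ℝ) (H (p.x s))).congr_of_eventuallyEq ?_
  filter_upwards [eventually_add_smul_mem (isOpen_chartDomain N) p.chart_mem v] with t ht
  rw [pullback_of_mem _ ht]
  simp [nodeFunction, smoothOf, ofChart, hv, SpectralData.chart, chartInv]

/-- The Poisson bracket with `{u_s, x_s} = H(x_s)`. -/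
def hamBracket {H : ℝ → ℝ} (hH : ContDiffOn ℝ ∞ H (Set.Ioo (-2) 2)) : Bracket N :=
  derivationBracket (fun s => -(nodeFunction hH s • dirDeriv (nodeDir s)))
    (fun s => dirDeriv (logDir s))

/-- `H(x_s)` is annihilated by every coordinate direction other than that of `x_s`, so the fields
`-H(x_s) ∂/∂x_s` and `∂/∂u_r` all commute. -/
lemma isPoissonBracket_hamBracket {H : ℝ → ℝ} (hH : ContDiffOn ℝ ∞ H (Set.Ioo (-2) 2)) :
    IsPoissonBracket (hamBracket hH : Bracket N) where
  skew := derivationBracket_skew _ _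
  leibniz := derivationBracket_leibniz _ _
  jacobi := by
    refine derivationBracket_jacobi (fun s r f => ?_) (fun s r f => dirDeriv_comm _ _ _)
      fun s r f => ?_
    · rcases eq_or_ne s r with rfl | hsr
      · rfl
      · simp only [Derivation.neg_apply, Derivation.smul_apply, map_neg, smul_eq_mul,
          Derivation.leibniz, dirDeriv_comm (nodeDir s) (nodeDir r)]
        rw [dirDeriv_nodeFunction hH (v := nodeDir s) (by simp [nodeDir, hsr.symm]),
          dirDeriv_nodeFunction hH (v := nodeDir r) (by simp [nodeDir, hsr])]
        ring
    · simp only [Derivation.neg_apply, Derivation.smul_apply, map_neg, smul_eq_mul,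
        Derivation.leibniz, dirDeriv_comm (nodeDir s) (logDir r)]
      rw [dirDeriv_nodeFunction hH (v := logDir r) (by simp [logDir])]
      ring

lemma hamBracket_apply {H : ℝ → ℝ} (hH : ContDiffOn ℝ ∞ H (Set.Ioo (-2) 2))
    (f g : smoothFunctions N) (p : SpectralData N) :
    (hamBracket hH f g).1 p = ∑ s, -H (p.x s) *
      ((dirDeriv (nodeDir s) f).1 p * (dirDeriv (logDir s) g).1 p -
        (dirDeriv (logDir s) f).1 p * (dirDeriv (nodeDir s) g).1 p) := by
  have h : hamBracket hH f g = ∑ s, -nodeFunction hH s *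
      (dirDeriv (nodeDir s) f * dirDeriv (logDir s) g -
        dirDeriv (logDir s) f * dirDeriv (nodeDir s) g) := by
    rw [hamBracket, derivationBracket_apply]
    refine Finset.sum_congr rfl fun s _ => ?_
    simp only [Derivation.neg_apply, Derivation.smul_apply, smul_eq_mul]
    ring
  rw [h, AddSubmonoidClass.coe_finsetSum, Finset.sum_apply]
  rfl

/-! ### The bracket of two Stieltjes transforms -/

/-- The Stieltjes transform in the canonical coordinates. -/
def chartStieltjes (z : ℂ) (c : ChartCoord N) : ℂ :=
  ∑ j, ((chartDensity c j / ∑ i, chartDensity c i : ℝ) : ℂ) * (1 / ((c.1 j : ℂ) - z))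

lemma mFun_ofChart (z : ℂ) {c : ChartCoord N} (hc : c ∈ chartDomain N) :
    mFun (ofChart c hc).measure z = chartStieltjes z c := by
  rw [mFun_measure]
  rfl

lemma mFun_eq_chartStieltjes (z : ℂ) (p : SpectralData N) :
    mFun p.measure z = chartStieltjes z p.chart := by
  rw [← mFun_ofChart z p.chart_mem, ofChart_chart]

omit [NeZero N] in
lemma contDiffOn_chartStieltjes {z : ℂ} (hz : z.im ≠ 0) :
    ContDiffOn ℝ ∞ (chartStieltjes z : ChartCoord N → ℂ) (chartDomain N) :=
  (contDiffOn_mFun_aux z hz (spectralDomain N)).comp contDiffOn_chartMap fun _ hc => chartMap_mem hc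

-- The sign of `a - b` disappears in the logarithmic derivative, so the interaction kernel on the
-- line is rational.
omit [NeZero N] in
lemma hasDerivAt_abs_sub {a b : ℝ → ℝ} {a' b' t : ℝ} (ha : HasDerivAt a a' t)
    (hb : HasDerivAt b b' t) (hab : a t - b t ≠ 0) :
    HasDerivAt (fun t => |a t - b t|) (|a t - b t| * ((a' - b') * (1 / (a t - b t)))) t := by
  refine ((hasDerivAt_abs hab).comp t (ha.sub hb)).congr_deriv ?_
  rcases lt_or_gt_of_ne hab with h | h
  · simp only [sign_neg h, abs_of_neg h, SignType.coe_neg, SignType.coe_one]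
    field_simp
  · simp only [sign_pos h, abs_of_pos h, SignType.coe_one]
    field_simp

lemma fderiv_chartStieltjes_apply {z : ℂ} (hz : z.im ≠ 0) {c : ChartCoord N}
    (hc : c ∈ chartDomain N) (v : ChartCoord N) :
    fderiv ℝ (chartStieltjes z) c v =
      ∑ j, ((chartDensity c j / ∑ i, chartDensity c i : ℝ) : ℂ) *
        ((((v.2 j - ∑ i, (v.1 j - v.1 i) * (1 / (c.1 j - c.1 i)) : ℝ)) : ℂ) *
          (1 / ((c.1 j : ℂ) - z) - chartStieltjes z c) -
          v.1 j * (1 / ((c.1 j : ℂ) - z)) ^ 2) := by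
  refine fderiv_apply_eq_of_hasDerivAt (((contDiffOn_chartStieltjes hz).contDiffAt
    ((isOpen_chartDomain N).mem_nhds hc)).differentiableAt (by simp)) ?_
  have hx : ∀ j, HasDerivAt (fun t : ℝ => (c + t • v).1 j) (v.1 j) 0 := fun j => by
    simpa using ((hasDerivAt_id (0 : ℝ)).mul_const (v.1 j)).const_add (c.1 j)
  have hm : ∀ j, HasDerivAt (fun t : ℝ => chartDensity (c + t • v) j)
      (chartDensity (c + (0 : ℝ) • v) j *
        (v.2 j - ∑ i, (v.1 j - v.1 i) * (1 / (c.1 j - c.1 i)))) 0 := by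
    intro j
    have hq : HasDerivAt (fun t : ℝ => Real.exp ((c + t • v).2 j))
        (Real.exp ((c + (0 : ℝ) • v).2 j) * v.2 j) 0 := by
      have h1 : HasDerivAt (fun t : ℝ => (c + t • v).2 j) (v.2 j) 0 := by
        simpa using ((hasDerivAt_id (0 : ℝ)).mul_const (v.2 j)).const_add (c.2 j)
      exact h1.exp
    have hne : ∀ i ∈ Finset.univ.erase j, (c + (0 : ℝ) • v).1 j - (c + (0 : ℝ) • v).1 i ≠ 0 :=
      fun i hi => by
        simpa only [zero_smul, add_zero] using
          sub_ne_zero.2 (hc.1.injective.ne (Finset.ne_of_mem_erase hi).symm)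
    refine (hasDerivAt_div_prod hq (fun i hi => hasDerivAt_abs_sub (hx j) (hx i) (hne i hi))
      fun i hi => abs_ne_zero.2 (hne i hi)).congr_deriv ?_
    unfold chartDensity nodeFactor
    rw [← Finset.sum_erase (Finset.univ) (a := j)
      (f := fun i => (v.1 j - v.1 i) * (1 / (c.1 j - c.1 i))) (by simp)]
    simp only [zero_smul, add_zero]
  have hg : ∀ j, HasDerivAt (fun t : ℝ => 1 / (((c + t • v).1 j : ℂ) - z))
      (-(v.1 j * (1 / ((c.1 j : ℂ) - z)) ^ 2)) 0 := by
    intro j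
    have h0 := ofReal_sub_ne_zero hz (c.1 j)
    have h1 := ((hx j).ofReal_comp.sub_const z).inv (ofReal_sub_ne_zero hz ((c + (0 : ℝ) • v).1 j))
    simp only [one_div]
    refine h1.congr_deriv ?_
    simp only [zero_smul, add_zero]
    field_simp
  have hM : ∑ i, chartDensity (c + (0 : ℝ) • v) i ≠ 0 := by
    simpa only [zero_smul, add_zero] using (sum_chartDensity_pos hc 0).ne'
  refine (hasDerivAt_weightedAverage hm hg hM).congr_deriv ?_
  simp only [zero_smul, add_zero, ← sub_eq_add_neg]
  rfl

lemma fderiv_chartStieltjes_logDir {z : ℂ} (hz : z.im ≠ 0) (p : SpectralData N) (s : Fin N) :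
    fderiv ℝ (chartStieltjes z) p.chart (logDir s) =
      p.w s * (1 / ((p.x s : ℂ) - z) - mFun p.measure z) := by
  rw [fderiv_chartStieltjes_apply hz p.chart_mem, mFun_eq_chartStieltjes, Finset.sum_eq_single s]
  · simp [logDir, p.chartDensity_chart, p.sum_w]
    simp [SpectralData.chart, chartInv]
  · intro j _ hj
    simp [logDir, hj]
  · simp

/-- The reactions of all masses are collected by `sum_mul_antisymm_direction`. The sum may run over
all `j`, since at `j = s` division by zero gives zero. -/
lemma fderiv_chartStieltjes_nodeDir {z : ℂ} (hz : z.im ≠ 0) (p : SpectralData N) (s : Fin N) :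
    fderiv ℝ (chartStieltjes z) p.chart (nodeDir s) =
      -(p.w s * (1 / ((p.x s : ℂ) - z)) ^ 2) -
        ∑ j, 1 / ((p.x s : ℂ) - p.x j) * (p.w s * (1 / ((p.x s : ℂ) - z) - mFun p.measure z) +
          p.w j * (1 / ((p.x j : ℂ) - z) - mFun p.measure z)) := by
  have key := sum_mul_antisymm_direction (fun j => (p.w j : ℂ))
    (fun j => 1 / ((p.x j : ℂ) - z) - mFun p.measure z) (fun i j => 1 / ((p.x i : ℂ) - p.x j))
      (fun i j => by rw [← neg_sub, one_div_neg_eq_neg_one_div]) s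
  rw [fderiv_chartStieltjes_apply hz p.chart_mem]
  simp only [p.chartDensity_chart, p.sum_w, div_one, ← mFun_eq_chartStieltjes]
  simp only [mul_sub (_ : ℂ) (_ * _) (_ * _), Finset.sum_sub_distrib]
  rw [sub_eq_add_neg, sub_eq_add_neg, add_comm (-((p.w s : ℂ) * _))]
  refine congrArg₂ (· + ·) (Eq.trans (Finset.sum_congr rfl fun j _ => ?_) key) ?_
  · congr 2
    simp only [nodeDir, Pi.single_apply, Pi.zero_apply, zero_sub, SpectralData.chart, chartInv]
    push_cast
    simp only [apply_ite (fun r : ℝ => (r : ℂ)), Complex.ofReal_one, Complex.ofReal_zero]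
  · rw [Finset.sum_eq_single s]
    · simp [nodeDir, SpectralData.chart, chartInv]
    · intro j _ hj
      simp [nodeDir, hj]
    · simp

/-- The complexified derivations of a Stieltjes transform. -/
lemma dirDeriv_mRe_add_mIm {z : ℂ} (hz : z.im ≠ 0) (v : ChartCoord N) (p : SpectralData N) :
    (((dirDeriv v (mRe N z hz)).1 p : ℝ) : ℂ) + ((dirDeriv v (mIm N z hz)).1 p : ℝ) * Complex.I =
      fderiv ℝ (chartStieltjes z) p.chart v := by
  have hd : DifferentiableAt ℝ (chartStieltjes z) p.chart :=
    ((contDiffOn_chartStieltjes hz).contDiffAt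
      ((isOpen_chartDomain N).mem_nhds p.chart_mem)).differentiableAt (by simp)
  have h1 : (dirDeriv v (mRe N z hz)).1 p = (fderiv ℝ (chartStieltjes z) p.chart v).re := by
    rw [dirDeriv_apply]
    refine fderiv_apply_eq_of_hasDerivAt (differentiableAt_pullback _ p.chart_mem) ?_
    have h2 := (Complex.reCLM.hasFDerivAt (x := chartStieltjes z (p.chart + (0 : ℝ) • v))).comp_hasDerivAt
      (0 : ℝ) (hasDerivAt_comp_line hd v)
    refine h2.congr_of_eventuallyEq ?_
    filter_upwards [eventually_add_smul_mem (isOpen_chartDomain N) p.chart_mem v] with t ht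
    rw [pullback_of_mem _ ht]
    simp [mRe, mFun_ofChart]
  have h1' : (dirDeriv v (mIm N z hz)).1 p = (fderiv ℝ (chartStieltjes z) p.chart v).im := by
    rw [dirDeriv_apply]
    refine fderiv_apply_eq_of_hasDerivAt (differentiableAt_pullback _ p.chart_mem) ?_
    have h2 := (Complex.imCLM.hasFDerivAt (x := chartStieltjes z (p.chart + (0 : ℝ) • v))).comp_hasDerivAt
      (0 : ℝ) (hasDerivAt_comp_line hd v)
    refine h2.congr_of_eventuallyEq ?_
    filter_upwards [eventually_add_smul_mem (isOpen_chartDomain N) p.chart_mem v] with t ht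
    rw [pullback_of_mem _ ht]
    simp [mIm, mFun_ofChart]
  rw [h1, h1', Complex.re_add_im]

omit [NeZero N] in
lemma mFunH_measure (H : ℝ → ℝ) (p : SpectralData N) (z : ℂ) :
    mFunH H p.measure z = ∑ j, (p.w j : ℂ) * (H (p.x j) / ((p.x j : ℂ) - z)) := by
  unfold mFunH SpectralData.measure
  rw [integral_sum_dirac fun j => (p.pos_w j).le]
  simp only [Complex.real_smul]

/-- The computation of the circle with the kernel `1 / (x_s - x_j)`, whose pole is cancelled by
`stieltjesKernel_offdiag` without any pairing of nodes. The minus sign in `hamBracket` compensates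
for the sign of the double pole. -/
lemma isHBracket_hamBracket {H : ℝ → ℝ} (hH : ContDiffOn ℝ ∞ H (Set.Ioo (-2) 2)) :
    IsHBracket H (hamBracket hH : Bracket N) := by
  refine ⟨isPoissonBracket_hamBracket hH, fun z w hz hw hzw p => ?_⟩
  set μ : Fin N → ℂ := fun s => (p.w s : ℂ) with hμ
  set a : Fin N → ℂ := fun s => 1 / ((p.x s : ℂ) - z) with ha
  set b : Fin N → ℂ := fun s => 1 / ((p.x s : ℂ) - w) with hb
  set K : Fin N → ℂ := fun s => (H (p.x s) : ℂ) with hK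
  set κ : Fin N → Fin N → ℂ := fun i j => 1 / ((p.x i : ℂ) - p.x j) with hκ
  have hma : mFun p.measure z = ∑ i, μ i * a i := mFun_measure p z
  have hmb : mFun p.measure w = ∑ i, μ i * b i := mFun_measure p w
  have hab : ∀ s, a s - b s = (z - w) * (a s * b s) := fun s => by
    have h1 := ofReal_sub_ne_zero hz (p.x s)
    have h2 := ofReal_sub_ne_zero hw (p.x s)
    simp only [ha, hb]
    field_simp
    ring
  have haa : ∀ {u : ℂ}, u.im ≠ 0 → ∀ s j, 1 / ((p.x s : ℂ) - u) - 1 / ((p.x j : ℂ) - u) =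
      ((p.x j : ℂ) - p.x s) * (1 / ((p.x s : ℂ) - u) * (1 / ((p.x j : ℂ) - u))) := fun hu s j => by
    have h1 := ofReal_sub_ne_zero hu (p.x s)
    have h2 := ofReal_sub_ne_zero hu (p.x j)
    field_simp
    ring
  have hRHS : bracketRHS (mFunH H p.measure) p.measure z w =
      (∑ s, K s * μ s * a s - ∑ s, K s * μ s * b s) *
        ((∑ i, μ i * a i - ∑ i, μ i * b i) / (z - w) - (∑ i, μ i * a i) * ∑ i, μ i * b i) := by
    unfold bracketRHS
    rw [hma, hmb, mFunH_measure, mFunH_measure]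
    congr 1
    congr 1 <;>
    · refine Finset.sum_congr rfl fun s _ => ?_
      simp only [hK, hμ, ha, hb]
      ring
  have hLHS : complexBracket (hamBracket hH) (mRe N z hz) (mIm N z hz) (mRe N w hw) (mIm N w hw) p =
      ∑ s, -K s * ((-(μ s * a s ^ 2) - ∑ j, κ s j * (μ s * (a s - mFun p.measure z) +
          μ j * (a j - mFun p.measure z))) * (μ s * (b s - mFun p.measure w)) -
        μ s * (a s - mFun p.measure z) * (-(μ s * b s ^ 2) - ∑ j, κ s j *
          (μ s * (b s - mFun p.measure w) + μ j * (b j - mFun p.measure w)))) := by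
    unfold complexBracket
    simp only [hamBracket_apply]
    push_cast
    rw [← Finset.sum_sub_distrib, ← Finset.sum_add_distrib, Finset.sum_mul,
      ← Finset.sum_add_distrib]
    refine Finset.sum_congr rfl fun s _ => ?_
    simp only [hμ, ha, hb, hκ]
    rw [← fderiv_chartStieltjes_nodeDir hz, ← fderiv_chartStieltjes_nodeDir hw,
      ← fderiv_chartStieltjes_logDir hz, ← fderiv_chartStieltjes_logDir hw,
      ← dirDeriv_mRe_add_mIm hz, ← dirDeriv_mRe_add_mIm hz, ← dirDeriv_mRe_add_mIm hw,
      ← dirDeriv_mRe_add_mIm hw]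
    simp only [hK]
    -- Recombining real and imaginary parts uses `I ^ 2 = -1` in the products of imaginary parts.
    linear_combination (H (p.x s) : ℂ) *
      ((((dirDeriv (nodeDir s) (mIm N z hz)).1 p : ℝ) : ℂ) *
        (((dirDeriv (logDir s) (mIm N w hw)).1 p : ℝ) : ℂ) -
      (((dirDeriv (logDir s) (mIm N z hz)).1 p : ℝ) : ℂ) *
        (((dirDeriv (nodeDir s) (mIm N w hw)).1 p : ℝ) : ℂ)) * Complex.I_sq
  rw [hLHS, hRHS, ← sum_stieltjesKernel K μ a b (sub_ne_zero.2 hzw) hab, sum_canonical_bracket,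
    hma, hmb, ← Finset.sum_sub_distrib]
  refine Finset.sum_congr rfl fun s _ => ?_
  set ma := ∑ i, μ i * a i
  set mb := ∑ i, μ i * b i
  rw [← Finset.add_sum_erase _ _ (Finset.mem_univ s), ← Finset.add_sum_erase _ _ (Finset.mem_univ s),
    ← stieltjesKernel_diag (ma := ma) (mb := mb) (hab s)]
  have hoff : ∀ j ∈ Finset.univ.erase s, K s * μ s * μ j * stieltjesKernel (z - w) ma mb a b s j =
      -(-K s * κ s j * (μ s * μ j * ((a j - ma) * (b s - mb) - (b j - mb) * (a s - ma)))) := by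
    intro j hj
    have hne : (p.x s : ℂ) - p.x j ≠ 0 := by
      exact_mod_cast sub_ne_zero.2 (p.strictMono_x.injective.ne (Finset.ne_of_mem_erase hj).symm)
    rw [stieltjesKernel_offdiag (ma := ma) (mb := mb) (hab s) (haa hz s j) (haa hw s j)]
    simp only [hκ]
    field_simp
    ring
  rw [Finset.sum_congr rfl hoff, Finset.sum_neg_distrib]
  -- The interaction at `j = s` is `1 / 0 = 0`, so only the double poles remain on the diagonal.
  simp only [hκ, sub_self, div_zero]
  ring

end

section

/-! ### Hadamard's lemma -/

section Hadamard

variable {E : Type} [NormedAddCommGroup E] [NormedSpace ℝ E]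

lemma segment_mem {U : Set E} (hU : Convex ℝ U) {p y : E} (hp : p ∈ U) (hy : y ∈ U) {t : ℝ}
    (ht : t ∈ Set.Icc (0 : ℝ) 1) : p + t • (y - p) ∈ U :=
  hU.add_smul_sub_mem hp hy ht

/-- The segments from `p` to a small closed ball sweep out a compact set, which yields the constant
dominating function for the parameter integrals below. -/
lemma exists_bound_on_segments [FiniteDimensional ℝ E] {F : Type} [NormedAddCommGroup F] {U : Set E} (hUo : IsOpen U)
    (hU : Convex ℝ U) {p : E} (hp : p ∈ U) {φ : E → F} (hφ : ContinuousOn φ U) {y₀ : E}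
    (hy₀ : y₀ ∈ U) : ∃ s ∈ 𝓝 y₀, s ⊆ U ∧ ∃ C : ℝ, ∀ y ∈ s, ∀ t ∈ Set.Icc (0 : ℝ) 1,
      ‖φ (p + t • (y - p))‖ ≤ C := by
  have : ProperSpace E := FiniteDimensional.proper ℝ E
  obtain ⟨ε, hε, hball⟩ := Metric.nhds_basis_closedBall.mem_iff.1 (hUo.mem_nhds hy₀)
  have hK : IsCompact ((fun q : ℝ × E => p + q.1 • (q.2 - p)) ''
      (Set.Icc (0 : ℝ) 1 ×ˢ Metric.closedBall y₀ ε)) :=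
    (isCompact_Icc.prod (isCompact_closedBall y₀ ε)).image (by fun_prop)
  obtain ⟨C, hC⟩ := hK.exists_bound_of_continuousOn (hφ.mono (by
    rintro _ ⟨⟨t, y⟩, ⟨ht, hy⟩, rfl⟩
    exact segment_mem hU hp (hball hy) ht))
  exact ⟨Metric.closedBall y₀ ε, Metric.closedBall_mem_nhds y₀ hε, hball, C, fun y hy t ht =>
    hC _ ⟨(t, y), ⟨ht, hy⟩, rfl⟩⟩

lemma continuousOn_segment_integrand {F : Type} [NormedAddCommGroup F] [NormedSpace ℝ F] {U : Set E}
    (hU : Convex ℝ U) {p : E} (hp : p ∈ U) {φ : E → F} (hφ : ContinuousOn φ U) (k : ℕ) {y : E}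
    (hy : y ∈ U) : ContinuousOn (fun t : ℝ => t ^ k • φ (p + t • (y - p))) (Set.Icc 0 1) :=
  ContinuousOn.smul (by fun_prop) (hφ.comp (by fun_prop) fun t ht => segment_mem hU hp hy ht)

/-- Differentiation under the integral lowers `n` by one, raises `k` by one and replaces `φ` by its
differential. The induction therefore treats all `k` and all target spaces at once. -/
lemma contDiffOn_segment_integral [FiniteDimensional ℝ E] {U : Set E} (hUo : IsOpen U) (hU : Convex ℝ U) {p : E} (hp : p ∈ U)
    (n : ℕ) : ∀ {F : Type} [NormedAddCommGroup F] [NormedSpace ℝ F] {φ : E → F} (k : ℕ),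
      ContDiffOn ℝ n φ U →
      ContDiffOn ℝ n (fun y => ∫ t in (0 : ℝ)..1, t ^ k • φ (p + t • (y - p))) U := by
  have hIoc : ∀ {t : ℝ}, t ∈ Set.uIoc (0 : ℝ) 1 → t ∈ Set.Icc (0 : ℝ) 1 := fun ht => by
    rw [Set.uIoc_of_le zero_le_one] at ht
    exact Set.Ioc_subset_Icc_self ht
  have hmeas : ∀ {F : Type} [NormedAddCommGroup F] [NormedSpace ℝ F] {φ : E → F} (k : ℕ),
      ContinuousOn φ U → ∀ y ∈ U, AEStronglyMeasurable (fun t : ℝ => t ^ k • φ (p + t • (y - p)))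
        (volume.restrict (Set.uIoc (0 : ℝ) 1)) := fun k hφ y hy =>
    ((continuousOn_segment_integrand hU hp hφ k hy).mono fun t ht => hIoc ht).aestronglyMeasurable
      measurableSet_uIoc
  have hpow : ∀ {F : Type} [NormedAddCommGroup F] [NormedSpace ℝ F] {a : F} {C : ℝ} (k : ℕ) {t : ℝ},
      t ∈ Set.Icc (0 : ℝ) 1 → ‖a‖ ≤ C → ‖t ^ k • a‖ ≤ C := by
    intro F _ _ a C k t ht ha
    rw [norm_smul, norm_pow, Real.norm_of_nonneg ht.1]
    exact (mul_le_of_le_one_left (norm_nonneg a) (pow_le_one₀ ht.1 ht.2)).trans ha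
  induction n with
  | zero =>
    intro F _ _ φ k hφ
    simp only [CharP.cast_eq_zero, contDiffOn_zero] at hφ ⊢
    intro y₀ hy₀
    obtain ⟨s, hs, hsU, C, hC⟩ := exists_bound_on_segments hUo hU hp hφ hy₀
    refine (intervalIntegral.continuousAt_of_dominated_interval (bound := fun _ => C) ?_ ?_
      intervalIntegrable_const ?_).continuousWithinAt
    · filter_upwards [hs] with y hy using hmeas k hφ y (hsU hy)
    · filter_upwards [hs] with y hy
      exact Filter.Eventually.of_forall fun t ht => hpow k (hIoc ht) (hC y hy t (hIoc ht))
    · refine Filter.Eventually.of_forall fun t ht => ContinuousAt.smul continuousAt_const ?_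
      exact ContinuousAt.comp (g := φ) (hφ.continuousAt
        (hUo.mem_nhds (segment_mem hU hp hy₀ (hIoc ht)))) (by fun_prop)
  | succ n ih =>
    intro F _ _ φ k hφ
    push_cast at hφ ⊢
    obtain ⟨hd, -, hfd⟩ := (contDiffOn_succ_iff_fderiv_of_isOpen hUo).1 hφ
    have hderiv : ∀ y₀ ∈ U, HasFDerivAt (fun y => ∫ t in (0 : ℝ)..1, t ^ k • φ (p + t • (y - p)))
        (∫ t in (0 : ℝ)..1, t ^ (k + 1) • fderiv ℝ φ (p + t • (y₀ - p))) y₀ := by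
      intro y₀ hy₀
      obtain ⟨s, hs, hsU, C, hC⟩ := exists_bound_on_segments hUo hU hp hfd.continuousOn hy₀
      refine intervalIntegral.hasFDerivAt_integral_of_dominated_of_fderiv_le (bound := fun _ => C)
        (F' := fun y t => t ^ (k + 1) • fderiv ℝ φ (p + t • (y - p))) hs ?_ ?_ ?_ ?_
        intervalIntegrable_const ?_
      · filter_upwards [hs] with y hy using hmeas k hφ.continuousOn y (hsU hy)
      · refine ContinuousOn.intervalIntegrable ?_
        rw [Set.uIcc_of_le zero_le_one]
        exact continuousOn_segment_integrand hU hp hφ.continuousOn k hy₀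
      · exact hmeas (k + 1) hfd.continuousOn y₀ hy₀
      · exact Filter.Eventually.of_forall fun t ht y hy =>
          hpow (k + 1) (hIoc ht) (hC y hy t (hIoc ht))
      · refine Filter.Eventually.of_forall fun t ht y hy => ?_
        have h1 : HasFDerivAt φ (fderiv ℝ φ (p + t • (y - p))) (p + t • (y - p)) :=
          (hd.differentiableAt (hUo.mem_nhds
            (segment_mem hU hp (hsU hy) (hIoc ht)))).hasFDerivAt
        have h2 : HasFDerivAt (fun y : E => p + t • (y - p)) (t • ContinuousLinearMap.id ℝ E) y :=
          (((hasFDerivAt_id y).sub_const p).const_smul t).const_add p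
        refine ((h1.comp y h2).const_smul (t ^ k)).congr_fderiv ?_
        ext v
        simp [pow_succ, smul_smul]
    refine (contDiffOn_succ_iff_fderiv_of_isOpen hUo).2
      ⟨fun y hy => (hderiv y hy).differentiableAt.differentiableWithinAt, by simp, ?_⟩
    exact (ih (k + 1) hfd).congr fun y hy => (hderiv y hy).fderiv

/-- Hadamard's lemma on a convex open set. -/
lemma exists_hadamard_factor [FiniteDimensional ℝ E] {U : Set E} (hUo : IsOpen U) (hU : Convex ℝ U) {p : E} (hp : p ∈ U)
    {F : E → ℝ} (hF : ContDiffOn ℝ ∞ F U) : ∃ G : E → E →L[ℝ] ℝ, ContDiffOn ℝ ∞ G U ∧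
      (∀ y ∈ U, F y - F p = G y (y - p)) ∧ G p = fderiv ℝ F p := by
  obtain ⟨hd, hfd⟩ := (contDiffOn_infty_iff_fderiv_of_isOpen hUo).1 hF
  refine ⟨fun y => ∫ t in (0 : ℝ)..1, t ^ 0 • fderiv ℝ F (p + t • (y - p)),
    contDiffOn_infty.2 fun n => contDiffOn_segment_integral hUo hU hp n 0 (contDiffOn_infty.1 hfd n),
    fun y hy => ?_, by simp⟩
  have hcont : ContinuousOn (fun t : ℝ => fderiv ℝ F (p + t • (y - p))) (Set.uIcc 0 1) := by
    rw [Set.uIcc_of_le zero_le_one]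
    simpa using continuousOn_segment_integrand hU hp hfd.continuousOn 0 hy
  simp only [pow_zero, one_smul]
  rw [ContinuousLinearMap.intervalIntegral_apply hcont.intervalIntegrable]
  have h := intervalIntegral.integral_eq_sub_of_hasDerivAt
    (f := fun t : ℝ => F (p + t • (y - p))) (f' := fun t => fderiv ℝ F (p + t • (y - p)) (y - p))
    (a := 0) (b := 1) (fun t ht => ?_) ((hcont.clm_apply continuousOn_const).intervalIntegrable)
  · rw [h]; simp
  · rw [Set.uIcc_of_le zero_le_one] at ht
    have h1 := (hd.differentiableAt (hUo.mem_nhds (segment_mem hU hp hy ht))).hasFDerivAt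
    have h2 : HasDerivAt (fun t : ℝ => p + t • (y - p)) (y - p) t := by
      simpa using ((hasDerivAt_id t).smul_const (y - p)).const_add p
    exact h1.comp_hasDerivAt t h2

end Hadamard

/-! ### Derivations at a point of the manifold of spectral measures -/

variable {N : ℕ}

/-- A derivation at a point is given by a vector. -/
lemma exists_vector_of_pointDerivation (p : SpectralData N) (D : smoothFunctions N →ₗ[ℝ] ℝ)
    (hD : ∀ f g, D (f * g) = D f * g.1 p + f.1 p * D g) :
    ∃ v : (Fin N → ℝ) × (Fin N → ℝ), ∀ (f : smoothFunctions N) (F : (Fin N → ℝ) × (Fin N → ℝ) → ℝ),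
      ContDiffOn ℝ ∞ F (spectralDomain N) → (∀ q : SpectralData N, F (q.x, q.w) = f.1 q) →
        D f = fderiv ℝ F (p.x, p.w) v := by
  set X : Fin N → smoothFunctions N := fun j =>
    smoothOf (fun y => y.1 j - p.x j) (ContDiff.contDiffOn (by fun_prop)) with hX
  set W : Fin N → smoothFunctions N := fun j =>
    smoothOf (fun y => y.2 j - p.w j) (ContDiff.contDiffOn (by fun_prop)) with hW
  have hXp : ∀ j, (X j).1 p = 0 := fun j => sub_self _
  have hWp : ∀ j, (W j).1 p = 0 := fun j => sub_self _
  have hD1 : D 1 = 0 := by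
    have h := hD 1 1
    rw [mul_one] at h
    have h1 : (1 : smoothFunctions N).1 p = 1 := rfl
    rw [h1] at h
    linarith
  refine ⟨(fun j => D (X j), fun j => D (W j)), fun f F hF hf => ?_⟩
  obtain ⟨G, hG, hFG, hGp⟩ := exists_hadamard_factor (isOpen_spectralDomain N)
    (convex_spectralDomain N) p.mem_spectralDomain hF
  have hGv : ∀ v, ContDiffOn ℝ ∞ (fun y => G y v) (spectralDomain N) := fun v =>
    hG.clm_apply contDiffOn_const
  have hdecomp : ∀ v : (Fin N → ℝ) × (Fin N → ℝ), v = ∑ j, v.1 j • (Pi.single j (1 : ℝ), (0 : Fin N → ℝ)) +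
      ∑ j, v.2 j • ((0 : Fin N → ℝ), Pi.single j (1 : ℝ)) := by
    intro v
    refine Prod.ext (funext fun i => ?_) (funext fun i => ?_) <;>
    simp [Prod.fst_sum, Prod.snd_sum, Finset.sum_apply, Pi.single_apply]
  have hLv : ∀ (L : (Fin N → ℝ) × (Fin N → ℝ) →L[ℝ] ℝ) (v : (Fin N → ℝ) × (Fin N → ℝ)),
      L v = ∑ j, v.1 j * L (Pi.single j 1, 0) + ∑ j, v.2 j * L (0, Pi.single j 1) := fun L v => by
    conv_lhs => rw [hdecomp v]
    simp only [map_add, map_sum, map_smul, smul_eq_mul]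
  -- Hadamard's decomposition at `p`. The coordinate differences vanish at `p`, so the Leibniz rule
  -- leaves only the values of `D` on them, which are the components of the vector and do not
  -- involve `F`.
  have hfsum : f = f.1 p • (1 : smoothFunctions N) +
      (∑ j, X j * smoothOf (fun y => G y (Pi.single j 1, 0)) (hGv _) +
        ∑ j, W j * smoothOf (fun y => G y (0, Pi.single j 1)) (hGv _)) := by
    refine Subtype.ext <| funext fun q => ?_
    have h := hFG _ q.mem_spectralDomain
    rw [hLv, hf, hf] at h
    have h' : (f.1 p • (1 : smoothFunctions N) +
      (∑ j, X j * smoothOf (fun y => G y (Pi.single j 1, 0)) (hGv _) +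
        ∑ j, W j * smoothOf (fun y => G y (0, Pi.single j 1)) (hGv _))).1 q =
        f.1 p + (∑ j, (q.x j - p.x j) * G (q.x, q.w) (Pi.single j 1, 0) +
          ∑ j, (q.w j - p.w j) * G (q.x, q.w) (0, Pi.single j 1)) := by
      simp only [Subalgebra.coe_add, AddSubmonoidClass.coe_finsetSum, Pi.add_apply, Finset.sum_apply]
      refine congrArg₂ (· + ·) ?_ rfl
      change f.1 p * 1 = _
      rw [mul_one]
    rw [h']
    simp only [Prod.fst_sub, Prod.snd_sub, Pi.sub_apply] at h
    linarith
  rw [hfsum, ← hGp, hLv]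
  simp only [map_add, map_smul, hD1, smul_zero, zero_add, map_sum, hD, hXp, hWp, zero_mul, add_zero]
  rfl

/-- A sum of simple and double poles that vanishes far up the imaginary axis is trivial. -/
lemma poles_eq_zero {x : Fin N → ℝ} (hx : Function.Injective x) {α β : Fin N → ℂ} {y₀ : ℝ}
    (h : ∀ y : ℝ, y₀ < y → ∑ j, (α j * (1 / ((x j : ℂ) - y * Complex.I)) +
      β j * (1 / ((x j : ℂ) - y * Complex.I)) ^ 2) = 0) : α = 0 ∧ β = 0 := by
  classical
  open Polynomial in
  have hroots : ∀ P : ℂ[X], (∀ y : ℝ, max y₀ 0 < y → P.eval (y * Complex.I) = 0) → P = 0 := by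
    intro P hP
    refine P.eq_zero_of_infinite_isRoot (Set.Infinite.mono ?_
      ((Set.Ioi_infinite (max y₀ 0)).image (f := fun y : ℝ => (y : ℂ) * Complex.I) ?_))
    · rintro _ ⟨y, hy, rfl⟩
      exact hP y hy
    · intro a _ b _ hab
      simpa using hab
  have hne : ∀ y : ℝ, max y₀ 0 < y → ∀ j, (x j : ℂ) - y * Complex.I ≠ 0 := fun y hy j =>
    ofReal_sub_ne_zero (by simpa using ((le_max_right y₀ 0).trans_lt hy).ne') _
  have hxne : ∀ {i j}, i ≠ j → (x i : ℂ) - x j ≠ 0 := fun hij => by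
    exact_mod_cast sub_ne_zero.2 (hx.ne hij)
  open Polynomial in
  have hβ : β = 0 := by
    -- Clearing denominators gives a polynomial with infinitely many zeros; at `x k` it is `β k`
    -- times a nonzero product.
    have hP := hroots (∑ j, (C (α j) * (C (x j : ℂ) - X) + C (β j)) *
      ∏ i ∈ Finset.univ.erase j, (C (x i : ℂ) - X) ^ 2) fun y hy => by
        have h1 := congrArg (fun r => r * ∏ i, ((x i : ℂ) - y * Complex.I) ^ 2)
          (h y ((le_max_left _ _).trans_lt hy))
        simp only [zero_mul] at h1
        rw [← h1, Finset.sum_mul, eval_finsetSum]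
        refine Finset.sum_congr rfl fun j _ => ?_
        rw [← Finset.mul_prod_erase _ _ (Finset.mem_univ j)]
        simp only [eval_mul, eval_add, eval_sub, eval_C, eval_X, eval_prod, eval_pow]
        have := hne y hy j
        field_simp
    funext k
    have h2 := congrArg (eval (x k : ℂ)) hP
    rw [eval_finsetSum, Finset.sum_eq_single k] at h2
    · simp only [eval_mul, eval_add, eval_sub, eval_C, eval_X, eval_prod, eval_pow, sub_self,
        mul_zero, zero_add, eval_zero] at h2
      exact (mul_eq_zero.1 h2).resolve_right (Finset.prod_ne_zero_iff.2 fun i hi =>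
        pow_ne_zero 2 (hxne (Finset.ne_of_mem_erase hi)))
    · intro j _ hj
      rw [eval_mul, eval_prod, Finset.prod_eq_zero (Finset.mem_erase.2 ⟨hj.symm, Finset.mem_univ k⟩),
        mul_zero]
      simp
    · simp
  refine ⟨?_, hβ⟩
  open Polynomial in
  -- Without double poles one power of each denominator suffices, and evaluation at `x k` isolates
  -- `α k`.
  have hP := hroots (∑ j, C (α j) * ∏ i ∈ Finset.univ.erase j, (C (x i : ℂ) - X)) fun y hy => by
    have h1 := congrArg (fun r => r * ∏ i, ((x i : ℂ) - y * Complex.I))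
      (h y ((le_max_left _ _).trans_lt hy))
    simp only [zero_mul] at h1
    rw [← h1, Finset.sum_mul, eval_finsetSum]
    refine Finset.sum_congr rfl fun j _ => ?_
    rw [← Finset.mul_prod_erase _ _ (Finset.mem_univ j)]
    simp only [eval_mul, eval_sub, eval_C, eval_X, eval_prod, hβ, Pi.zero_apply]
    have := hne y hy j
    field_simp
    ring
  funext k
  have h2 := congrArg (Polynomial.eval (x k : ℂ)) hP
  rw [Polynomial.eval_finsetSum, Finset.sum_eq_single k] at h2
  · simp only [Polynomial.eval_mul, Polynomial.eval_sub, Polynomial.eval_C, Polynomial.eval_X,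
      Polynomial.eval_prod, Polynomial.eval_zero] at h2
    exact (mul_eq_zero.1 h2).resolve_right (Finset.prod_ne_zero_iff.2 fun i hi =>
      hxne (Finset.ne_of_mem_erase hi))
  · intro j _ hj
    rw [Polynomial.eval_mul, Polynomial.eval_prod,
      Finset.prod_eq_zero (Finset.mem_erase.2 ⟨hj.symm, Finset.mem_univ k⟩), mul_zero]
    simp
  · simp

/-- The Stieltjes transform as a function of nodes and weights. -/
def nodeStieltjes (z : ℂ) (y : (Fin N → ℝ) × (Fin N → ℝ)) : ℂ :=
  ∑ j, (y.2 j : ℂ) * (1 / ((y.1 j : ℂ) - z))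

lemma contDiff_nodeStieltjes {z : ℂ} (hz : z.im ≠ 0) :
    ContDiff ℝ ∞ (nodeStieltjes z : (Fin N → ℝ) × (Fin N → ℝ) → ℂ) :=
  contDiffOn_univ.1 (contDiffOn_mFun_aux z hz Set.univ)

lemma fderiv_nodeStieltjes_apply {z : ℂ} (hz : z.im ≠ 0) (y v : (Fin N → ℝ) × (Fin N → ℝ)) :
    fderiv ℝ (nodeStieltjes z) y v = ∑ j, ((v.2 j : ℂ) * (1 / ((y.1 j : ℂ) - z)) +
      -((y.2 j : ℂ) * v.1 j) * (1 / ((y.1 j : ℂ) - z)) ^ 2) := by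
  refine fderiv_apply_eq_of_hasDerivAt ((contDiff_nodeStieltjes hz).differentiable
    (by simp) y) ?_
  refine HasDerivAt.fun_sum fun j _ => ?_
  have h1 : HasDerivAt (fun t : ℝ => (y + t • v).1 j) (v.1 j) 0 := by
    simpa using ((hasDerivAt_id (0 : ℝ)).mul_const (v.1 j)).const_add (y.1 j)
  have h2 : HasDerivAt (fun t : ℝ => (y + t • v).2 j) (v.2 j) 0 := by
    simpa using ((hasDerivAt_id (0 : ℝ)).mul_const (v.2 j)).const_add (y.2 j)
  have h3 := (h1.ofReal_comp.sub_const z).inv (ofReal_sub_ne_zero hz ((y + (0 : ℝ) • v).1 j))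
  simp only [one_div]
  refine (h2.ofReal_comp.mul h3).congr_deriv ?_
  have h0 := ofReal_sub_ne_zero hz (y.1 j)
  simp only [zero_smul, add_zero, Pi.inv_apply]
  field_simp

/-- A variation of the weights shows in the simple poles and a variation of the nodes in the double
poles, multiplied by weights that are positive. -/
lemma vector_eq_zero_of_stieltjes (p : SpectralData N) {v : (Fin N → ℝ) × (Fin N → ℝ)} {y₀ : ℝ}
    (h0 : 0 ≤ y₀)
    (h : ∀ y : ℝ, y₀ < y → fderiv ℝ (nodeStieltjes (y * Complex.I)) (p.x, p.w) v = 0) : v = 0 := by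
  have h1 := poles_eq_zero (α := fun j => (v.2 j : ℂ)) (β := fun j => -((p.w j : ℂ) * v.1 j))
    p.strictMono_x.injective fun y hy => by
      rw [← h y hy, fderiv_nodeStieltjes_apply (by simpa using (h0.trans_lt hy).ne')]
  refine Prod.ext (funext fun j => ?_) (funext fun j => ?_)
  · have h2 := congrFun h1.2 j
    have h3 : (p.w j : ℂ) ≠ 0 := by exact_mod_cast (p.pos_w j).ne'
    simpa [h3] using h2
  · simpa using congrFun h1.1 j

lemma im_mul_I_ne_zero {y : ℝ} (hy : 0 < y) : ((y : ℂ) * Complex.I).im ≠ 0 := by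
  simpa using hy.ne'

/-- A derivation at a point which vanishes on sufficiently many Stieltjes transforms is zero. -/
lemma pointDerivation_eq_zero (p : SpectralData N) (D : smoothFunctions N →ₗ[ℝ] ℝ)
    (hD : ∀ f g, D (f * g) = D f * g.1 p + f.1 p * D g) {y₀ : ℝ} (h0 : 0 ≤ y₀)
    (h : ∀ (y : ℝ) (hy : y₀ < y), D (mRe N _ (im_mul_I_ne_zero (h0.trans_lt hy))) = 0 ∧
      D (mIm N _ (im_mul_I_ne_zero (h0.trans_lt hy))) = 0) : D = 0 := by
  obtain ⟨v, hv⟩ := exists_vector_of_pointDerivation p D hD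
  have hv0 : v = 0 := by
    refine vector_eq_zero_of_stieltjes p h0 fun y hy => ?_
    have hz := im_mul_I_ne_zero (h0.trans_lt hy)
    have hd : DifferentiableAt ℝ (nodeStieltjes (N := N) (y * Complex.I)) (p.x, p.w) :=
      (contDiff_nodeStieltjes hz).differentiable (by simp) _
    have h1 := hv (mRe N _ hz) (fun q => (nodeStieltjes (y * Complex.I) q).re)
      (Complex.reCLM.contDiff.comp_contDiffOn (contDiff_nodeStieltjes hz).contDiffOn)
      (fun q => by simp only [mRe, mFun_measure]; rfl)
    have h2 := hv (mIm N _ hz) (fun q => (nodeStieltjes (y * Complex.I) q).im)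
      (Complex.imCLM.contDiff.comp_contDiffOn (contDiff_nodeStieltjes hz).contDiffOn)
      (fun q => by simp only [mIm, mFun_measure]; rfl)
    have e1 : fderiv ℝ (fun q => (nodeStieltjes (y * Complex.I) q).re) (p.x, p.w) =
        Complex.reCLM.comp (fderiv ℝ (nodeStieltjes (y * Complex.I)) (p.x, p.w)) :=
      (Complex.reCLM.hasFDerivAt.comp (p.x, p.w) hd.hasFDerivAt).fderiv
    have e2 : fderiv ℝ (fun q => (nodeStieltjes (y * Complex.I) q).im) (p.x, p.w) =
        Complex.imCLM.comp (fderiv ℝ (nodeStieltjes (y * Complex.I)) (p.x, p.w)) :=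
      (Complex.imCLM.hasFDerivAt.comp (p.x, p.w) hd.hasFDerivAt).fderiv
    rw [(h y hy).1, e1] at h1
    rw [(h y hy).2, e2] at h2
    exact Complex.ext h1.symm h2.symm
  refine LinearMap.ext fun f => ?_
  obtain ⟨F, hF, hf⟩ := f.2
  rw [hv f F hF hf, hv0, map_zero]
  rfl

/-! ### Poisson brackets are determined by Stieltjes transforms -/

lemma IsPoissonBracket.leibniz_left {B : Bracket N} (hB : IsPoissonBracket B)
    (f g k : smoothFunctions N) : B (f * g) k = B f k * g + f * B g k := by
  rw [hB.skew, hB.leibniz, hB.skew k f, hB.skew k g]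
  ring

/-- The linear functional `f ↦ {f, g}(p)`. -/
def bracketAt (B : Bracket N) (g : smoothFunctions N) (p : SpectralData N) :
    smoothFunctions N →ₗ[ℝ] ℝ where
  toFun f := (B f g).1 p
  map_add' f f' := by rw [map_add]; rfl
  map_smul' r f := by rw [map_smul]; rfl

lemma bracketAt_mul {B : Bracket N} (hB : IsPoissonBracket B) (k : smoothFunctions N)
    (p : SpectralData N) (f g : smoothFunctions N) :
    bracketAt B k p (f * g) = bracketAt B k p f * g.1 p + f.1 p * bracketAt B k p g := by
  change (B (f * g) k).1 p = _
  rw [hB.leibniz_left]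
  rfl

/-- Both functionals `f ↦ {f, g}(p)` are derivations at `p`, so `pointDerivation_eq_zero` applies to
their difference. The threshold `y₀` leaves room to avoid the excluded case `z = w`. -/
lemma bracket_eq_of_stieltjes {B B' : Bracket N} (hB : IsPoissonBracket B)
    (hB' : IsPoissonBracket B') {g : smoothFunctions N} {y₀ : ℝ} (h0 : 0 ≤ y₀)
    (h : ∀ (y : ℝ) (hy : y₀ < y), B (mRe N _ (im_mul_I_ne_zero (h0.trans_lt hy))) g =
        B' (mRe N _ (im_mul_I_ne_zero (h0.trans_lt hy))) g ∧
      B (mIm N _ (im_mul_I_ne_zero (h0.trans_lt hy))) g =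
        B' (mIm N _ (im_mul_I_ne_zero (h0.trans_lt hy))) g) (f : smoothFunctions N) :
    B f g = B' f g := by
  refine Subtype.ext <| funext fun p => ?_
  have h1 := pointDerivation_eq_zero p (bracketAt B g p - bracketAt B' g p) (fun a b => by
    simp only [LinearMap.sub_apply, bracketAt_mul hB, bracketAt_mul hB']; ring) h0 fun y hy => by
      constructor
      · change (B _ g).1 p - (B' _ g).1 p = 0
        rw [(h y hy).1, sub_self]
      · change (B _ g).1 p - (B' _ g).1 p = 0
        rw [(h y hy).2, sub_self]
  exact sub_eq_zero.1 (congrArg (fun L : smoothFunctions N →ₗ[ℝ] ℝ => L f) h1)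

lemma mFun_conj (p : SpectralData N) (z : ℂ) :
    mFun p.measure (starRingEnd ℂ z) = starRingEnd ℂ (mFun p.measure z) := by
  simp [mFun_measure]

lemma conj_im_ne_zero {z : ℂ} (hz : z.im ≠ 0) : (starRingEnd ℂ z).im ≠ 0 := by simpa using hz

lemma mRe_conj {z : ℂ} (hz : z.im ≠ 0) : mRe N (starRingEnd ℂ z) (conj_im_ne_zero hz) = mRe N z hz :=
  Subtype.ext <| funext fun p => by simp [mRe, mFun_conj]

lemma mIm_conj {z : ℂ} (hz : z.im ≠ 0) : mIm N (starRingEnd ℂ z) (conj_im_ne_zero hz) = -mIm N z hz :=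
  Subtype.ext <| funext fun p => by simp [mIm, mFun_conj]

/-- Conjugating the second argument changes the sign of `g₂`; sums and differences of the two
complex values recover the four real brackets. -/
lemma bracket_eq_of_complexBracket_eq {B B' : Bracket N} {f₁ f₂ g₁ g₂ : smoothFunctions N}
    {p : SpectralData N} (h : complexBracket B f₁ f₂ g₁ g₂ p = complexBracket B' f₁ f₂ g₁ g₂ p)
    (h' : complexBracket B f₁ f₂ g₁ (-g₂) p = complexBracket B' f₁ f₂ g₁ (-g₂) p) :
    (B f₁ g₁).1 p = (B' f₁ g₁).1 p ∧ (B f₂ g₁).1 p = (B' f₂ g₁).1 p ∧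
      (B f₁ g₂).1 p = (B' f₁ g₂).1 p ∧ (B f₂ g₂).1 p = (B' f₂ g₂).1 p := by
  have hneg : ∀ (C : Bracket N) f, (C f (-g₂)).1 p = -(C f g₂).1 p := fun C f => by
    rw [map_neg]; rfl
  simp only [complexBracket, hneg] at h h'
  have h1 := congrArg Complex.re h
  have h2 := congrArg Complex.im h
  have h3 := congrArg Complex.re h'
  have h4 := congrArg Complex.im h'
  simp at h1 h2 h3 h4
  refine ⟨?_, ?_, ?_, ?_⟩ <;> linarith

/-- The formula is available only for `z ≠ w`, and `z = iy` with `y > |Im w|` avoids both `w` and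
its conjugate. The derivation property extends the equality to all functions in the first slot, and
skew symmetry repeats the argument in the second. -/
lemma IsBracketOf.unique {K : Measure ℝ → ℂ → ℂ} {B B' : Bracket N} (hB : IsBracketOf K B)
    (hB' : IsBracketOf K B') : B = B' := by
  have hval : ∀ {w : ℂ} (hw : w.im ≠ 0) (y : ℝ) (hy : |w.im| < y),
      (B (mRe N _ (im_mul_I_ne_zero ((abs_nonneg _).trans_lt hy))) (mRe N w hw) =
        B' (mRe N _ (im_mul_I_ne_zero ((abs_nonneg _).trans_lt hy))) (mRe N w hw) ∧
      B (mIm N _ (im_mul_I_ne_zero ((abs_nonneg _).trans_lt hy))) (mRe N w hw) =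
        B' (mIm N _ (im_mul_I_ne_zero ((abs_nonneg _).trans_lt hy))) (mRe N w hw)) ∧
      (B (mRe N _ (im_mul_I_ne_zero ((abs_nonneg _).trans_lt hy))) (mIm N w hw) =
        B' (mRe N _ (im_mul_I_ne_zero ((abs_nonneg _).trans_lt hy))) (mIm N w hw) ∧
      B (mIm N _ (im_mul_I_ne_zero ((abs_nonneg _).trans_lt hy))) (mIm N w hw) =
        B' (mIm N _ (im_mul_I_ne_zero ((abs_nonneg _).trans_lt hy))) (mIm N w hw)) := by
    intro w hw y hy
    have hz := im_mul_I_ne_zero ((abs_nonneg _).trans_lt hy)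
    have hzw : (y : ℂ) * Complex.I ≠ w := fun h => by
      rw [← h] at hy
      simp at hy
      exact absurd hy (not_lt.2 (le_abs_self y))
    have hzw' : (y : ℂ) * Complex.I ≠ starRingEnd ℂ w := fun h => by
      have h1 := congrArg Complex.im h
      simp at h1
      rw [h1] at hy
      exact absurd hy (not_lt.2 (neg_le_abs _))
    have key := fun p => bracket_eq_of_complexBracket_eq (B := B) (B' := B') (p := p)
      (f₁ := mRe N _ hz) (f₂ := mIm N _ hz) (g₁ := mRe N w hw) (g₂ := mIm N w hw)
      ((hB.2 _ _ hz hw hzw p).trans (hB'.2 _ _ hz hw hzw p).symm) (by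
        rw [← mRe_conj hw, ← mIm_conj hw]
        exact (hB.2 _ _ hz (conj_im_ne_zero hw) hzw' p).trans
          (hB'.2 _ _ hz (conj_im_ne_zero hw) hzw' p).symm)
    exact ⟨⟨Subtype.ext <| funext fun p => (key p).1, Subtype.ext <| funext fun p => (key p).2.1⟩,
      ⟨Subtype.ext <| funext fun p => (key p).2.2.1, Subtype.ext <| funext fun p => (key p).2.2.2⟩⟩
  have hre : ∀ {w : ℂ} (hw : w.im ≠ 0) f, B f (mRe N w hw) = B' f (mRe N w hw) := fun hw f =>
    bracket_eq_of_stieltjes hB.1 hB'.1 (abs_nonneg _) (fun y hy => (hval hw y hy).1) f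
  have him : ∀ {w : ℂ} (hw : w.im ≠ 0) f, B f (mIm N w hw) = B' f (mIm N w hw) := fun hw f =>
    bracket_eq_of_stieltjes hB.1 hB'.1 (abs_nonneg _) (fun y hy => (hval hw y hy).2) f
  refine LinearMap.ext fun f => LinearMap.ext fun g => ?_
  rw [hB.1.skew, hB'.1.skew, bracket_eq_of_stieltjes hB.1 hB'.1 le_rfl (fun y hy => ⟨?_, ?_⟩) g]
  · rw [hB.1.skew, hB'.1.skew, hre]
  · rw [hB.1.skew, hB'.1.skew, him]

end

section

/-! ### Existence and uniqueness of the brackets built from a function -/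

section

variable {N : ℕ} [NeZero N]

lemma isHBracket_iff {H : ℝ → ℝ} (hH : ContDiffOn ℝ ∞ H (Set.Ioo (-2) 2)) (B : Bracket N) :
    IsHBracket H B ↔ B = hamBracket hH :=
  ⟨fun hB => hB.unique (isHBracket_hamBracket hH), fun hB => hB ▸ isHBracket_hamBracket hH⟩

lemma hamBracket_add {H H' : ℝ → ℝ} (hH : ContDiffOn ℝ ∞ H (Set.Ioo (-2) 2))
    (hH' : ContDiffOn ℝ ∞ H' (Set.Ioo (-2) 2)) :
    (hamBracket hH + hamBracket hH' : Bracket N) = hamBracket (hH.add hH') := by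
  refine LinearMap.ext fun f => LinearMap.ext fun g => Subtype.ext <| funext fun p => ?_
  change (hamBracket hH f g).1 p + (hamBracket hH' f g).1 p = _
  simp only [hamBracket_apply, ← Finset.sum_add_distrib]
  refine Finset.sum_congr rfl fun s _ => ?_
  ring

/-- By linearity in `H`, the sum of two brackets of the family belongs to the family. -/
lemma compatible_hamBracket {H H' : ℝ → ℝ} (hH : ContDiffOn ℝ ∞ H (Set.Ioo (-2) 2))
    (hH' : ContDiffOn ℝ ∞ H' (Set.Ioo (-2) 2)) :
    Compatible (hamBracket hH : Bracket N) (hamBracket hH') :=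
  ⟨isPoissonBracket_hamBracket hH, isPoissonBracket_hamBracket hH', by
    rw [hamBracket_add]; exact isPoissonBracket_hamBracket _⟩

/-- Only the values of `H` at the nodes enter the bracket, and the nodes lie where `H` agrees with
`P`. -/
lemma hamBracket_polynomial {H : ℝ → ℝ} (hH : ContDiffOn ℝ ∞ H (Set.Ioo (-2) 2)) {P : Polynomial ℝ}
    (hP : ∀ t ∈ Set.Icc (-2 : ℝ) 2, H t = P.eval t)
    (hpow : ∀ k : ℕ, ContDiffOn ℝ ∞ (fun t : ℝ => t ^ k) (Set.Ioo (-2) 2)) :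
    (hamBracket hH : Bracket N) =
      ∑ k ∈ Finset.range (P.natDegree + 1), P.coeff k • (hamBracket (hpow k) : Bracket N) := by
  refine LinearMap.ext fun f => LinearMap.ext fun g => Subtype.ext <| funext fun p => ?_
  have h1 : (((∑ k ∈ Finset.range (P.natDegree + 1), P.coeff k • (hamBracket (hpow k) : Bracket N))
      f g).1 p) = ∑ k ∈ Finset.range (P.natDegree + 1), P.coeff k * ((hamBracket (hpow k) : Bracket N) f g).1 p := by
    simp only [LinearMap.sum_apply, LinearMap.smul_apply, AddSubmonoidClass.coe_finsetSum,
      Finset.sum_apply]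
    rfl
  rw [h1]
  simp only [hamBracket_apply, Finset.mul_sum]
  rw [Finset.sum_comm]
  refine Finset.sum_congr rfl fun s _ => ?_
  rw [hP _ (Set.Ioo_subset_Icc_self (p.mem_x s)), Polynomial.eval_eq_sum_range, ← Finset.sum_neg_distrib,
    Finset.sum_mul]
  refine Finset.sum_congr rfl fun k _ => ?_
  ring

end

/-- `arccos (t / 2)` is smooth inside the open interval, which is enough because all nodes lie
there. -/
lemma contDiffOn_hTransform {h : Circle → ℝ} (h_smooth : ContMDiff (𝓡 1) 𝓘(ℝ, ℝ) ∞ h) :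
    ContDiffOn ℝ ∞ (hTransform h) (Set.Ioo (-2) 2) := by
  have h1 : ContDiff ℝ ∞ fun θ : ℝ => h (Circle.exp θ) :=
    contMDiff_iff_contDiff.1 (h_smooth.comp contMDiff_circleExp)
  have h2 : ContDiffOn ℝ ∞ (fun t : ℝ => Real.arccos (t / 2)) (Set.Ioo (-2) 2) := by
    intro t ht
    refine ((Real.contDiffAt_arccos (n := ∞) (x := t / 2) ?_ ?_).comp (f := fun t : ℝ => t / 2) t
      (by fun_prop)).contDiffWithinAt
    · intro h; linarith [ht.1]
    · intro h; linarith [ht.2]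
  unfold hTransform
  exact (contDiffOn_const.mul (Real.contDiff_sin.comp_contDiffOn h2)).mul (h1.comp_contDiffOn h2)

/-! ### Faybusovich-Gekhtman brackets -/

section FaybusovichGekhtman

variable {N : ℕ}

lemma polynomial_eq_zero_of_tendsto {P : Polynomial ℂ}
    (h : Filter.Tendsto (fun z => P.eval z) (Bornology.cobounded ℂ) (𝓝 0)) : P = 0 := by
  by_cases hd : 0 < P.degree
  · have h1 : Filter.Tendsto (fun z => ‖P.eval z‖) (Bornology.cobounded ℂ) Filter.atTop :=
      P.tendsto_norm_atTop hd tendsto_norm_cobounded_atTop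
    exact absurd h.norm (not_tendsto_nhds_of_tendsto_atTop h1 _)
  · rw [Polynomial.eq_C_of_degree_le_zero (not_lt.1 hd)] at h ⊢
    simp only [Polynomial.eval_C] at h
    rw [tendsto_nhds_unique tendsto_const_nhds h, map_zero]

/-- Two candidates differ by a polynomial tending to zero at infinity, so the choice in `polyPart`
is forced. -/
lemma polyPart_eq {r : ℂ → ℂ} {P : Polynomial ℂ}
    (h : Filter.Tendsto (fun z => r z - P.eval z) (Bornology.cobounded ℂ) (𝓝 0)) : polyPart r = P := by
  have hr : ∃ P : Polynomial ℂ,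
    Filter.Tendsto (fun z => r z - P.eval z) (Bornology.cobounded ℂ) (𝓝 0) := ⟨P, h⟩
  have h1 : polyPart r = hr.choose := dif_pos hr
  rw [h1]
  have h2 := h.sub hr.choose_spec
  refine sub_eq_zero.1 (polynomial_eq_zero_of_tendsto ?_)
  simpa using h2

lemma tendsto_mFunH_cobounded (H : ℝ → ℝ) (p : SpectralData N) :
    Filter.Tendsto (mFunH H p.measure) (Bornology.cobounded ℂ) (𝓝 0) := by
  have h1 : mFunH H p.measure = fun z => ∑ j, (p.w j : ℂ) * (H (p.x j) / ((p.x j : ℂ) - z)) :=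
    funext fun z => mFunH_measure H p z
  rw [h1, show (0 : ℂ) = ∑ j : Fin N, (p.w j : ℂ) * (H (p.x j) * 0) by simp]
  refine tendsto_finsetSum _ fun j _ => Filter.Tendsto.const_mul _ ?_
  simp only [div_eq_mul_inv]
  refine Filter.Tendsto.const_mul _ (Filter.tendsto_inv₀_cobounded.comp ?_)
  exact tendsto_const_sub_cobounded _

/-- `z^k / (x - z)` equals `x^k / (x - z)` minus the quotient of `z^k - x^k` by `z - x`. That
quotient is a polynomial in `z`, while the remaining fraction decays at infinity. -/
lemma negPart_pow_mul_mFun (k : ℕ) (p : SpectralData N) {z : ℂ} (hz : z.im ≠ 0) :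
    negPart (fun z => z ^ k * mFun p.measure z) z = mFunH (fun t => t ^ k) p.measure z := by
  classical
  set P : Polynomial ℂ := -∑ j, Polynomial.C (p.w j : ℂ) *
    ∑ i ∈ Finset.range k, Polynomial.X ^ i * Polynomial.C ((p.x j : ℂ) ^ (k - 1 - i)) with hP
  have key : ∀ z : ℂ, (∀ j, (p.x j : ℂ) - z ≠ 0) →
      z ^ k * mFun p.measure z - P.eval z = mFunH (fun t => t ^ k) p.measure z := by
    intro z hz
    rw [mFun_measure, mFunH_measure, hP, Finset.mul_sum]
    simp only [Polynomial.eval_neg, Polynomial.eval_finsetSum, Polynomial.eval_mul,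
      Polynomial.eval_C, Polynomial.eval_pow, Polynomial.eval_X, sub_neg_eq_add,
      ← Finset.sum_add_distrib]
    refine Finset.sum_congr rfl fun j _ => ?_
    have h1 := (Commute.all z (p.x j : ℂ)).geom_sum₂_mul k
    have h2 := hz j
    push_cast
    field_simp
    linear_combination -(p.w j : ℂ) * h1
  have hev : ∀ᶠ z in Bornology.cobounded ℂ, mFunH (fun t => t ^ k) p.measure z =
      z ^ k * mFun p.measure z - P.eval z := by
    have h1 : ∀ j, ∀ᶠ z in Bornology.cobounded ℂ, (p.x j : ℂ) - z ≠ 0 := fun j => by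
      filter_upwards [Bornology.isBounded_def.1
        (Bornology.isBounded_singleton (x := (p.x j : ℂ)))] with z hz h
      exact hz (sub_eq_zero.1 h).symm
    filter_upwards [Filter.eventually_all.2 h1] with z hz using (key z hz).symm
  unfold negPart
  rw [polyPart_eq ((tendsto_mFunH_cobounded _ p).congr' hev), key z fun j => ofReal_sub_ne_zero hz _]

lemma isFaybusovichGekhtmanBracket_iff (k : ℕ) (B : Bracket N) :
    IsFaybusovichGekhtmanBracket k B ↔ IsHBracket (fun t => t ^ k) B := by
  refine and_congr Iff.rfl (forall_congr' fun z => forall_congr' fun w => forall_congr' fun hz =>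
    forall_congr' fun hw => forall_congr' fun _ => forall_congr' fun p => ?_)
  unfold bracketRHS
  beta_reduce
  rw [negPart_pow_mul_mFun k p hz, negPart_pow_mul_mFun k p hw]

end FaybusovichGekhtman

/-! ### Trigonometric polynomials -/

/-- Comparing real parts at `z` and `z⁻¹`, oddness leaves a sine sum with coefficients `-Im c_j`,
and `sin θ sin (jθ) = sin² θ U_{j-1}(cos θ)` is a polynomial in `cos θ`. -/
lemma exists_polynomial_hTransform {h : Circle → ℝ} (h_odd : ∀ z : Circle, h z⁻¹ = -h z)
    (hh : IsTrigPolynomial h) :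
    ∃ P : Polynomial ℝ, ∀ t ∈ Set.Icc (-2 : ℝ) 2, hTransform h t = P.eval t := by
  obtain ⟨c, hc⟩ := hh
  have hh_exp : ∀ θ : ℝ, h (Circle.exp θ) = c.sum fun j a => -a.im * Real.sin (j * θ) := by
    intro θ
    have h1 := hc (Circle.exp θ)
    have h2 := hc (Circle.exp (-θ))
    rw [Circle.exp_neg, h_odd] at h2
    have hpow : ∀ (φ : ℝ) (j : ℤ), ((Circle.exp φ : Circle) : ℂ) ^ j = Complex.exp ((j * φ : ℝ) * Complex.I) := by
      intro φ j
      rw [Circle.coe_exp, ← Complex.exp_int_mul]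
      push_cast
      ring_nf
    rw [← Circle.exp_neg] at h2
    simp only [hpow, Finsupp.sum] at h1 h2
    have h3 := congrArg Complex.re h1
    have h4 := congrArg Complex.re h2
    simp only [Complex.ofReal_re, Complex.re_sum, Complex.mul_re, Complex.exp_ofReal_mul_I_re,
      Complex.exp_ofReal_mul_I_im, mul_neg, Real.cos_neg, Real.sin_neg] at h3 h4
    rw [Finset.sum_sub_distrib] at h3
    simp only [sub_neg_eq_add, Finset.sum_add_distrib] at h4
    simp only [Finsupp.sum, neg_mul, Finset.sum_neg_distrib]
    linarith
  -- With `t = 2 cos θ` the factor `(4 - t²) / 2` is `2 sin² θ`. Chebyshev polynomials with integer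
  -- index cover the negative frequencies too.
  refine ⟨c.sum fun j a => Polynomial.C (-a.im) * (Polynomial.C (1 / 2) * (4 - Polynomial.X ^ 2) *
    (Polynomial.Chebyshev.U ℝ (j - 1)).comp (Polynomial.C (1 / 2) * Polynomial.X)), fun t ht => ?_⟩
  obtain ⟨θ, rfl⟩ : ∃ θ : ℝ, 2 * Real.cos θ = t := ⟨Real.arccos (t / 2), by
    rw [Real.cos_arccos (by linarith [ht.1]) (by linarith [ht.2])]; ring⟩
  rw [hTransform_two_mul_cos h_odd, hh_exp]
  simp only [Finsupp.sum, Polynomial.eval_finsetSum, Finset.mul_sum]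
  refine Finset.sum_congr rfl fun j _ => ?_
  have h1 := Polynomial.Chebyshev.U_real_cos θ (j - 1)
  push_cast at h1
  rw [sub_add_cancel] at h1
  simp only [Polynomial.eval_mul, Polynomial.eval_C, Polynomial.eval_sub, Polynomial.eval_pow,
    Polynomial.eval_X, Polynomial.eval_comp, Polynomial.eval_ofNat]
  rw [show (1 / 2 : ℝ) * (2 * Real.cos θ) = Real.cos θ by ring, ← h1]
  linear_combination (-2 * (c j).im * (Polynomial.Chebyshev.U ℝ (j - 1)).eval (Real.cos θ)) *
    Real.sin_sq_add_cos_sq θ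

end

section

/-! ### The Lie-Poisson bracket at skew-Hermitian matrices -/

section LiePoisson

variable {N : ℕ}

lemma imTracePairing_add_left (X X' Y : Matrix (Fin N) (Fin N) ℂ) :
    imTracePairing (X + X') Y = imTracePairing X Y + imTracePairing X' Y := by
  simp [imTracePairing, add_mul]

lemma imTracePairing_sub_left (X X' Y : Matrix (Fin N) (Fin N) ℂ) :
    imTracePairing (X - X') Y = imTracePairing X Y - imTracePairing X' Y := by
  simp [imTracePairing, sub_mul]

lemma imTracePairing_add_right (X Y Y' : Matrix (Fin N) (Fin N) ℂ) :
    imTracePairing X (Y + Y') = imTracePairing X Y + imTracePairing X Y' := by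
  simp [imTracePairing, mul_add]

/-- The two summands of the splitting are isotropic: here the trace of the product is real, and for
upper triangular matrices only products of real diagonal entries contribute. -/
lemma imTracePairing_skew_skew {X Y : Matrix (Fin N) (Fin N) ℂ} (hX : X.conjTranspose = -X)
    (hY : Y.conjTranspose = -Y) : imTracePairing X Y = 0 := by
  have h1 : star (X * Y).trace = (X * Y).trace := by
    rw [← Matrix.trace_conjTranspose, Matrix.conjTranspose_mul, hX, hY, neg_mul_neg,
      Matrix.trace_mul_comm]
  exact Complex.conj_eq_iff_im.1 h1

lemma imTracePairing_upper_upper {X Y : Matrix (Fin N) (Fin N) ℂ} (hX : ∀ i j, j < i → X i j = 0)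
    (hX' : ∀ i, (X i i).im = 0) (hY : ∀ i j, j < i → Y i j = 0) (hY' : ∀ i, (Y i i).im = 0) :
    imTracePairing X Y = 0 := by
  simp only [imTracePairing, Matrix.trace, Matrix.diag_apply, Matrix.mul_apply, Complex.im_sum]
  refine Finset.sum_eq_zero fun i _ => Finset.sum_eq_zero fun j _ => ?_
  rcases lt_trichotomy i j with h | rfl | h
  · rw [hY j i h, mul_zero, Complex.zero_im]
  · rw [Complex.mul_im, hX', hY', mul_zero, zero_mul, add_zero]
  · rw [hX i j h, zero_mul, Complex.zero_im]

/-- `R` is `1` on one summand and `-1` on the other, so the mixed commutators cancel. -/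
lemma rLieBracket_eq (A C : Matrix (Fin N) (Fin N) ℂ) :
    rLieBracket A C = (projUpper A * projUpper C - projUpper C * projUpper A) -
      (projSkew A * projSkew C - projSkew C * projSkew A) := by
  have hA : A = projUpper A + projSkew A := by simp [projUpper]
  have hC : C = projUpper C + projSkew C := by simp [projUpper]
  unfold rLieBracket rMatrix
  set U := projUpper A
  set S := projSkew A
  set V := projUpper C
  set W := projSkew C
  rw [hA, hC]
  simp only [mul_add, add_mul, mul_sub, sub_mul]
  module

lemma rLieBracket_skew (A C : Matrix (Fin N) (Fin N) ℂ) : rLieBracket A C = -rLieBracket C A := by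
  rw [rLieBracket_eq, rLieBracket_eq]
  abel

lemma liePoissonBracket_skew (φ ψ : Matrix (Fin N) (Fin N) ℂ → ℝ) (X : Matrix (Fin N) (Fin N) ℂ) :
    liePoissonBracket φ ψ X = -liePoissonBracket ψ φ X := by
  unfold liePoissonBracket
  rw [rLieBracket_skew, imTracePairing, neg_mul, Matrix.trace_neg, Complex.neg_im, imTracePairing]
  ring

/-- The bracket on skew-Hermitian matrices through the Hamiltonian vector field. -/
lemma imTracePairing_rLieBracket {X : Matrix (Fin N) (Fin N) ℂ} (hX : X.conjTranspose = -X)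
    (A C : Matrix (Fin N) (Fin N) ℂ) :
    imTracePairing (rLieBracket A C) X =
      imTracePairing C (projSkew (X * projUpper A - projUpper A * X)) := by
  rw [rLieBracket_eq, imTracePairing_sub_left]
  set U := projUpper A with hU
  have hskew : imTracePairing (projSkew A * projSkew C - projSkew C * projSkew A) X = 0 := by
    refine imTracePairing_skew_skew ?_ hX
    rw [Matrix.conjTranspose_sub, Matrix.conjTranspose_mul, Matrix.conjTranspose_mul,
      projSkew_conjTranspose, projSkew_conjTranspose, neg_mul_neg, neg_mul_neg, neg_sub]
  have hcyc : imTracePairing (U * projUpper C - projUpper C * U) X =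
      imTracePairing (projUpper C) (X * U - U * X) := by
    unfold imTracePairing
    rw [sub_mul, mul_sub, Matrix.trace_sub, Matrix.trace_sub, Matrix.mul_assoc U,
      Matrix.trace_mul_comm U, Matrix.mul_assoc, Matrix.mul_assoc]
  set ξ := X * U - U * X
  have hξ : ξ = projUpper ξ + projSkew ξ := by simp [projUpper]
  -- Isotropy of the two summands allows the upper part of `ξ` to be dropped here and the skew part
  -- of `C` to be restored in `hC`.
  have h1 : imTracePairing (projUpper C) ξ = imTracePairing (projUpper C) (projSkew ξ) := by
    conv_lhs => rw [hξ, imTracePairing_add_right]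
    rw [imTracePairing_upper_upper (fun i j h => projUpper_apply_of_lt C h) (projUpper_diag_im C)
      (fun i j h => projUpper_apply_of_lt ξ h) (projUpper_diag_im ξ), zero_add]
  have hC : imTracePairing C (projSkew ξ) = imTracePairing (projUpper C) (projSkew ξ) := by
    conv_lhs => rw [show C = projUpper C + projSkew C by simp [projUpper], imTracePairing_add_left]
    rw [imTracePairing_skew_skew (projSkew_conjTranspose C) (projSkew_conjTranspose ξ), add_zero]
  rw [hskew, sub_zero, hcyc, h1, hC]

lemma fderiv_eq_imTracePairing {φ : Matrix (Fin N) (Fin N) ℂ → ℝ} (X Y : Matrix (Fin N) (Fin N) ℂ) :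
    fderiv ℝ φ X Y = imTracePairing (matrixGradient φ X) Y := by
  have hsingle : ∀ i j, Matrix.single i j (Y i j) =
      (Y i j).re • Matrix.single i j (1 : ℂ) + (Y i j).im • Matrix.single i j Complex.I := by
    intro i j
    rw [Matrix.smul_single, Matrix.smul_single, ← Matrix.single_add]
    congr 1
    simp [Complex.re_add_im]
  have hL : fderiv ℝ φ X Y = ∑ i, ∑ j, ((Y i j).re * fderiv ℝ φ X (Matrix.single i j 1) +
      (Y i j).im * fderiv ℝ φ X (Matrix.single i j Complex.I)) := by
    conv_lhs => rw [Matrix.matrix_eq_sum_single Y]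
    simp only [hsingle, map_sum, map_add, map_smul, smul_eq_mul]
  rw [hL]
  simp only [imTracePairing, Matrix.trace, Matrix.diag_apply, Matrix.mul_apply, Complex.im_sum]
  rw [Finset.sum_comm]
  refine Finset.sum_congr rfl fun i _ => Finset.sum_congr rfl fun j _ => ?_
  simp [matrixGradient]
  ring

/-! ### Hamiltonian vector fields on Jacobi matrices -/

lemma iEmbed_conjTranspose {J : Matrix (Fin N) (Fin N) ℝ} (hJ : J.IsSymm) :
    (iEmbed J).conjTranspose = -iEmbed J := by
  ext i j
  simp [iEmbed, hJ.apply]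

/-- Symmetric tridiagonal matrices, the tangent space of the Jacobi matrices. -/
def IsSymmTridiagonal (ξ : Matrix (Fin N) (Fin N) ℝ) : Prop :=
  ξ.IsSymm ∧ ∀ i j : Fin N, (i : ℕ) + 1 < j → ξ i j = 0

/-- The Hamiltonian vector field of a function with gradient `A` on the Jacobi matrices. -/
def todaField (J : Matrix (Fin N) (Fin N) ℝ) (A : Matrix (Fin N) (Fin N) ℂ) :
    Matrix (Fin N) (Fin N) ℝ :=
  Matrix.of fun i j => if j < i then J i j * (A j j - A i i).re else
    if i < j then J i j * (A i i - A j j).re else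
      ∑ k, J i k * (projUpper A k i - projUpper A i k).re

lemma isSymmTridiagonal_todaField {J : Matrix (Fin N) (Fin N) ℝ} (hJ : IsJacobi J)
    (A : Matrix (Fin N) (Fin N) ℂ) : IsSymmTridiagonal (todaField J A) := by
  constructor
  · ext i j
    rcases lt_trichotomy i j with h | rfl | h
    · simp [todaField, h, h.not_gt, hJ.symm.apply]
    · rfl
    · simp [todaField, h, h.not_gt, hJ.symm.apply]
  · intro i j hij
    have h : i < j := Fin.lt_def.2 (by omega)
    simp [todaField, h, h.not_gt, hJ.tridiagonal i j hij]

lemma projUpper_diag (A : Matrix (Fin N) (Fin N) ℂ) (i : Fin N) :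
    projUpper A i i = ((A i i).re : ℂ) := by
  refine Complex.ext ?_ ?_ <;> simp [projUpper, projSkew]

/-- Below the diagonal `J` has a single subdiagonal and `projUpper A` vanishes, so each of the two
products has one term, containing a real diagonal entry of `projUpper A`. Hence the Hamiltonian
field is tangent to the matrices `iJ`. -/
lemma projSkew_commutator_iEmbed {J : Matrix (Fin N) (Fin N) ℝ} (hJ : IsJacobi J)
    (A : Matrix (Fin N) (Fin N) ℂ) :
    projSkew (iEmbed J * projUpper A - projUpper A * iEmbed J) = iEmbed (todaField J A) := by
  have hlow : ∀ i j, j < i → (iEmbed J * projUpper A - projUpper A * iEmbed J) i j =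
      Complex.I * (J i j * (A j j - A i i).re : ℝ) := by
    intro i j hij
    have hJ0 : ∀ a b : Fin N, (a : ℕ) + 1 < b → J b a = 0 := fun a b h => by
      rw [← hJ.tridiagonal a b h, hJ.symm.apply]
    rw [Matrix.sub_apply, Matrix.mul_apply, Matrix.mul_apply, Finset.sum_eq_single j,
      Finset.sum_eq_single i, projUpper_diag, projUpper_diag]
    · simp [iEmbed]; ring
    · intro k _ hk
      rcases lt_or_gt_of_ne hk with h | h
      · rw [projUpper_apply_of_lt A h, zero_mul]
      · have : J k j = 0 := hJ0 j k (by have := Fin.lt_def.1 h; have := Fin.lt_def.1 hij; omega)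
        simp [iEmbed, this]
    · simp
    · intro k _ hk
      rcases lt_or_gt_of_ne hk with h | h
      · have : J i k = 0 := hJ0 k i (by have := Fin.lt_def.1 h; have := Fin.lt_def.1 hij; omega)
        simp [iEmbed, this]
      · rw [projUpper_apply_of_lt A h, mul_zero]
    · simp
  ext i j
  rcases lt_trichotomy i j with h | rfl | h
  · have e : projSkew (iEmbed J * projUpper A - projUpper A * iEmbed J) i j =
      -(starRingEnd ℂ) ((iEmbed J * projUpper A - projUpper A * iEmbed J) j i) := by
      simp [projSkew, h, h.not_gt]
    rw [e, hlow j i h]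
    simp [iEmbed, todaField, h, h.not_gt, hJ.symm.apply j i]
  · have e : projSkew (iEmbed J * projUpper A - projUpper A * iEmbed J) i i =
      ((iEmbed J * projUpper A - projUpper A * iEmbed J) i i).im * Complex.I := by
      simp [projSkew]
    rw [e, mul_comm]
    have e2 : iEmbed (todaField J A) i i =
        Complex.I * (∑ k, J i k * (projUpper A k i - projUpper A i k).re : ℝ) := by
      simp [iEmbed, todaField]
    rw [e2]
    congr 2
    rw [Matrix.sub_apply, Matrix.mul_apply, Matrix.mul_apply, ← Finset.sum_sub_distrib,
      Complex.im_sum]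
    refine Finset.sum_congr rfl fun k _ => ?_
    simp [iEmbed, hJ.symm.apply i k]
    ring
  · have e : projSkew (iEmbed J * projUpper A - projUpper A * iEmbed J) i j =
      (iEmbed J * projUpper A - projUpper A * iEmbed J) i j := by
      simp [projSkew, h]
    rw [e, hlow i j h]
    simp [iEmbed, todaField, h]

/-- The Lie-Poisson bracket at `iJ` only involves derivatives along the Jacobi matrices. -/
lemma liePoissonBracket_iEmbed {J : Matrix (Fin N) (Fin N) ℝ} (hJ : IsJacobi J)
    (φ ψ : Matrix (Fin N) (Fin N) ℂ → ℝ) :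
    liePoissonBracket φ ψ (iEmbed J) =
      1 / 2 * fderiv ℝ ψ (iEmbed J) (iEmbed (todaField J (matrixGradient φ (iEmbed J)))) := by
  unfold liePoissonBracket
  rw [imTracePairing_rLieBracket (iEmbed_conjTranspose hJ.symm), projSkew_commutator_iEmbed hJ,
    fderiv_eq_imTracePairing]

end LiePoisson

/-! ### The Wronskian identity for Jacobi matrices -/

section Wronskian

variable {N : ℕ} [NeZero N]

omit [NeZero N] in
lemma sum_sq_of_orthogonal (s : Finset (Fin N)) (f : Fin N → ℂ)
    (hf : ∀ k ∈ s, ∀ l ∈ s, k ≠ l → f k * f l = 0) : (∑ k ∈ s, f k) ^ 2 = ∑ k ∈ s, f k ^ 2 := by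
  rw [sq, Finset.sum_mul_sum]
  refine Finset.sum_congr rfl fun k hk => ?_
  rw [Finset.sum_eq_single_of_mem k hk fun l hl hlk => hf k hk l hl hlk.symm, sq]

/-- `L i` and `R i` are the Wronskian fluxes from `i` to the left and to the right. The equations
for `u` and `y` compute `R i - L i`, so the sum becomes one of `R i ^ 2 - L i ^ 2`, which telescopes
because neighbouring sites share a flux. Only the source term at `0` remains. -/
lemma wronskian_identity {J : Matrix (Fin N) (Fin N) ℝ} (hJ : IsJacobi J) {z w : ℂ} (hzw : z ≠ w)
    {u y : Fin N → ℂ} (hu : ∀ i, ∑ k, (J i k : ℂ) * u k = z * u i + if i = 0 then 1 else 0)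
    (hy : ∀ i, ∑ k, (J i k : ℂ) * y k = w * y i + if i = 0 then 1 else 0) :
    ∑ i, u i * y i * (∑ k with k < i, (J i k : ℂ) * (u k * y i - u i * y k) +
      ∑ k with i < k, (J i k : ℂ) * (u i * y k - u k * y i)) =
    (u 0 - y 0) * ((u 0 - y 0) / (z - w) - u 0 * y 0) := by
  set L : Fin N → ℂ := fun i => ∑ k with k < i, (J i k : ℂ) * (u k * y i - u i * y k) with hL
  set R : Fin N → ℂ := fun i => ∑ k with i < k, (J i k : ℂ) * (u i * y k - u k * y i) with hR
  have hsymm : ∀ i k, J i k = J k i := fun i k => hJ.symm.apply k i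
  have hL0 : L 0 = 0 := by
    simp only [hL]
    rw [Finset.filter_eq_empty_iff.2 (fun k _ => by simp), Finset.sum_empty]
  have hRL : ∀ i, R i - L i = (w - z) * (u i * y i) + if i = 0 then u 0 - y 0 else 0 := by
    intro i
    have h1 : R i - L i = ∑ k, (J i k : ℂ) * (u i * y k - u k * y i) := by
      simp only [hL, hR, Finset.sum_filter]
      rw [← Finset.sum_sub_distrib]
      refine Finset.sum_congr rfl fun k _ => ?_
      rcases lt_trichotomy i k with h | rfl | h
      · simp [h, h.not_gt]
      · simp
      · simp [h, h.not_gt]; ring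
    have h2 : ∑ k, (J i k : ℂ) * (u i * y k - u k * y i) =
        u i * ∑ k, (J i k : ℂ) * y k - y i * ∑ k, (J i k : ℂ) * u k := by
      rw [Finset.mul_sum, Finset.mul_sum, ← Finset.sum_sub_distrib]
      exact Finset.sum_congr rfl fun k _ => by ring
    rw [h1, h2, hu, hy]
    split_ifs with h
    · rw [h]; ring
    · ring
  -- Tridiagonality leaves at most one nonzero summand in each flux, so squaring is termwise and
  -- exchanging the indices matches both sides.
  have hsq : ∑ i, R i ^ 2 = ∑ i, L i ^ 2 := by
    have e1 : ∀ i, R i ^ 2 = ∑ k with i < k, ((J i k : ℂ) * (u i * y k - u k * y i)) ^ 2 := by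
      intro i
      refine sum_sq_of_orthogonal _ _ fun k hk l hl hkl => ?_
      have hk' := Fin.lt_def.1 (Finset.mem_filter.1 hk).2
      have hl' := Fin.lt_def.1 (Finset.mem_filter.1 hl).2
      have hkl' : (k : ℕ) ≠ l := fun h => hkl (Fin.ext h)
      rcases lt_or_gt_of_ne hkl' with h | h
      · rw [hJ.tridiagonal i l (by omega)]; simp
      · rw [hJ.tridiagonal i k (by omega)]; simp
    have e2 : ∀ i, L i ^ 2 = ∑ k with k < i, ((J i k : ℂ) * (u k * y i - u i * y k)) ^ 2 := by
      intro i
      refine sum_sq_of_orthogonal _ _ fun k hk l hl hkl => ?_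
      have hk' := Fin.lt_def.1 (Finset.mem_filter.1 hk).2
      have hl' := Fin.lt_def.1 (Finset.mem_filter.1 hl).2
      have hkl' : (k : ℕ) ≠ l := fun h => hkl (Fin.ext h)
      rcases lt_or_gt_of_ne hkl' with h | h
      · rw [hsymm i k, hJ.tridiagonal k i (by omega)]; simp
      · rw [hsymm i l, hJ.tridiagonal l i (by omega)]; simp
    simp only [e1, e2, Finset.sum_filter]
    rw [Finset.sum_comm]
    refine Finset.sum_congr rfl fun i _ => Finset.sum_congr rfl fun k _ => ?_
    rw [hsymm i k]
  have hwz : w - z ≠ 0 := sub_ne_zero.2 hzw.symm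
  have hmain : (w - z) * ∑ i, u i * y i * (L i + R i) = -((u 0 - y 0) * R 0) := by
    have h1 : ∀ i, (w - z) * (u i * y i * (L i + R i)) =
        R i ^ 2 - L i ^ 2 - if i = 0 then (u 0 - y 0) * R 0 else 0 := by
      intro i
      have h2 := hRL i
      split_ifs at h2 ⊢ with h
      · subst h
        rw [hL0] at h2 ⊢
        linear_combination (-R 0) * h2
      · linear_combination (-(L i + R i)) * h2
    rw [Finset.mul_sum, Finset.sum_congr rfl fun i _ => h1 i, Finset.sum_sub_distrib,
      Finset.sum_sub_distrib, hsq, sub_self, zero_sub, Finset.sum_ite_eq']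
    simp
  have hR0 := hRL 0
  rw [hL0, if_pos rfl, sub_zero] at hR0
  rw [hR0] at hmain
  have hzw' : z - w ≠ 0 := sub_ne_zero.2 hzw
  refine mul_left_cancel₀ hwz (hmain.trans ?_)
  field_simp
  ring

-- `A` and `A'` have the form of the gradients of the real and imaginary parts of a resolvent entry.
-- `todaField` depends on real parts of their entries, and `Re A + i Re A' = -u uᵀ`, so the
-- combination is a polynomial in `u` without conjugates.
omit [NeZero N] in
lemma sum_todaField_rankOne {J : Matrix (Fin N) (Fin N) ℝ} (hJ : IsJacobi J) (u y : Fin N → ℂ)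
    {A A' : Matrix (Fin N) (Fin N) ℂ} (hA : ∀ i j, A i j = -(u i * u j))
    (hA' : ∀ i j, A' i j = Complex.I * (u i * u j)) :
    ∑ i, ∑ j, ((todaField J A i j : ℂ) + todaField J A' i j * Complex.I) * (y i * y j) =
      -(2 * ∑ i, u i * y i * (∑ k with k < i, (J i k : ℂ) * (u k * y i - u i * y k) +
        ∑ k with i < k, (J i k : ℂ) * (u i * y k - u k * y i))) := by
  have hsymm : ∀ i k, J i k = J k i := fun i k => hJ.symm.apply k i
  set O : Fin N → Fin N → ℂ := fun i j => if j < i then -(J i j * (u j * u j - u i * u i)) else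
    if i < j then -(J i j * (u i * u i - u j * u j)) else 0 with hO
  set G : Fin N → Fin N → ℂ := fun i k => if k < i then -(2 * J i k * (u k * u i)) else
    if i < k then 2 * J i k * (u i * u k) else 0 with hG
  have hupper : ∀ (M : Matrix (Fin N) (Fin N) ℂ) {i k : Fin N}, i < k →
      projUpper M i k = M i k + starRingEnd ℂ (M k i) := fun M i k h => by
    simp [projUpper, projSkew, h, h.not_gt]
  have hre : ∀ a : ℂ, ((a.re : ℂ) + a.im * Complex.I) = a := Complex.re_add_im
  have hT : ∀ i j, (todaField J A i j : ℂ) + todaField J A' i j * Complex.I =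
      O i j + if j = i then ∑ k, G i k else 0 := by
    intro i j
    rcases lt_trichotomy i j with h | rfl | h
    · simp only [todaField, hO, Matrix.of_apply, h, h.not_gt, if_true, if_false, h.ne', hA, hA',
        add_zero]
      rw [← hre (u i * u i), ← hre (u j * u j)]
      apply Complex.ext <;> simp <;> ring
    · simp only [todaField, hO, Matrix.of_apply, lt_irrefl, if_true, if_false, zero_add]
      push_cast
      rw [Finset.sum_mul, ← Finset.sum_add_distrib]
      refine Finset.sum_congr rfl fun k _ => ?_
      simp only [hG]
      rcases lt_trichotomy i k with h | rfl | h
      · rw [projUpper_apply_of_lt A h, projUpper_apply_of_lt A' h, hupper A h, hupper A' h]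
        simp only [h, h.not_gt, if_true, if_false, hA, hA']
        rw [mul_comm (u k) (u i)]
        apply Complex.ext <;> simp <;> ring
      · simp
      · rw [projUpper_apply_of_lt A h, projUpper_apply_of_lt A' h, hupper A h, hupper A' h]
        simp only [h, if_true, hA, hA']
        rw [mul_comm (u i) (u k)]
        apply Complex.ext <;> simp <;> ring
    · simp only [todaField, hO, Matrix.of_apply, h, if_true, if_false, h.ne, hA, hA', add_zero]
      apply Complex.ext <;> simp <;> ring
  -- The excess of each row over its Wronskian form; it is antisymmetric in the two indices and sums
  -- to zero.
  set D : Fin N → Fin N → ℂ := fun i k => if k < i then -(J i k * (y i * y k) * (u i ^ 2 + u k ^ 2))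
    else if i < k then J i k * (y i * y k) * (u i ^ 2 + u k ^ 2) else 0 with hD
  have hDsum : ∑ i, ∑ k, D i k = 0 := by
    have hswap : ∑ i, ∑ k, D i k = -∑ i, ∑ k, D i k := by
      conv_lhs => rw [Finset.sum_comm]
      simp only [← Finset.sum_neg_distrib]
      refine Finset.sum_congr rfl fun i _ => Finset.sum_congr rfl fun k _ => ?_
      simp only [hD]
      rcases lt_trichotomy i k with h | rfl | h
      · simp only [h, h.not_gt, if_true, if_false, hsymm k i]; ring
      · simp
      · simp only [h, h.not_gt, if_true, if_false, hsymm k i]; ring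
    exact self_eq_neg.1 hswap
  have hrow : ∀ i, ∑ j, ((todaField J A i j : ℂ) + todaField J A' i j * Complex.I) * (y i * y j) =
      -(2 * (u i * y i * (∑ k with k < i, (J i k : ℂ) * (u k * y i - u i * y k) +
        ∑ k with i < k, (J i k : ℂ) * (u i * y k - u k * y i)))) + ∑ k, D i k := by
    intro i
    simp only [hT, add_mul, Finset.sum_add_distrib, ite_mul, zero_mul, Finset.sum_ite_eq',
      Finset.mem_univ, if_true, Finset.sum_filter]
    rw [Finset.sum_mul, ← Finset.sum_add_distrib, ← Finset.sum_add_distrib, Finset.mul_sum,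
      Finset.mul_sum, ← Finset.sum_neg_distrib, ← Finset.sum_add_distrib]
    refine Finset.sum_congr rfl fun k _ => ?_
    simp only [hO, hG, hD]
    rcases lt_trichotomy i k with h | rfl | h
    · simp only [h, h.not_gt, if_true, if_false]; ring
    · simp
    · simp only [h, h.not_gt, if_true, if_false]; ring
  rw [Finset.sum_congr rfl fun i _ => hrow i, Finset.sum_add_distrib, hDsum, add_zero,
    Finset.sum_neg_distrib, Finset.mul_sum]

end Wronskian

end

section

/-! ### The Jacobi matrix of a spectral measure -/

section SpectralMatrix

open InnerProductSpace

variable {N : ℕ}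

/-- The vectors `(x_j^k √w_j)_j`. -/
def krylovVector (y : (Fin N → ℝ) × (Fin N → ℝ)) (k : Fin N) : EuclideanSpace ℝ (Fin N) :=
  WithLp.toLp 2 fun j => y.1 j ^ (k : ℕ) * √(y.2 j)

/-- The orthonormal basis obtained from the vectors `(x_j^k √w_j)_j`: normalized orthogonal
polynomials at the nodes, times `√w_j`. -/
def spectralBasis (y : (Fin N → ℝ) × (Fin N → ℝ)) (k : Fin N) : EuclideanSpace ℝ (Fin N) :=
  gramSchmidtNormed ℝ (krylovVector y) k

/-- The matrix of the multiplication by the variable in the basis of orthonormal polynomials. -/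
def spectralMatrix (y : (Fin N → ℝ) × (Fin N → ℝ)) : Matrix (Fin N) (Fin N) ℝ :=
  Matrix.of fun k l => ∑ j, spectralBasis y k j * y.1 j * spectralBasis y l j

lemma real_inner_eq_sum (a b : EuclideanSpace ℝ (Fin N)) : inner ℝ a b = ∑ j, a j * b j := by
  rw [PiLp.inner_apply]
  exact Finset.sum_congr rfl fun j _ => by simp [mul_comm]

/-- A Vandermonde matrix with distinct nodes, its columns scaled by the positive numbers `√w_j`. -/
lemma linearIndependent_krylovVector {y : (Fin N → ℝ) × (Fin N → ℝ)} (hy : y ∈ spectralDomain N) :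
    LinearIndependent ℝ (krylovVector y) := by
  have hdet : ((Matrix.vandermonde y.1).transpose * Matrix.diagonal fun j => √(y.2 j)).det ≠ 0 := by
    rw [Matrix.det_mul, Matrix.det_transpose, Matrix.det_diagonal]
    exact mul_ne_zero (Matrix.det_vandermonde_ne_zero_iff.2 hy.1.injective)
      (Finset.prod_ne_zero_iff.2 fun j _ => (Real.sqrt_pos.2 (hy.2.2 j)).ne')
  have h := (Matrix.linearIndependent_rows_of_det_ne_zero hdet).map'
    (WithLp.linearEquiv 2 ℝ (Fin N → ℝ)).symm.toLinearMap (LinearEquiv.ker _)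
  convert h using 1
  · funext k
    ext j
    simp [krylovVector, Matrix.mul_diagonal, Matrix.vandermonde]
  · rfl

variable {y : (Fin N → ℝ) × (Fin N → ℝ)}

lemma orthonormal_spectralBasis (hy : y ∈ spectralDomain N) (k l : Fin N) :
    ∑ j, spectralBasis y k j * spectralBasis y l j = if k = l then 1 else 0 := by
  rw [← real_inner_eq_sum]
  exact orthonormal_iff_ite.1 (gramSchmidtNormed_orthonormal (linearIndependent_krylovVector hy)) k l

lemma gramSchmidt_krylovVector_norm_pos (hy : y ∈ spectralDomain N) (k : Fin N) :
    0 < ‖gramSchmidt ℝ (krylovVector y) k‖ :=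
  norm_pos_iff.2 (gramSchmidt_ne_zero k (linearIndependent_krylovVector hy))

lemma spectralBasis_eq (y : (Fin N → ℝ) × (Fin N → ℝ)) (k : Fin N) : spectralBasis y k =
    ‖gramSchmidt ℝ (krylovVector y) k‖⁻¹ • gramSchmidt ℝ (krylovVector y) k := rfl

lemma sum_spectralBasis_krylovVector (y : (Fin N → ℝ) × (Fin N → ℝ)) {a k : Fin N} (h : a < k) :
    ∑ j, spectralBasis y k j * krylovVector y a j = 0 := by
  rw [← real_inner_eq_sum, spectralBasis_eq, real_inner_smul_left,
    gramSchmidt_inv_triangular ℝ _ h, mul_zero]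

lemma sub_gramSchmidt_mem_span {E ι : Type*} [NormedAddCommGroup E] [InnerProductSpace ℝ E]
    [LinearOrder ι] [LocallyFiniteOrderBot ι] [WellFoundedLT ι] (f : ι → E) (i : ι) :
    f i - gramSchmidt ℝ f i ∈ Submodule.span ℝ (f '' Set.Iio i) := by
  rw [gramSchmidt_def ℝ f i, sub_sub_cancel, ← span_gramSchmidt_Iio]
  refine Submodule.sum_mem _ fun a ha => ?_
  refine Submodule.span_mono ?_ (Submodule.starProjection_apply_mem _ _)
  exact Set.singleton_subset_iff.2 ⟨a, Finset.mem_Iio.1 ha, rfl⟩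

lemma sum_spectralBasis_of_mem_span (y : (Fin N → ℝ) × (Fin N → ℝ)) {s : Set (Fin N)} {k : Fin N}
    (hs : ∀ a ∈ s, a < k) {v : EuclideanSpace ℝ (Fin N)}
    (hv : v ∈ Submodule.span ℝ (krylovVector y '' s)) : ∑ j, spectralBasis y k j * v j = 0 := by
  induction hv using Submodule.span_induction with
  | mem v hv =>
    obtain ⟨a, ha, rfl⟩ := hv
    exact sum_spectralBasis_krylovVector y (hs a ha)
  | zero => simp
  | add a b _ _ ha hb => simp [mul_add, Finset.sum_add_distrib, ha, hb]
  | smul c a _ ha =>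
    simp only [PiLp.smul_apply, smul_eq_mul, mul_left_comm, ← Finset.mul_sum, ha, mul_zero]

lemma krylovVector_succ (y : (Fin N → ℝ) × (Fin N → ℝ)) {a b : Fin N} (h : (a : ℕ) + 1 = b)
    (j : Fin N) : y.1 j * krylovVector y a j = krylovVector y b j := by
  simp only [krylovVector, ← h, pow_succ]
  ring

/-- Multiplication by the variable raises degrees by one, so degrees below `k - 1` stay orthogonal
to the basis vector of index `k`. -/
lemma sum_spectralBasis_mul_of_mem_span (y : (Fin N → ℝ) × (Fin N → ℝ)) {s : Set (Fin N)}
    {k : Fin N} (hs : ∀ a ∈ s, (a : ℕ) + 1 < k) {v : EuclideanSpace ℝ (Fin N)}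
    (hv : v ∈ Submodule.span ℝ (krylovVector y '' s)) :
    ∑ j, v j * y.1 j * spectralBasis y k j = 0 := by
  induction hv using Submodule.span_induction with
  | mem v hv =>
    obtain ⟨a, ha, rfl⟩ := hv
    rw [← sum_spectralBasis_krylovVector y (a := ⟨a + 1, (hs a ha).trans k.2⟩) (k := k)
      (Fin.lt_def.2 (hs a ha))]
    refine Finset.sum_congr rfl fun j _ => ?_
    rw [← krylovVector_succ y (a := a) (b := ⟨a + 1, (hs a ha).trans k.2⟩) rfl j]
    ring
  | zero => simp
  | add a b _ _ ha hb => simp [add_mul, Finset.sum_add_distrib, ha, hb]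
  | smul c a _ ha =>
    simp only [PiLp.smul_apply, smul_eq_mul, mul_assoc, ← Finset.mul_sum] at ha ⊢
    rw [ha, mul_zero]

lemma sum_spectralBasis_krylovVector_self (hy : y ∈ spectralDomain N) (k : Fin N) :
    ∑ j, spectralBasis y k j * krylovVector y k j = ‖gramSchmidt ℝ (krylovVector y) k‖ := by
  have h1 := sum_spectralBasis_of_mem_span y (k := k) (s := Set.Iio k) (fun a ha => ha)
    (sub_gramSchmidt_mem_span (krylovVector y) k)
  simp only [PiLp.sub_apply, mul_sub, Finset.sum_sub_distrib] at h1
  rw [sub_eq_zero.1 h1, ← real_inner_eq_sum, spectralBasis_eq, real_inner_smul_left,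
    real_inner_self_eq_norm_sq]
  have := gramSchmidt_krylovVector_norm_pos hy k
  field_simp

/-- Degree counting gives the tridiagonal form. The entry next to the diagonal is the ratio of the
norms of two consecutive monic orthogonal polynomials. -/
lemma isJacobi_spectralMatrix (hy : y ∈ spectralDomain N) : IsJacobi (spectralMatrix y) where
  symm := by
    ext k l
    simp only [spectralMatrix, Matrix.transpose_apply, Matrix.of_apply]
    exact Finset.sum_congr rfl fun j _ => by ring
  tridiagonal i k hik := by
    refine sum_spectralBasis_mul_of_mem_span y (s := Set.Iic i)
      (fun a ha => lt_of_le_of_lt (Nat.succ_le_succ (Fin.le_def.1 ha)) hik) ?_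
    rw [spectralBasis_eq]
    exact Submodule.smul_mem _ _ (gramSchmidt_mem_span ℝ _ le_rfl)
  offdiag_pos i k hik := by
    have h1 := sum_spectralBasis_mul_of_mem_span y (k := k) (s := Set.Iio i)
      (fun a ha => by have := Fin.lt_def.1 ha; omega) (sub_gramSchmidt_mem_span (krylovVector y) i)
    simp only [PiLp.sub_apply, sub_mul, Finset.sum_sub_distrib] at h1
    have h2 : ∑ j, krylovVector y i j * y.1 j * spectralBasis y k j =
        ‖gramSchmidt ℝ (krylovVector y) k‖ := by
      rw [← sum_spectralBasis_krylovVector_self hy]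
      refine Finset.sum_congr rfl fun j _ => ?_
      rw [← krylovVector_succ y hik j]
      ring
    have h3 : spectralMatrix y i k = ‖gramSchmidt ℝ (krylovVector y) i‖⁻¹ *
        ‖gramSchmidt ℝ (krylovVector y) k‖ := by
      rw [← h2, sub_eq_zero.1 h1, Finset.mul_sum]
      simp only [spectralMatrix, Matrix.of_apply]
      refine Finset.sum_congr rfl fun j _ => ?_
      rw [spectralBasis_eq y i, PiLp.smul_apply, smul_eq_mul]
      ring
    rw [h3]
    exact mul_pos (inv_pos.2 (gramSchmidt_krylovVector_norm_pos hy i))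
      (gramSchmidt_krylovVector_norm_pos hy k)

/-- The orthogonal matrix of the basis of orthonormal polynomials. -/
def spectralFrame (y : (Fin N → ℝ) × (Fin N → ℝ)) : Matrix (Fin N) (Fin N) ℝ :=
  Matrix.of fun k j => spectralBasis y k j

lemma spectralFrame_mul_transpose (hy : y ∈ spectralDomain N) :
    spectralFrame y * (spectralFrame y).transpose = 1 := by
  ext k l
  rw [Matrix.mul_apply, Matrix.one_apply, ← orthonormal_spectralBasis hy]
  rfl

lemma spectralMatrix_eq (y : (Fin N → ℝ) × (Fin N → ℝ)) : spectralMatrix y =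
    spectralFrame y * Matrix.diagonal y.1 * (spectralFrame y).transpose := by
  ext k l
  rw [Matrix.mul_apply]
  simp [spectralMatrix, spectralFrame, Matrix.mul_diagonal]

lemma spectralMatrix_pow (hy : y ∈ spectralDomain N) (k : ℕ) : spectralMatrix y ^ k =
    spectralFrame y * Matrix.diagonal (fun j => y.1 j ^ k) * (spectralFrame y).transpose := by
  have h1 := spectralFrame_mul_transpose hy
  have h2 := mul_eq_one_comm.1 h1
  induction k with
  | zero => simp [h1]
  | succ k ih =>
    rw [pow_succ, ih, spectralMatrix_eq]
    simp only [Matrix.mul_assoc]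
    rw [← Matrix.mul_assoc _ (spectralFrame y), h2, Matrix.one_mul, ← Matrix.mul_assoc (Matrix.diagonal _),
      Matrix.diagonal_mul_diagonal]
    simp only [pow_succ]

variable [NeZero N]

/-- The orthonormal polynomial of degree zero is the constant `1`, because the total mass is one. -/
lemma spectralBasis_zero (p : SpectralData N) (j : Fin N) :
    spectralBasis (p.x, p.w) 0 j = √(p.w j) := by
  have h1 : gramSchmidt ℝ (krylovVector (p.x, p.w)) 0 = krylovVector (p.x, p.w) 0 := by
    rw [gramSchmidt_def, Finset.sum_eq_zero, sub_zero]
    intro a ha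
    exact absurd (Finset.mem_Iio.1 ha) (by simp)
  have h2 : ‖krylovVector (p.x, p.w) 0‖ = 1 := by
    rw [EuclideanSpace.norm_eq, Real.sqrt_eq_one, ← p.sum_w]
    refine Finset.sum_congr rfl fun j _ => ?_
    simp [krylovVector, Real.sq_sqrt (p.pos_w j).le]
  rw [spectralBasis_eq, h1, h2]
  simp [krylovVector]

lemma isSpectralMeasure_spectralMatrix (p : SpectralData N) :
    IsSpectralMeasure (spectralMatrix (p.x, p.w)) p := by
  refine ⟨isJacobi_spectralMatrix p.mem_spectralDomain, fun k => ?_⟩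
  rw [spectralMatrix_pow p.mem_spectralDomain, SpectralData.measure,
    integral_sum_dirac (fun j => (p.pos_w j).le)]
  rw [Matrix.mul_apply]
  simp only [Matrix.mul_diagonal, spectralFrame, Matrix.of_apply, Matrix.transpose_apply,
    spectralBasis_zero, smul_eq_mul]
  refine Finset.sum_congr rfl fun j _ => ?_
  rw [mul_right_comm, Real.mul_self_sqrt (p.pos_w j).le]

end SpectralMatrix

/-! ### Differentiability of the Jacobi matrix in the nodes and weights -/

section Smoothness

open InnerProductSpace

variable {N : ℕ} {y : (Fin N → ℝ) × (Fin N → ℝ)}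

lemma differentiableAt_krylovVector (hy : y ∈ spectralDomain N) (k : Fin N) :
    DifferentiableAt ℝ (fun y => krylovVector y k) y := by
  refine (differentiableAt_piLp 2).2 fun j => ?_
  simp only [krylovVector]
  refine DifferentiableAt.mul (by fun_prop) (DifferentiableAt.sqrt (by fun_prop) (hy.2.2 j).ne')

lemma differentiableAt_gramSchmidt_krylovVector (hy : y ∈ spectralDomain N) (k : Fin N) :
    DifferentiableAt ℝ (fun y => gramSchmidt ℝ (krylovVector y) k) y := by
  induction k using WellFoundedLT.induction with
  | _ k ih =>
    have h : (fun y : (Fin N → ℝ) × (Fin N → ℝ) => gramSchmidt ℝ (krylovVector y) k) =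
        fun y => krylovVector y k - ∑ i ∈ Finset.Iio k,
          (inner ℝ (gramSchmidt ℝ (krylovVector y) i) (krylovVector y k) *
            (‖gramSchmidt ℝ (krylovVector y) i‖ ^ 2)⁻¹) • gramSchmidt ℝ (krylovVector y) i := by
      funext y
      simp only [← div_eq_mul_inv]
      exact eq_sub_of_add_eq (gramSchmidt_def'' ℝ (krylovVector y) k).symm
    rw [h]
    refine (differentiableAt_krylovVector hy k).sub (DifferentiableAt.fun_sum fun i hi => ?_)
    have hi' := ih i (Finset.mem_Iio.1 hi)
    refine DifferentiableAt.fun_smul (DifferentiableAt.fun_mul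
      (hi'.inner ℝ (differentiableAt_krylovVector hy k)) ((hi'.norm_sq ℝ).fun_inv ?_)) hi'
    exact pow_ne_zero 2 (gramSchmidt_krylovVector_norm_pos hy i).ne'

lemma differentiableAt_spectralMatrix (hy : y ∈ spectralDomain N) :
    DifferentiableAt ℝ (spectralMatrix (N := N)) y := by
  have h : ∀ k, DifferentiableAt ℝ (fun y => spectralBasis y k) y := fun k => by
    have hk := differentiableAt_gramSchmidt_krylovVector hy k
    simp only [spectralBasis_eq]
    exact ((hk.norm ℝ (norm_pos_iff.1 (gramSchmidt_krylovVector_norm_pos hy k))).inv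
      (gramSchmidt_krylovVector_norm_pos hy k).ne').smul hk
  have h2 : DifferentiableAt ℝ (fun (y : (Fin N → ℝ) × (Fin N → ℝ)) (k l : Fin N) =>
      ∑ j, spectralBasis y k j * y.1 j * spectralBasis y l j) y := by
    refine differentiableAt_pi.2 fun k => differentiableAt_pi.2 fun l => ?_
    refine DifferentiableAt.fun_sum fun j _ => ?_
    have h1 := fun k => (differentiableAt_piLp 2).1 (h k) j
    exact ((h1 k).mul (by fun_prop)).mul (h1 l)
  exact h2

end Smoothness

end

section

/-! ### Jacobi matrices are determined by their moments -/

section Moments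

variable {N : ℕ} [NeZero N]

lemma IsJacobi.pow_apply_eq_zero {J : Matrix (Fin N) (Fin N) ℝ} (hJ : IsJacobi J) (a : ℕ) :
    ∀ {k : Fin N}, a < (k : ℕ) → (J ^ a) 0 k = 0 := by
  induction a with
  | zero =>
    intro k hk
    rw [pow_zero, Matrix.one_apply_ne]
    rintro rfl
    simp at hk
  | succ a ih =>
    intro k hk
    rw [pow_succ, Matrix.mul_apply]
    refine Finset.sum_eq_zero fun j _ => ?_
    rcases lt_or_ge a (j : ℕ) with h | h
    · rw [ih h, zero_mul]
    · rw [hJ.tridiagonal j k (by omega), mul_zero]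

/-- The only path of length `a` from `0` to `a` crosses each of the first `a` positive off-diagonal
entries once. -/
lemma IsJacobi.pow_apply_pos {J : Matrix (Fin N) (Fin N) ℝ} (hJ : IsJacobi J) (a : ℕ) :
    ∀ {k : Fin N}, (k : ℕ) = a → 0 < (J ^ a) 0 k := by
  induction a with
  | zero =>
    intro k hk
    have : k = 0 := Fin.ext (by simpa using hk)
    simp [this]
  | succ a ih =>
    intro k hk
    have ha : a < N := by have := k.2; omega
    rw [pow_succ, Matrix.mul_apply, Finset.sum_eq_single ⟨a, ha⟩]
    · exact mul_pos (ih rfl) (hJ.offdiag_pos _ _ hk.symm)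
    · intro j _ hj
      have hj' : (j : ℕ) ≠ a := fun h => hj (Fin.ext h)
      rcases lt_or_ge a (j : ℕ) with h | h
      · rw [hJ.pow_apply_eq_zero a h, zero_mul]
      · rw [hJ.tridiagonal j k (by omega), mul_zero]
    · simp

omit [NeZero N] in
lemma IsJacobi.pow_symm {J : Matrix (Fin N) (Fin N) ℝ} (hJ : IsJacobi J) (a : ℕ) (i j : Fin N) :
    (J ^ a) i j = (J ^ a) j i := by
  have h : (J ^ a).transpose = J ^ a := by rw [Matrix.transpose_pow, hJ.symm]
  exact congrFun (congrFun h.symm i) j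

/-- A perturbation of Jacobi matrices with vanishing moments is trivial. -/
lemma symmTridiagonal_eq_zero_of_moments {J J' ξ : Matrix (Fin N) (Fin N) ℝ} (hJ : IsJacobi J)
    (hJ' : IsJacobi J') (hξ : IsSymmTridiagonal ξ)
    (h : ∀ m : ℕ, ∑ q ∈ Finset.HasAntidiagonal.antidiagonal m, (J ^ q.1 * ξ * J' ^ q.2) 0 0 = 0) : ξ = 0 := by
  have hsymm : ∀ i j, ξ i j = ξ j i := fun i j => hξ.1.apply j i
  have hfar : ∀ i j : Fin N, (i : ℕ) + 1 < j ∨ (j : ℕ) + 1 < i → ξ i j = 0 := by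
    rintro i j (hij | hij)
    · exact hξ.2 i j hij
    · rw [hsymm, hξ.2 j i hij]
  -- Induction on `k + l`. In the moment of order `s` the powers reach only entries with index sum
  -- at most `s`, and those with a smaller sum are already zero.
  suffices H : ∀ (s : ℕ) (k l : Fin N), (k : ℕ) + l = s → ξ k l = 0 from
    Matrix.ext fun k l => H _ k l rfl
  intro s
  induction s using Nat.strong_induction_on with
  | _ s ih =>
    intro k l hkl
    by_cases hfar' : (k : ℕ) + 1 < l ∨ (l : ℕ) + 1 < k
    · exact hfar k l hfar'
    -- Up to symmetry only one entry of the three diagonals has index sum `s`, so the surviving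
    -- terms all have the sign of `ξ k l` and cannot cancel.
    have hsign : ∀ a b : Fin N, (a : ℕ) + b = s → 0 ≤ ξ a b * ξ k l := by
      intro a b hab
      by_cases hfar'' : (a : ℕ) + 1 < b ∨ (b : ℕ) + 1 < a
      · rw [hfar a b hfar'', zero_mul]
      · have : (a = k ∧ b = l) ∨ (a = l ∧ b = k) := by
          simp only [Fin.ext_iff]
          omega
        rcases this with ⟨rfl, rfl⟩ | ⟨rfl, rfl⟩
        · exact mul_self_nonneg _
        · rw [hsymm]
          exact mul_self_nonneg _
    have hterm : ∀ q ∈ Finset.HasAntidiagonal.antidiagonal s, ∀ j i : Fin N,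
        0 ≤ (J ^ q.1) 0 i * ξ i j * (J' ^ q.2) j 0 * ξ k l := by
      intro q hq j i
      have hq' := Finset.HasAntidiagonal.mem_antidiagonal.1 hq
      rw [hJ'.pow_symm]
      rcases lt_or_ge q.1 (i : ℕ) with h1 | h1
      · simp [hJ.pow_apply_eq_zero _ h1]
      rcases lt_or_ge q.2 (j : ℕ) with h2 | h2
      · simp [hJ'.pow_apply_eq_zero _ h2]
      rcases lt_or_ge ((i : ℕ) + j) s with h3 | h3
      · simp [ih _ h3 i j rfl]
      have h4 := hJ.pow_apply_pos q.1 (k := i) (by omega)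
      have h5 := hJ'.pow_apply_pos q.2 (k := j) (by omega)
      have h6 := mul_nonneg (mul_nonneg h4.le h5.le) (hsign i j (by omega))
      linarith
    have hsum : ∑ q ∈ Finset.HasAntidiagonal.antidiagonal s, ∑ j, ∑ i,
        (J ^ q.1) 0 i * ξ i j * (J' ^ q.2) j 0 * ξ k l = 0 := by
      rw [← zero_mul (ξ k l), ← h s, Finset.sum_mul]
      refine Finset.sum_congr rfl fun q _ => ?_
      simp only [Matrix.mul_apply, Finset.sum_mul]
    have hz1 := (Finset.sum_eq_zero_iff_of_nonneg fun q hq =>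
      Finset.sum_nonneg fun j _ => Finset.sum_nonneg fun i _ => hterm q hq j i).1 hsum
      ((k : ℕ), (l : ℕ)) (Finset.HasAntidiagonal.mem_antidiagonal.2 hkl)
    have hmem : ((k : ℕ), (l : ℕ)) ∈ Finset.HasAntidiagonal.antidiagonal s := Finset.HasAntidiagonal.mem_antidiagonal.2 hkl
    have hz2 := (Finset.sum_eq_zero_iff_of_nonneg fun j _ =>
      Finset.sum_nonneg fun i _ => hterm _ hmem j i).1 hz1 l (Finset.mem_univ _)
    have hz3 := (Finset.sum_eq_zero_iff_of_nonneg fun i _ => hterm _ hmem l i).1 hz2 k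
      (Finset.mem_univ _)
    have h4 := hJ.pow_apply_pos k (k := k) rfl
    have h5 := hJ'.pow_apply_pos l (k := l) rfl
    rw [← hJ'.pow_symm] at h5
    simpa [h4.ne', h5.ne'] using hz3

lemma sum_antidiagonal_pow_sub {R : Type*} [Ring R] (a b : R) (m : ℕ) :
    ∑ q ∈ Finset.HasAntidiagonal.antidiagonal m, a ^ q.1 * (a - b) * b ^ q.2 = a ^ (m + 1) - b ^ (m + 1) := by
  induction m with
  | zero => simp
  | succ m ih =>
    have h : ∀ q : ℕ × ℕ, a ^ (q.1 + 1) * (a - b) * b ^ q.2 = a * (a ^ q.1 * (a - b) * b ^ q.2) :=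
      fun q => by rw [pow_succ']; simp only [mul_assoc]
    rw [Finset.Nat.sum_antidiagonal_succ, Finset.sum_congr rfl fun q _ => h q, ← Finset.mul_sum, ih,
      pow_succ' a (m + 1), pow_succ' b (m + 1)]
    noncomm_ring

/-- `sum_antidiagonal_pow_sub` expresses differences of moments through `J - J'`; this is why the
rigidity lemma admits two different Jacobi matrices. -/
lemma IsSpectralMeasure.unique {J J' : Matrix (Fin N) (Fin N) ℝ} {p : SpectralData N}
    (hJ : IsSpectralMeasure J p) (hJ' : IsSpectralMeasure J' p) : J = J' := by
  refine sub_eq_zero.1 (symmTridiagonal_eq_zero_of_moments hJ.1 hJ'.1 ⟨?_, fun i j hij => ?_⟩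
    fun m => ?_)
  · exact hJ.1.symm.sub hJ'.1.symm
  · rw [Matrix.sub_apply, hJ.1.tridiagonal i j hij, hJ'.1.tridiagonal i j hij, sub_zero]
  · have h := congrFun (congrFun (sum_antidiagonal_pow_sub J J' m) 0) 0
    rw [Matrix.sum_apply, Matrix.sub_apply, hJ.2, hJ'.2, sub_self] at h
    exact h

end Moments

/-! ### The resolvent of the Jacobi matrix of a spectral measure -/

section Resolvent

variable {N : ℕ}

/-- The resolvent of the Jacobi matrix with given nodes and weights. -/
def spectralResolvent (p : SpectralData N) (z : ℂ) : Matrix (Fin N) (Fin N) ℂ :=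
  Matrix.of fun i j => ∑ l, (spectralBasis (p.x, p.w) i l : ℂ) * (1 / ((p.x l : ℂ) - z)) *
    spectralBasis (p.x, p.w) j l

lemma spectralMatrix_sub_mul_resolvent (p : SpectralData N) {z : ℂ} (hz : z.im ≠ 0) :
    ((spectralMatrix (p.x, p.w)).map ((↑) : ℝ → ℂ) - z • 1) * spectralResolvent p z = 1 := by
  set Q := (spectralFrame (p.x, p.w)).map ((↑) : ℝ → ℂ) with hQ
  have h1 : Q * Q.transpose = 1 := by
    have h := congrArg (fun M : Matrix (Fin N) (Fin N) ℝ => M.map Complex.ofRealHom)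
      (spectralFrame_mul_transpose p.mem_spectralDomain)
    simp only [Matrix.map_mul, Matrix.transpose_map] at h
    rw [Matrix.map_one _ (map_zero _) (map_one _)] at h
    exact h
  have h2 : Q.transpose * Q = 1 := mul_eq_one_comm.1 h1
  have hJ : (spectralMatrix (p.x, p.w)).map ((↑) : ℝ → ℂ) =
      Q * Matrix.diagonal (fun j => (p.x j : ℂ)) * Q.transpose := by
    have h := congrArg (fun M : Matrix (Fin N) (Fin N) ℝ => M.map Complex.ofRealHom)
      (spectralMatrix_eq (p.x, p.w))
    simp only [Matrix.map_mul, Matrix.transpose_map] at h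
    rw [Matrix.diagonal_map (map_zero _)] at h
    exact h
  have hG : spectralResolvent p z =
      Q * Matrix.diagonal (fun j => 1 / ((p.x j : ℂ) - z)) * Q.transpose := by
    ext i j
    rw [Matrix.mul_apply]
    simp [spectralResolvent, Matrix.mul_diagonal, hQ, spectralFrame]
  have hz1 : z • (1 : Matrix (Fin N) (Fin N) ℂ) =
      Q * Matrix.diagonal (fun _ => z) * Q.transpose := by
    rw [← Matrix.smul_one_eq_diagonal, Matrix.mul_smul, Matrix.mul_one, Matrix.smul_mul, h1]
  rw [hJ, hG, hz1, ← sub_mul, ← mul_sub, Matrix.diagonal_sub]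
  simp only [Matrix.mul_assoc]
  rw [← Matrix.mul_assoc _ Q, h2, Matrix.one_mul, ← Matrix.mul_assoc (Matrix.diagonal _),
    Matrix.diagonal_mul_diagonal]
  simp only [mul_one_div_cancel (ofReal_sub_ne_zero hz _), Matrix.diagonal_one, Matrix.one_mul, h1]

variable [NeZero N]

/-- The first column of the resolvent. -/
def resolventVector (p : SpectralData N) (z : ℂ) (i : Fin N) : ℂ := spectralResolvent p z i 0

lemma sum_mul_resolventVector (p : SpectralData N) {z : ℂ} (hz : z.im ≠ 0) (i : Fin N) :
    ∑ k, (spectralMatrix (p.x, p.w) i k : ℂ) * resolventVector p z k =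
      z * resolventVector p z i + if i = 0 then 1 else 0 := by
  have h := congrFun (congrFun (spectralMatrix_sub_mul_resolvent p hz) i) 0
  rw [sub_mul, Matrix.sub_apply, Matrix.smul_mul, Matrix.one_mul, Matrix.smul_apply,
    Matrix.mul_apply, Matrix.one_apply] at h
  exact sub_eq_iff_eq_add'.1 h

lemma resolventVector_zero (p : SpectralData N) (z : ℂ) :
    resolventVector p z 0 = mFun p.measure z := by
  rw [mFun_measure]
  simp only [resolventVector, spectralResolvent, Matrix.of_apply]
  refine Finset.sum_congr rfl fun l _ => ?_
  rw [spectralBasis_zero, mul_right_comm, ← Complex.ofReal_mul, Real.mul_self_sqrt (p.pos_w l).le]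

omit [NeZero N] in
lemma sum_conjugate_quadratic {R : Type*} [CommRing R] (Q ξ : Fin N → Fin N → R) (o : Fin N)
    (α β : Fin N → R) :
    ∑ k, ∑ k', (∑ j, Q o j * α j * Q k j) * ξ k k' * (∑ l, Q k' l * β l * Q o l) =
      ∑ j, ∑ l, α j * β l * (Q o j * Q o l * ∑ k, ∑ k', Q k j * ξ k k' * Q k' l) := by
  have h1 : ∀ k k', (∑ j, Q o j * α j * Q k j) * ξ k k' * (∑ l, Q k' l * β l * Q o l) =
      ∑ j, ∑ l, α j * β l * (Q o j * Q o l * (Q k j * ξ k k' * Q k' l)) := by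
    intro k k'
    simp only [Finset.sum_mul, Finset.mul_sum]
    rw [Finset.sum_comm]
    exact Finset.sum_congr rfl fun j _ => Finset.sum_congr rfl fun l _ => by ring
  have h2 : ∀ k, ∑ k', ∑ j, ∑ l, α j * β l * (Q o j * Q o l * (Q k j * ξ k k' * Q k' l)) =
      ∑ j, ∑ k', ∑ l, α j * β l * (Q o j * Q o l * (Q k j * ξ k k' * Q k' l)) :=
    fun k => Finset.sum_comm
  simp only [h1, h2]
  rw [Finset.sum_comm]
  refine Finset.sum_congr rfl fun j _ => ?_
  rw [Finset.sum_congr rfl fun k _ => Finset.sum_comm, Finset.sum_comm]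
  refine Finset.sum_congr rfl fun l _ => ?_
  simp only [Finset.mul_sum]

/-- A symmetric tridiagonal matrix is determined by its values on the first columns of the
resolvents. -/
lemma symmTridiagonal_eq_zero_of_resolventVector (p : SpectralData N)
    {ξ : Matrix (Fin N) (Fin N) ℝ} (hξ : IsSymmTridiagonal ξ) {y₀ : ℝ}
    (h : ∀ y : ℝ, y₀ < y → ∑ i, ∑ j, (ξ i j : ℂ) *
      (resolventVector p (y * Complex.I) i * resolventVector p (y * Complex.I) j) = 0) : ξ = 0 := by
  set Q : Fin N → Fin N → ℝ := fun k j => spectralBasis (p.x, p.w) k j with hQ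
  -- In the eigenbasis the quadratic form on the resolvent vector is `∑ c j l * r j * r l` with `r j
  -- = 1 / (x_j - z)`.
  set c : Fin N → Fin N → ℝ := fun j l => Q 0 j * Q 0 l * ∑ k, ∑ k', Q k j * ξ k k' * Q k' l with hc
  have hcsymm : ∀ j l, c j l = c l j := by
    intro j l
    simp only [hc]
    rw [Finset.sum_comm, mul_comm (Q 0 j)]
    congr 1
    refine Finset.sum_congr rfl fun k _ => Finset.sum_congr rfl fun k' _ => ?_
    rw [hξ.1.apply]
    ring
  -- Partial fractions: `c j l * r j * r l = d j l * (r l - r j)` for `j ≠ l`. On the diagonal `d`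
  -- is zero by division by zero, and `c j j` is the coefficient of a double pole.
  set d : Fin N → Fin N → ℝ := fun j l => c j l / (p.x j - p.x l) with hd
  have hdanti : ∀ j l, d j l = -d l j := by
    intro j l
    simp only [hd]
    rw [hcsymm, ← neg_sub (p.x l), div_neg]
  have hne : ∀ {j l}, j ≠ l → p.x j - p.x l ≠ 0 := fun hjl =>
    sub_ne_zero.2 (p.strictMono_x.injective.ne hjl)
  have hpoles := poles_eq_zero (α := fun j => ((-2 * ∑ l, d j l : ℝ) : ℂ))
    (β := fun j => (c j j : ℂ)) (y₀ := max y₀ 0) p.strictMono_x.injective fun y hy => by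
      have hz := im_mul_I_ne_zero ((le_max_right _ _).trans_lt hy)
      set r : Fin N → ℂ := fun j => 1 / ((p.x j : ℂ) - y * Complex.I) with hr
      have h0 := h y ((le_max_left _ _).trans_lt hy)
      have h1 := sum_conjugate_quadratic (fun k j => (Q k j : ℂ)) (fun k k' => (ξ k k' : ℂ)) 0 r r
      have h2 : ∑ j, ∑ l, r j * r l * (c j l : ℂ) = 0 := by
        rw [← h0]
        simp only [hc]
        push_cast
        rw [← h1]
        refine Finset.sum_congr rfl fun k _ => Finset.sum_congr rfl fun k' _ => ?_
        have e1 : resolventVector p (y * Complex.I) k = ∑ j, (Q 0 j : ℂ) * r j * Q k j := by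
          simp only [resolventVector, spectralResolvent, Matrix.of_apply]
          exact Finset.sum_congr rfl fun j _ => by simp only [hQ, hr]; ring
        have e2 : resolventVector p (y * Complex.I) k' = ∑ j, (Q k' j : ℂ) * r j * Q 0 j := rfl
        rw [e1, e2]
        ring
      have h3 : ∀ j l, r j * r l * (c j l : ℂ) =
          (d j l : ℂ) * (r l - r j) + if l = j then (c j j : ℂ) * r j ^ 2 else 0 := by
        intro j l
        split_ifs with hjl
        · subst hjl
          ring
        · have h4 := hne (Ne.symm hjl)
          have h4' : (p.x j : ℂ) - p.x l ≠ 0 := by exact_mod_cast h4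
          have h5 := ofReal_sub_ne_zero hz (p.x j)
          have h6 := ofReal_sub_ne_zero hz (p.x l)
          simp only [hd, hr]
          push_cast
          field_simp
          ring
      have h7 : ∑ j, ∑ l, (d j l : ℂ) * r l = -∑ j, ∑ l, (d j l : ℂ) * r j := by
        rw [Finset.sum_comm, ← Finset.sum_neg_distrib]
        refine Finset.sum_congr rfl fun j _ => ?_
        rw [← Finset.sum_neg_distrib]
        refine Finset.sum_congr rfl fun l _ => ?_
        rw [hdanti l j]
        push_cast
        ring
      rw [← h2, Finset.sum_congr rfl fun j _ => Finset.sum_congr rfl fun l _ => h3 j l]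
      simp only [Finset.sum_add_distrib, mul_sub, Finset.sum_sub_distrib, Finset.sum_ite_eq',
        Finset.mem_univ, if_true]
      rw [h7]
      congr 1
      rw [← neg_add', ← two_mul, Finset.mul_sum, ← Finset.sum_neg_distrib]
      refine Finset.sum_congr rfl fun j _ => ?_
      rw [← Finset.sum_mul]
      push_cast
      ring
  have hdsum : ∀ j, ∑ l, d j l = 0 := fun j => by
    have := congrFun hpoles.1 j
    simp only [Pi.zero_apply, Complex.ofReal_eq_zero] at this
    linarith
  have hcdiag : ∀ j, c j j = 0 := fun j => by simpa using congrFun hpoles.2 j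
  have hcd : ∀ j l, c j l = (p.x j - p.x l) * d j l := by
    intro j l
    by_cases hjl : j = l
    · subst hjl
      rw [hcdiag, sub_self, zero_mul]
    · simp only [hd]
      rw [mul_div_cancel₀ _ (hne hjl)]
  have hJ := isJacobi_spectralMatrix p.mem_spectralDomain
  -- The vanishing poles give `c j j = 0` and zero row sums of `d`. The moment of order `m` becomes
  -- `∑ (x_j^(m+1) - x_l^(m+1)) * d j l`, and each half vanishes by the row sums.
  refine symmTridiagonal_eq_zero_of_moments hJ hJ hξ fun m => ?_
  have hpow : ∀ (a : ℕ) i j, (spectralMatrix (p.x, p.w) ^ a) i j =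
      ∑ l, Q i l * p.x l ^ a * Q j l := by
    intro a i j
    rw [spectralMatrix_pow p.mem_spectralDomain, Matrix.mul_apply]
    simp [Matrix.mul_diagonal, spectralFrame, hQ]
  have hmom : ∀ a b : ℕ, (spectralMatrix (p.x, p.w) ^ a * ξ * spectralMatrix (p.x, p.w) ^ b) 0 0 =
      ∑ j, ∑ l, p.x j ^ a * p.x l ^ b * c j l := by
    intro a b
    rw [← sum_conjugate_quadratic Q ξ 0 (fun j => p.x j ^ a) (fun j => p.x j ^ b), Finset.sum_comm,
      Matrix.mul_apply]
    refine Finset.sum_congr rfl fun k' _ => ?_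
    rw [Matrix.mul_apply, Finset.sum_mul]
    refine Finset.sum_congr rfl fun k _ => ?_
    rw [hpow, hpow]
  simp only [hmom]
  rw [Finset.sum_comm]
  have h8 : ∀ j, ∑ q ∈ Finset.HasAntidiagonal.antidiagonal m, ∑ l, p.x j ^ q.1 * p.x l ^ q.2 * c j l =
      ∑ l, (p.x j ^ (m + 1) - p.x l ^ (m + 1)) * d j l := by
    intro j
    rw [Finset.sum_comm]
    refine Finset.sum_congr rfl fun l _ => ?_
    rw [← sum_antidiagonal_pow_sub, Finset.sum_mul]
    refine Finset.sum_congr rfl fun q _ => ?_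
    rw [hcd]
    ring
  rw [Finset.sum_congr rfl fun j _ => h8 j]
  simp only [sub_mul, Finset.sum_sub_distrib, ← Finset.mul_sum, hdsum, mul_zero,
    zero_sub, Finset.sum_neg_distrib]
  rw [neg_eq_zero, Finset.sum_comm]
  refine Finset.sum_eq_zero fun l _ => ?_
  rw [← Finset.mul_sum, Finset.sum_congr rfl fun j _ => hdanti j l, Finset.sum_neg_distrib, hdsum,
    neg_zero, mul_zero]

end Resolvent

end

section

/-! ### Resolvent entries as functions of a matrix -/

section ResolventExtension

variable {N : ℕ}

lemma contDiff_det {E : Type*} [NormedAddCommGroup E] [NormedSpace ℝ E]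
    {A : E → Matrix (Fin N) (Fin N) ℂ} (hA : ∀ i j, ContDiff ℝ ∞ fun X => A X i j) :
    ContDiff ℝ ∞ fun X => (A X).det := by
  simp only [Matrix.det_apply']
  exact ContDiff.sum fun σ _ => contDiff_const.mul (contDiff_prod fun i _ => hA _ _)

lemma contDiff_adjugate {E : Type*} [NormedAddCommGroup E] [NormedSpace ℝ E]
    {A : E → Matrix (Fin N) (Fin N) ℂ} (hA : ∀ i j, ContDiff ℝ ∞ fun X => A X i j) (i j : Fin N) :
    ContDiff ℝ ∞ fun X => (A X).adjugate i j := by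
  simp only [Matrix.adjugate_apply]
  refine contDiff_det fun k l => ?_
  by_cases hk : k = j
  · subst hk
    simp only [Matrix.updateRow_self]
    exact contDiff_const
  · simp only [Matrix.updateRow_ne hk]
    exact hA k l

/-- The matrix `-iX - z`, equal to `J - z` for `X = iJ`. -/
def shiftedMatrix (z : ℂ) (X : Matrix (Fin N) (Fin N) ℂ) : Matrix (Fin N) (Fin N) ℂ :=
  -Complex.I • X - z • 1

lemma contDiff_shiftedMatrix_apply (z : ℂ) (i j : Fin N) :
    ContDiff ℝ ∞ fun X : Matrix (Fin N) (Fin N) ℂ => shiftedMatrix z X i j := by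
  have h : ContDiff ℝ ∞ fun X : Matrix (Fin N) (Fin N) ℂ => X i j := contDiff_apply_apply ℝ ℂ i j
  simp only [shiftedMatrix, Matrix.sub_apply, Matrix.smul_apply, smul_eq_mul]
  exact (contDiff_const.mul h).sub contDiff_const

/-- The domain of the resolvent. -/
def resolventDomain (N : ℕ) (z : ℂ) : Set (Matrix (Fin N) (Fin N) ℂ) :=
  {X | (shiftedMatrix z X).det ≠ 0}

lemma isOpen_resolventDomain (z : ℂ) : IsOpen (resolventDomain N z) :=
  isOpen_compl_singleton.preimage (contDiff_det (contDiff_shiftedMatrix_apply z)).continuous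

/-- The resolvent entry `((-iX - z)⁻¹)_{ij}`. -/
def resolventEntry (z : ℂ) (i j : Fin N) (X : Matrix (Fin N) (Fin N) ℂ) : ℂ :=
  (shiftedMatrix z X)⁻¹ i j

lemma contDiffOn_resolventEntry (z : ℂ) (i j : Fin N) :
    ContDiffOn ℝ ∞ (resolventEntry z i j) (resolventDomain N z) := by
  have h : resolventEntry (N := N) z i j = fun X =>
      (shiftedMatrix z X).det⁻¹ * (shiftedMatrix z X).adjugate i j := by
    funext X
    rw [resolventEntry, Matrix.inv_def, Matrix.smul_apply, smul_eq_mul, Ring.inverse_eq_inv']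
  rw [h]
  exact ((contDiff_det (contDiff_shiftedMatrix_apply z)).contDiffOn.inv fun X hX => hX).mul
    (contDiff_adjugate (contDiff_shiftedMatrix_apply z) i j).contDiffOn

lemma shiftedMatrix_iEmbed (z : ℂ) (J : Matrix (Fin N) (Fin N) ℝ) :
    shiftedMatrix z (iEmbed J) = J.map ((↑) : ℝ → ℂ) - z • 1 := by
  unfold shiftedMatrix
  congr 1
  ext i j
  simp [iEmbed, ← mul_assoc]

lemma iEmbed_spectralMatrix_mem (p : SpectralData N) {z : ℂ} (hz : z.im ≠ 0) :
    iEmbed (spectralMatrix (p.x, p.w)) ∈ resolventDomain N z := by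
  have h := spectralMatrix_sub_mul_resolvent p hz
  rw [← shiftedMatrix_iEmbed] at h
  exact (Matrix.isUnit_det_of_right_inverse h).ne_zero

lemma inv_shiftedMatrix (p : SpectralData N) {z : ℂ} (hz : z.im ≠ 0) :
    (shiftedMatrix z (iEmbed (spectralMatrix (p.x, p.w))))⁻¹ = spectralResolvent p z :=
  Matrix.inv_eq_right_inv (by rw [shiftedMatrix_iEmbed, spectralMatrix_sub_mul_resolvent p hz])

variable [NeZero N]

/-- At `iJ` the corner entry of the resolvent is `m`, because the spectral measure determines the
Jacobi matrix. -/
lemma isMatrixExtension_mRe {z : ℂ} (hz : z.im ≠ 0) :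
    IsMatrixExtension (resolventDomain N z) (mRe N z hz) fun X => (resolventEntry z 0 0 X).re where
  smooth := Complex.reCLM.contDiff.comp_contDiffOn (contDiffOn_resolventEntry z 0 0)
  extends_ J p hJ _ := by
    rw [hJ.unique (isSpectralMeasure_spectralMatrix p), resolventEntry, inv_shiftedMatrix p hz]
    exact congrArg Complex.re (resolventVector_zero p z)

lemma isMatrixExtension_mIm {z : ℂ} (hz : z.im ≠ 0) :
    IsMatrixExtension (resolventDomain N z) (mIm N z hz) fun X => (resolventEntry z 0 0 X).im where
  smooth := Complex.imCLM.contDiff.comp_contDiffOn (contDiffOn_resolventEntry z 0 0)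
  extends_ J p hJ _ := by
    rw [hJ.unique (isSpectralMeasure_spectralMatrix p), resolventEntry, inv_shiftedMatrix p hz]
    exact congrArg Complex.im (resolventVector_zero p z)

lemma IsMatrixExtension.mono {U V : Set (Matrix (Fin N) (Fin N) ℂ)} {f : smoothFunctions N}
    {φ : Matrix (Fin N) (Fin N) ℂ → ℝ} (h : IsMatrixExtension U f φ) (hVU : V ⊆ U) :
    IsMatrixExtension V f φ :=
  ⟨h.smooth.mono hVU, fun J p hJ hV => h.extends_ J p hJ (hVU hV)⟩

omit [NeZero N] in
lemma differentiableAt_resolventEntry (z : ℂ) (i j : Fin N) {X : Matrix (Fin N) (Fin N) ℂ}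
    (hX : X ∈ resolventDomain N z) : DifferentiableAt ℝ (resolventEntry z i j) X :=
  ((contDiffOn_resolventEntry z i j).contDiffAt ((isOpen_resolventDomain z).mem_nhds hX)).differentiableAt
    (by simp)

omit [NeZero N] in
lemma spectralResolvent_symm (p : SpectralData N) (z : ℂ) (i j : Fin N) :
    spectralResolvent p z i j = spectralResolvent p z j i := by
  simp only [spectralResolvent, Matrix.of_apply]
  exact Finset.sum_congr rfl fun l _ => by ring

/-- The resolvent identity gives the derivative `i G Y G`, and symmetry of `G` expresses its corner
entry through the first column alone. -/
lemma fderiv_resolventEntry (p : SpectralData N) {z : ℂ} (hz : z.im ≠ 0)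
    (Y : Matrix (Fin N) (Fin N) ℂ) :
    fderiv ℝ (resolventEntry z 0 0) (iEmbed (spectralMatrix (p.x, p.w))) Y =
      Complex.I * ∑ a, ∑ b, resolventVector p z a * Y a b * resolventVector p z b := by
  set X₀ := iEmbed (spectralMatrix (p.x, p.w)) with hX₀
  set G := spectralResolvent p z with hG
  have hX₀mem : X₀ ∈ resolventDomain N z := iEmbed_spectralMatrix_mem p hz
  have hG0 : G * shiftedMatrix z X₀ = 1 := by
    rw [mul_eq_one_comm, hX₀, shiftedMatrix_iEmbed]
    exact spectralMatrix_sub_mul_resolvent p hz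
  refine fderiv_apply_eq_of_hasDerivAt (differentiableAt_resolventEntry z 0 0 hX₀mem) ?_
  have hev : ∀ᶠ t : ℝ in 𝓝 0, X₀ + t • Y ∈ resolventDomain N z :=
    eventually_add_smul_mem (isOpen_resolventDomain z) hX₀mem Y
  -- An exact identity along the line: the increment is `t` times a differentiable function of `t`,
  -- so the derivative at `0` is the value of that function at `0`.
  have hline : ∀ t : ℝ, X₀ + t • Y ∈ resolventDomain N z → resolventEntry z 0 0 (X₀ + t • Y) =
      G 0 0 + (t : ℂ) * (Complex.I * ∑ a, ∑ b, G 0 a * Y a b *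
        resolventEntry z b 0 (X₀ + t • Y)) := by
    intro t ht
    have hS : shiftedMatrix z (X₀ + t • Y) = shiftedMatrix z X₀ - ((t : ℂ) * Complex.I) • Y := by
      unfold shiftedMatrix
      ext i j
      simp
      ring
    have h1 : shiftedMatrix z (X₀ + t • Y) * (shiftedMatrix z (X₀ + t • Y))⁻¹ = 1 :=
      Matrix.mul_nonsing_inv _ (isUnit_iff_ne_zero.2 ht)
    set R := (shiftedMatrix z (X₀ + t • Y))⁻¹ with hR
    have h2 : R = G + ((t : ℂ) * Complex.I) • (G * (Y * R)) := by
      have h3 : G * (shiftedMatrix z (X₀ + t • Y) * R) = G := by rw [h1, Matrix.mul_one]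
      rw [hS, sub_mul, mul_sub, ← Matrix.mul_assoc, hG0, Matrix.one_mul, Matrix.smul_mul,
        Matrix.mul_smul] at h3
      exact (sub_eq_iff_eq_add.1 h3)
    have h4 := congrFun (congrFun h2 0) 0
    change R 0 0 = _
    rw [h4, Matrix.add_apply, Matrix.smul_apply, Matrix.mul_apply, smul_eq_mul, mul_assoc]
    congr 3
    refine Finset.sum_congr rfl fun a _ => ?_
    rw [Matrix.mul_apply, Finset.mul_sum]
    refine Finset.sum_congr rfl fun b _ => ?_
    rw [mul_assoc]
    rfl
  have hd : ∀ b, DifferentiableAt ℝ (fun t : ℝ => resolventEntry z b 0 (X₀ + t • Y)) 0 := by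
    intro b
    have h0 : X₀ = X₀ + (0 : ℝ) • Y := by simp
    refine DifferentiableAt.comp (0 : ℝ) (g := resolventEntry z b 0) ?_ ?_
    · rw [← h0]
      exact differentiableAt_resolventEntry z b 0 hX₀mem
    · exact ((differentiableAt_id.smul_const Y).const_add X₀)
  have hD : DifferentiableAt ℝ (fun t : ℝ => Complex.I * ∑ a, ∑ b, G 0 a * Y a b *
      resolventEntry z b 0 (X₀ + t • Y)) 0 :=
    DifferentiableAt.const_mul (DifferentiableAt.fun_sum fun a _ => DifferentiableAt.fun_sum
      fun b _ => (hd b).const_mul _) _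
  have h5 := ((Complex.ofRealCLM.hasDerivAt (x := (0 : ℝ))).mul hD.hasDerivAt).const_add (G 0 0)
  refine (h5.congr_of_eventuallyEq (hev.mono fun t ht => hline t ht)).congr_deriv ?_
  simp only [Complex.ofRealCLM_apply, Complex.ofReal_zero, zero_mul, add_zero, Complex.ofReal_one,
    one_mul, zero_smul]
  congr 1
  refine Finset.sum_congr rfl fun a _ => Finset.sum_congr rfl fun b _ => ?_
  rw [resolventEntry, hX₀, inv_shiftedMatrix p hz, hG, spectralResolvent_symm p z 0 a]
  rfl

lemma fderiv_resolventEntry_re (p : SpectralData N) {z : ℂ} (hz : z.im ≠ 0)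
    (Y : Matrix (Fin N) (Fin N) ℂ) :
    fderiv ℝ (fun X => (resolventEntry z 0 0 X).re) (iEmbed (spectralMatrix (p.x, p.w))) Y =
      (fderiv ℝ (resolventEntry z 0 0) (iEmbed (spectralMatrix (p.x, p.w))) Y).re := by
  have h := differentiableAt_resolventEntry z 0 0 (iEmbed_spectralMatrix_mem p hz)
  have e := (Complex.reCLM.hasFDerivAt.comp (iEmbed (spectralMatrix (p.x, p.w))) h.hasFDerivAt).fderiv
  exact congrArg (fun L : Matrix (Fin N) (Fin N) ℂ →L[ℝ] ℝ => L Y) e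

lemma fderiv_resolventEntry_im (p : SpectralData N) {z : ℂ} (hz : z.im ≠ 0)
    (Y : Matrix (Fin N) (Fin N) ℂ) :
    fderiv ℝ (fun X => (resolventEntry z 0 0 X).im) (iEmbed (spectralMatrix (p.x, p.w))) Y =
      (fderiv ℝ (resolventEntry z 0 0) (iEmbed (spectralMatrix (p.x, p.w))) Y).im := by
  have h := differentiableAt_resolventEntry z 0 0 (iEmbed_spectralMatrix_mem p hz)
  have e := (Complex.imCLM.hasFDerivAt.comp (iEmbed (spectralMatrix (p.x, p.w))) h.hasFDerivAt).fderiv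
  exact congrArg (fun L : Matrix (Fin N) (Fin N) ℂ →L[ℝ] ℝ => L Y) e

lemma fderiv_resolventEntry_single (p : SpectralData N) {z : ℂ} (hz : z.im ≠ 0) (i j : Fin N)
    (c : ℂ) :
    fderiv ℝ (resolventEntry z 0 0) (iEmbed (spectralMatrix (p.x, p.w))) (Matrix.single i j c) =
      Complex.I * c * (resolventVector p z i * resolventVector p z j) := by
  rw [fderiv_resolventEntry p hz, Finset.sum_eq_single i, Finset.sum_eq_single j,
    Matrix.single_apply_same]
  · ring
  · intro b _ hb
    rw [Matrix.single_apply_of_col_ne _ _ hb.symm, mul_zero, zero_mul]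
  · simp
  · intro a _ ha
    exact Finset.sum_eq_zero fun b _ => by
      rw [Matrix.single_apply_of_row_ne ha.symm, mul_zero, zero_mul]
  · simp

lemma fderiv_resolventEntry_iEmbed (p : SpectralData N) {z : ℂ} (hz : z.im ≠ 0)
    (η : Matrix (Fin N) (Fin N) ℝ) :
    fderiv ℝ (resolventEntry z 0 0) (iEmbed (spectralMatrix (p.x, p.w))) (iEmbed η) =
      -∑ a, ∑ b, (η a b : ℂ) * (resolventVector p z a * resolventVector p z b) := by
  rw [fderiv_resolventEntry p hz, Finset.mul_sum, ← Finset.sum_neg_distrib]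
  refine Finset.sum_congr rfl fun a _ => ?_
  rw [Finset.mul_sum, ← Finset.sum_neg_distrib]
  refine Finset.sum_congr rfl fun b _ => ?_
  simp only [iEmbed, Matrix.map_apply]
  linear_combination (resolventVector p z a * η a b * resolventVector p z b) * Complex.I_mul_I

lemma matrixGradient_resolventEntry_re (p : SpectralData N) {z : ℂ} (hz : z.im ≠ 0) (i j : Fin N) :
    matrixGradient (fun X => (resolventEntry z 0 0 X).re) (iEmbed (spectralMatrix (p.x, p.w))) i j =
      -(resolventVector p z i * resolventVector p z j) := by
  simp only [matrixGradient, Matrix.of_apply, fderiv_resolventEntry_re p hz,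
    fderiv_resolventEntry_single p hz]
  apply Complex.ext <;> simp <;> ring

lemma matrixGradient_resolventEntry_im (p : SpectralData N) {z : ℂ} (hz : z.im ≠ 0) (i j : Fin N) :
    matrixGradient (fun X => (resolventEntry z 0 0 X).im) (iEmbed (spectralMatrix (p.x, p.w))) i j =
      Complex.I * (resolventVector p z i * resolventVector p z j) := by
  simp only [matrixGradient, Matrix.of_apply, fderiv_resolventEntry_im p hz,
    fderiv_resolventEntry_single p hz]
  apply Complex.ext <;> simp <;> ring

/-- The Lie-Poisson bracket of a function with a resolvent entry. -/
lemma liePoissonBracket_resolventEntry (p : SpectralData N) {w : ℂ} (hw : w.im ≠ 0)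
    (φ : Matrix (Fin N) (Fin N) ℂ → ℝ) :
    (liePoissonBracket φ (fun X => (resolventEntry w 0 0 X).re)
        (iEmbed (spectralMatrix (p.x, p.w))) : ℂ) +
      liePoissonBracket φ (fun X => (resolventEntry w 0 0 X).im)
        (iEmbed (spectralMatrix (p.x, p.w))) * Complex.I =
      -(1 / 2) * ∑ a, ∑ b, (todaField (spectralMatrix (p.x, p.w))
        (matrixGradient φ (iEmbed (spectralMatrix (p.x, p.w)))) a b : ℂ) *
          (resolventVector p w a * resolventVector p w b) := by
  have hJ := isJacobi_spectralMatrix p.mem_spectralDomain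
  rw [liePoissonBracket_iEmbed hJ, liePoissonBracket_iEmbed hJ, fderiv_resolventEntry_re p hw,
    fderiv_resolventEntry_im p hw]
  rw [neg_mul, ← mul_neg, ← fderiv_resolventEntry_iEmbed p hw]
  conv_rhs => rw [← Complex.re_add_im (fderiv ℝ (resolventEntry w 0 0) _ _)]
  push_cast
  ring

/-- `sum_todaField_rankOne` and `wronskian_identity` apply with the resolvent vectors at `z` and
`w`. The factor `1 / 2` of the Lie-Poisson bracket cancels the `2` of the former, and `m_H = m` for
`H = 1`. -/
lemma liePoissonBracket_resolventEntry_resolventEntry (p : SpectralData N) {z w : ℂ}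
    (hz : z.im ≠ 0) (hw : w.im ≠ 0) (hzw : z ≠ w) :
    ((liePoissonBracket (fun X => (resolventEntry z 0 0 X).re)
        (fun X => (resolventEntry w 0 0 X).re) (iEmbed (spectralMatrix (p.x, p.w))) -
      liePoissonBracket (fun X => (resolventEntry z 0 0 X).im)
        (fun X => (resolventEntry w 0 0 X).im) (iEmbed (spectralMatrix (p.x, p.w))) : ℝ) : ℂ) +
    ((liePoissonBracket (fun X => (resolventEntry z 0 0 X).re)
        (fun X => (resolventEntry w 0 0 X).im) (iEmbed (spectralMatrix (p.x, p.w))) +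
      liePoissonBracket (fun X => (resolventEntry z 0 0 X).im)
        (fun X => (resolventEntry w 0 0 X).re) (iEmbed (spectralMatrix (p.x, p.w))) : ℝ) : ℂ) *
      Complex.I = bracketRHS (mFunH (fun _ => 1) p.measure) p.measure z w := by
  have hJ := isJacobi_spectralMatrix p.mem_spectralDomain
  have h1 := liePoissonBracket_resolventEntry p hw fun X => (resolventEntry z 0 0 X).re
  have h2 := liePoissonBracket_resolventEntry p hw fun X => (resolventEntry z 0 0 X).im
  have h3 := sum_todaField_rankOne hJ (resolventVector p z) (resolventVector p w)
    (matrixGradient_resolventEntry_re p hz) (matrixGradient_resolventEntry_im p hz)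
  rw [wronskian_identity hJ hzw (sum_mul_resolventVector p hz) (sum_mul_resolventVector p hw)] at h3
  simp only [add_mul, Finset.sum_add_distrib, resolventVector_zero] at h3
  have h4 : bracketRHS (mFunH (fun _ => 1) p.measure) p.measure z w =
      (mFun p.measure z - mFun p.measure w) * ((mFun p.measure z - mFun p.measure w) / (z - w) -
        mFun p.measure z * mFun p.measure w) := by
    simp only [bracketRHS, mFunH, mFun, Complex.ofReal_one]
  have h5 : ∀ (A : Matrix (Fin N) (Fin N) ℝ), ∑ a, ∑ b, (A a b : ℂ) * Complex.I *
      (resolventVector p w a * resolventVector p w b) = Complex.I * ∑ a, ∑ b, (A a b : ℂ) *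
      (resolventVector p w a * resolventVector p w b) := by
    intro A
    simp only [Finset.mul_sum]
    exact Finset.sum_congr rfl fun a _ => Finset.sum_congr rfl fun b _ => by ring
  rw [h5] at h3
  rw [h4]
  push_cast
  linear_combination h1 + Complex.I * h2 - (1 / 2) * h3 -
    (liePoissonBracket (fun X => (resolventEntry z 0 0 X).im)
        (fun X => (resolventEntry w 0 0 X).im) (iEmbed (spectralMatrix (p.x, p.w))) : ℂ) *
      Complex.I_mul_I

end ResolventExtension

end

section

/-! ### The Toda bracket -/

section Toda

variable {N : ℕ} [NeZero N]

/-- Agreement of the Lie-Poisson bracket of resolvents with the bracket for `H = 1`. -/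
lemma liePoissonBracket_eq_of_isHBracket {T : Bracket N} (hT : IsHBracket (fun _ => 1) T)
    (p : SpectralData N) {z w : ℂ} (hz : z.im ≠ 0) (hw : w.im ≠ 0) (hzw : z ≠ w)
    (hzw' : z ≠ starRingEnd ℂ w) {φ : Matrix (Fin N) (Fin N) ℂ → ℝ} {f : smoothFunctions N}
    (hφ : (φ = fun X => (resolventEntry z 0 0 X).re) ∧ f = mRe N z hz ∨
      (φ = fun X => (resolventEntry z 0 0 X).im) ∧ f = mIm N z hz) :
    liePoissonBracket φ (fun X => (resolventEntry w 0 0 X).re)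
        (iEmbed (spectralMatrix (p.x, p.w))) = (T f (mRe N w hw)).1 p ∧
      liePoissonBracket φ (fun X => (resolventEntry w 0 0 X).im)
        (iEmbed (spectralMatrix (p.x, p.w))) = (T f (mIm N w hw)).1 p := by
  have hw' := conj_im_ne_zero hw
  have h1 := (liePoissonBracket_resolventEntry_resolventEntry p hz hw hzw).trans
    (hT.2 z w hz hw hzw p).symm
  have h2 := (liePoissonBracket_resolventEntry_resolventEntry p hz hw' hzw').trans
    (hT.2 z _ hz hw' hzw' p).symm
  have hvec : ∀ a, resolventVector p (starRingEnd ℂ w) a = starRingEnd ℂ (resolventVector p w a) := by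
    intro a
    simp [resolventVector, spectralResolvent]
  -- Replacing `w` by its conjugate flips the sign of the imaginary part only, so the two complex
  -- identities `h1` and `h2` separate into four real ones.
  have hconj : ∀ ψ : Matrix (Fin N) (Fin N) ℂ → ℝ,
      liePoissonBracket ψ (fun X => (resolventEntry (starRingEnd ℂ w) 0 0 X).re)
          (iEmbed (spectralMatrix (p.x, p.w))) =
        liePoissonBracket ψ (fun X => (resolventEntry w 0 0 X).re)
          (iEmbed (spectralMatrix (p.x, p.w))) ∧
      liePoissonBracket ψ (fun X => (resolventEntry (starRingEnd ℂ w) 0 0 X).im)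
          (iEmbed (spectralMatrix (p.x, p.w))) =
        -liePoissonBracket ψ (fun X => (resolventEntry w 0 0 X).im)
          (iEmbed (spectralMatrix (p.x, p.w))) := by
    intro ψ
    have e1 := liePoissonBracket_resolventEntry p hw ψ
    have e2 := liePoissonBracket_resolventEntry p hw' ψ
    have e3 : ∀ A : Matrix (Fin N) (Fin N) ℝ, -(1 / 2) * ∑ a, ∑ b, (A a b : ℂ) *
        (resolventVector p (starRingEnd ℂ w) a * resolventVector p (starRingEnd ℂ w) b) =
        starRingEnd ℂ (-(1 / 2) * ∑ a, ∑ b, (A a b : ℂ) *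
          (resolventVector p w a * resolventVector p w b)) := by
      intro A
      rw [show (-(1 / 2) : ℂ) = ((-(1 / 2) : ℝ) : ℂ) by push_cast; rfl]
      simp only [hvec, map_mul, map_sum, Complex.conj_ofReal]
    rw [e3, ← e1] at e2
    have e4 := congrArg Complex.re e2
    have e5 := congrArg Complex.im e2
    simp at e4 e5
    exact ⟨e4, e5⟩
  have hneg : ∀ f, (T f (-mIm N w hw)).1 p = -(T f (mIm N w hw)).1 p := fun f => by
    rw [map_neg]; rfl
  rw [mRe_conj hw, mIm_conj hw] at h2
  simp only [complexBracket, hneg, (hconj _).1, (hconj _).2] at h1 h2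
  have h3 := congrArg Complex.re h1
  have h4 := congrArg Complex.im h1
  have h5 := congrArg Complex.re h2
  have h6 := congrArg Complex.im h2
  simp only [Complex.add_re, Complex.add_im, Complex.re_ofReal_mul, Complex.im_ofReal_mul,
    Complex.ofReal_re, Complex.ofReal_im, Complex.I_re, Complex.I_im, mul_zero, mul_one, add_zero,
    zero_add] at h3 h4 h5 h6
  rcases hφ with ⟨rfl, rfl⟩ | ⟨rfl, rfl⟩ <;> constructor <;> linarith

/-- Resolvent entries are admissible extensions on the common domain of two resolvents, so the
defining property of the Toda bracket can be evaluated on them. -/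
lemma IsTodaBracket.isHBracket {T : Bracket N} (hT : IsTodaBracket T) :
    IsHBracket (fun _ => 1) T := by
  refine ⟨hT.1, fun z w hz hw hzw p => ?_⟩
  rw [← liePoissonBracket_resolventEntry_resolventEntry p hz hw hzw]
  have hopen := (isOpen_resolventDomain (N := N) z).inter (isOpen_resolventDomain w)
  have hmem : iEmbed (spectralMatrix (p.x, p.w)) ∈ resolventDomain N z ∩ resolventDomain N w :=
    ⟨iEmbed_spectralMatrix_mem p hz, iEmbed_spectralMatrix_mem p hw⟩
  have hJ := isSpectralMeasure_spectralMatrix p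
  have l := fun {f φ} (h : IsMatrixExtension (resolventDomain N z) f φ) =>
    h.mono (Set.inter_subset_left (t := resolventDomain N w))
  have r := fun {f φ} (h : IsMatrixExtension (resolventDomain N w) f φ) =>
    h.mono (Set.inter_subset_right (s := resolventDomain N z))
  rw [complexBracket,
    hT.2 _ _ _ _ _ hopen (l (isMatrixExtension_mRe hz)) (r (isMatrixExtension_mRe hw)) _ p hJ hmem,
    hT.2 _ _ _ _ _ hopen (l (isMatrixExtension_mIm hz)) (r (isMatrixExtension_mIm hw)) _ p hJ hmem,
    hT.2 _ _ _ _ _ hopen (l (isMatrixExtension_mRe hz)) (r (isMatrixExtension_mIm hw)) _ p hJ hmem,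
    hT.2 _ _ _ _ _ hopen (l (isMatrixExtension_mIm hz)) (r (isMatrixExtension_mRe hw)) _ p hJ hmem]

omit [NeZero N] in
lemma eventually_spectralData (p : SpectralData N) {v : (Fin N → ℝ) × (Fin N → ℝ)}
    (hv : ∑ j, v.2 j = 0) : ∀ᶠ t : ℝ in 𝓝 0, ∃ q : SpectralData N, (q.x, q.w) = (p.x, p.w) + t • v := by
  filter_upwards [eventually_add_smul_mem (isOpen_spectralDomain N) p.mem_spectralDomain v] with t ht
  refine ⟨⟨_, _, ht.1, ht.2.1, ht.2.2, ?_⟩, rfl⟩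
  simp only [Prod.snd_add, Prod.smul_snd, Pi.add_apply, Pi.smul_apply, smul_eq_mul,
    Finset.sum_add_distrib, ← Finset.mul_sum, hv, p.sum_w]
  simp

/-- The embedding `J ↦ iJ` as a continuous linear map. -/
def iEmbedCLM (N : ℕ) : Matrix (Fin N) (Fin N) ℝ →L[ℝ] Matrix (Fin N) (Fin N) ℂ :=
  LinearMap.toContinuousLinearMap
    { toFun := iEmbed
      map_add' := fun A B => by ext i j; simp [iEmbed, mul_add]
      map_smul' := fun r A => by ext i j; simp [iEmbed, mul_left_comm] }

omit [NeZero N] in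
lemma hasDerivAt_spectralMatrix_line (p : SpectralData N) (v : (Fin N → ℝ) × (Fin N → ℝ)) :
    HasDerivAt (fun t : ℝ => spectralMatrix ((p.x, p.w) + t • v))
      (fderiv ℝ (spectralMatrix (N := N)) (p.x, p.w) v) 0 :=
  hasDerivAt_comp_line (differentiableAt_spectralMatrix p.mem_spectralDomain) v

omit [NeZero N] in
lemma isSymmTridiagonal_fderiv_spectralMatrix (p : SpectralData N)
    (v : (Fin N → ℝ) × (Fin N → ℝ)) :
    IsSymmTridiagonal (fderiv ℝ (spectralMatrix (N := N)) (p.x, p.w) v) := by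
  have hentry : ∀ i j, HasDerivAt (fun t : ℝ => spectralMatrix ((p.x, p.w) + t • v) i j)
      (fderiv ℝ (spectralMatrix (N := N)) (p.x, p.w) v i j) 0 := fun i j =>
    hasDerivAt_pi.1 (hasDerivAt_pi.1 (hasDerivAt_spectralMatrix_line p v) i) j
  have hev := eventually_add_smul_mem (isOpen_spectralDomain N) p.mem_spectralDomain v
  constructor
  · ext i j
    refine (hentry j i).unique ((hentry i j).congr_of_eventuallyEq (hev.mono fun t ht => ?_))
    exact (isJacobi_spectralMatrix ht).symm.apply i j
  · intro i j hij
    refine (hentry i j).unique ((hasDerivAt_const (0 : ℝ) (0 : ℝ)).congr_of_eventuallyEq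
      (hev.mono fun t ht => ?_))
    exact (isJacobi_spectralMatrix ht).tridiagonal i j hij

/-- Directional derivatives of an extension along the Jacobi matrices. -/
lemma fderiv_matrixExtension {U : Set (Matrix (Fin N) (Fin N) ℂ)} (hU : IsOpen U)
    {f : smoothFunctions N} {φ : Matrix (Fin N) (Fin N) ℂ → ℝ} (hφ : IsMatrixExtension U f φ)
    {F : (Fin N → ℝ) × (Fin N → ℝ) → ℝ} (hF : ContDiffOn ℝ ∞ F (spectralDomain N))
    (hf : ∀ q : SpectralData N, F (q.x, q.w) = f.1 q) (p : SpectralData N)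
    (hp : iEmbed (spectralMatrix (p.x, p.w)) ∈ U) {v : (Fin N → ℝ) × (Fin N → ℝ)}
    (hv : ∑ j, v.2 j = 0) :
    fderiv ℝ φ (iEmbed (spectralMatrix (p.x, p.w)))
      (iEmbed (fderiv ℝ (spectralMatrix (N := N)) (p.x, p.w) v)) = fderiv ℝ F (p.x, p.w) v := by
  have h1 : HasDerivAt (fun t : ℝ => iEmbed (spectralMatrix ((p.x, p.w) + t • v)))
      (iEmbed (fderiv ℝ (spectralMatrix (N := N)) (p.x, p.w) v)) 0 :=
    (iEmbedCLM N).hasFDerivAt.comp_hasDerivAt (0 : ℝ) (hasDerivAt_spectralMatrix_line p v)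
  have h0 : iEmbed (spectralMatrix ((p.x, p.w) + (0 : ℝ) • v)) =
      iEmbed (spectralMatrix (p.x, p.w)) := by rw [zero_smul, add_zero]
  have hd : DifferentiableAt ℝ φ (iEmbed (spectralMatrix ((p.x, p.w) + (0 : ℝ) • v))) := by
    rw [h0]
    exact (hφ.smooth.contDiffAt (hU.mem_nhds hp)).differentiableAt (by simp)
  have h2 := hd.hasFDerivAt.comp_hasDerivAt (0 : ℝ) h1
  rw [h0] at h2
  have h3 : HasDerivAt (fun t : ℝ => F ((p.x, p.w) + t • v)) (fderiv ℝ F (p.x, p.w) v) 0 :=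
    hasDerivAt_comp_line ((hF.contDiffAt ((isOpen_spectralDomain N).mem_nhds
      p.mem_spectralDomain)).differentiableAt (by simp)) v
  refine h2.unique (h3.congr_of_eventuallyEq ?_)
  have hUev : ∀ᶠ t : ℝ in 𝓝 0, iEmbed (spectralMatrix ((p.x, p.w) + t • v)) ∈ U :=
    h1.continuousAt.eventually_mem (hU.mem_nhds (by rw [h0]; exact hp))
  filter_upwards [hUev, eventually_spectralData p hv] with t ht hq
  obtain ⟨q, hq⟩ := hq
  simp only [Function.comp_apply]
  rw [← hq] at ht ⊢
  rw [hf, hφ.extends_ _ q (isSpectralMeasure_spectralMatrix q) ht]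

omit [NeZero N] in
lemma one_smoothFunctions_apply (q : SpectralData N) : (1 : smoothFunctions N).1 q = 1 := rfl

/-- If the Lie-Poisson bracket with a function agrees with a Poisson bracket on resolvents, then
it agrees on all functions. -/
lemma liePoissonBracket_eq_of_resolventEntry {T : Bracket N} (hT : IsPoissonBracket T)
    (p : SpectralData N) {g : smoothFunctions N} {ψ : Matrix (Fin N) (Fin N) ℂ → ℝ} {y₀ : ℝ}
    (h0 : 0 ≤ y₀)
    (h : ∀ (y : ℝ) (hy : y₀ < y),
      liePoissonBracket ψ (fun X => (resolventEntry (y * Complex.I) 0 0 X).re)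
          (iEmbed (spectralMatrix (p.x, p.w))) =
        (T g (mRe N _ (im_mul_I_ne_zero (h0.trans_lt hy)))).1 p ∧
      liePoissonBracket ψ (fun X => (resolventEntry (y * Complex.I) 0 0 X).im)
          (iEmbed (spectralMatrix (p.x, p.w))) =
        (T g (mIm N _ (im_mul_I_ne_zero (h0.trans_lt hy)))).1 p)
    {U : Set (Matrix (Fin N) (Fin N) ℂ)} (hU : IsOpen U) {f : smoothFunctions N}
    {φ : Matrix (Fin N) (Fin N) ℂ → ℝ} (hφ : IsMatrixExtension U f φ)
    (hp : iEmbed (spectralMatrix (p.x, p.w)) ∈ U) :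
    liePoissonBracket ψ φ (iEmbed (spectralMatrix (p.x, p.w))) = (T g f).1 p := by
  have hJ := isJacobi_spectralMatrix p.mem_spectralDomain
  have hTg : ∀ f, (T g f).1 p = -bracketAt T g p f := fun f => by
    rw [hT.skew]; rfl
  obtain ⟨v, hv⟩ := exists_vector_of_pointDerivation p (-bracketAt T g p) (fun a b => by
    simp only [LinearMap.neg_apply, bracketAt_mul hT]; ring)
  -- A derivation kills constants and the total mass is constant on the manifold, so `v` is tangent
  -- to the hypersurface.
  have hv1 : ∑ j, v.2 j = 0 := by
    have h1 := hv 1 (fun y => ∑ j, y.2 j) (by fun_prop) (fun q => q.sum_w)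
    have h2 : bracketAt T g p 1 = 0 := by
      have := bracketAt_mul hT g p 1 1
      rw [mul_one, one_smoothFunctions_apply] at this
      linarith
    have h3 : fderiv ℝ (fun y : (Fin N → ℝ) × (Fin N → ℝ) => ∑ j, y.2 j) (p.x, p.w) v =
        ∑ j, v.2 j := by
      refine fderiv_apply_eq_of_hasDerivAt (by fun_prop) ?_
      refine HasDerivAt.fun_sum fun j _ => ?_
      simpa using ((hasDerivAt_id (0 : ℝ)).mul_const (v.2 j)).const_add (p.w j)
    rw [← h3, ← h1, LinearMap.neg_apply, h2, neg_zero]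
  have key : ∀ {U : Set (Matrix (Fin N) (Fin N) ℂ)} {f : smoothFunctions N}
      {φ : Matrix (Fin N) (Fin N) ℂ → ℝ}, IsOpen U → IsMatrixExtension U f φ →
      iEmbed (spectralMatrix (p.x, p.w)) ∈ U → (T g f).1 p =
        fderiv ℝ φ (iEmbed (spectralMatrix (p.x, p.w)))
          (iEmbed (fderiv ℝ (spectralMatrix (N := N)) (p.x, p.w) v)) := by
    intro U f φ hU hφ hp
    obtain ⟨F, hF, hf⟩ := f.2
    rw [fderiv_matrixExtension hU hφ hF hf p hp hv1, ← hv f F hF hf, hTg]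
    rfl
  set η := todaField (spectralMatrix (p.x, p.w))
    (matrixGradient ψ (iEmbed (spectralMatrix (p.x, p.w)))) with hη
  set δ := fderiv ℝ (spectralMatrix (N := N)) (p.x, p.w) v with hδ
  have hη' : IsSymmTridiagonal η := isSymmTridiagonal_todaField hJ
    (matrixGradient ψ (iEmbed (spectralMatrix (p.x, p.w))))
  have hδ' : IsSymmTridiagonal δ := isSymmTridiagonal_fderiv_spectralMatrix p v
  have hξ : IsSymmTridiagonal ((1 / 2 : ℝ) • η - δ) := by
    refine ⟨(hη'.1.smul _).sub hδ'.1, fun i j hij => ?_⟩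
    rw [Matrix.sub_apply, Matrix.smul_apply, hη'.2 i j hij, hδ'.2 i j hij, smul_zero, sub_zero]
  have hlin : iEmbed ((1 / 2 : ℝ) • η - δ) = (1 / 2 : ℝ) • iEmbed η - iEmbed δ := by
    change iEmbedCLM N _ = (1 / 2 : ℝ) • iEmbedCLM N _ - iEmbedCLM N _
    rw [map_sub, map_smul]
  -- `η / 2` is the Hamiltonian direction and `δ` the image of `v` among the Jacobi matrices. Both
  -- are symmetric tridiagonal and give the same derivatives of the resolvent entries far up the
  -- imaginary axis.
  have hzero : (1 / 2 : ℝ) • η - δ = 0 := by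
    refine symmTridiagonal_eq_zero_of_resolventVector p hξ (y₀ := y₀) fun y hy => ?_
    have hz := im_mul_I_ne_zero (h0.trans_lt hy)
    have hmem := iEmbed_spectralMatrix_mem p hz
    have h1 := (h y hy).1.trans (key (isOpen_resolventDomain _) (isMatrixExtension_mRe hz) hmem)
    have h2 := (h y hy).2.trans (key (isOpen_resolventDomain _) (isMatrixExtension_mIm hz) hmem)
    rw [liePoissonBracket_iEmbed hJ, ← hη, fderiv_resolventEntry_re p hz,
      fderiv_resolventEntry_re p hz] at h1
    rw [liePoissonBracket_iEmbed hJ, ← hη, fderiv_resolventEntry_im p hz,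
      fderiv_resolventEntry_im p hz] at h2
    have h3 := fderiv_resolventEntry_iEmbed p hz ((1 / 2 : ℝ) • η - δ)
    rw [hlin, map_sub, map_smul] at h3
    refine neg_eq_zero.1 (h3.symm.trans ?_)
    apply Complex.ext
    · rw [Complex.sub_re, Complex.smul_re, smul_eq_mul, h1, sub_self, Complex.zero_re]
    · rw [Complex.sub_im, Complex.smul_im, smul_eq_mul, h2, sub_self, Complex.zero_im]
  rw [key hU hφ hp, liePoissonBracket_iEmbed hJ, ← hη, ← sub_eq_zero.1 hzero]
  have hsm : iEmbed ((1 / 2 : ℝ) • η) = (1 / 2 : ℝ) • iEmbed η := (iEmbedCLM N).map_smul _ _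
  rw [hsm, map_smul, smul_eq_mul]

/-- Agreement on pairs of resolvent entries is known. `liePoissonBracket_eq_of_resolventEntry`, used
twice with skew symmetry in between, frees one slot after the other. -/
lemma IsHBracket.isTodaBracket {T : Bracket N} (hT : IsHBracket (fun _ => 1) T) :
    IsTodaBracket T := by
  refine ⟨hT.1, fun U f g φ ψ hU hf hg J p hJ hJU => ?_⟩
  have hJp := hJ.unique (isSpectralMeasure_spectralMatrix p)
  subst hJp
  have hres : ∀ {z : ℂ} (hz : z.im ≠ 0) {χ : Matrix (Fin N) (Fin N) ℂ → ℝ} {k : smoothFunctions N},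
      (χ = fun X => (resolventEntry z 0 0 X).re) ∧ k = mRe N z hz ∨
        (χ = fun X => (resolventEntry z 0 0 X).im) ∧ k = mIm N z hz →
      liePoissonBracket φ χ (iEmbed (spectralMatrix (p.x, p.w))) = (T f k).1 p := by
    intro z hz χ k hχ
    rw [liePoissonBracket_skew, hT.1.skew,
      liePoissonBracket_eq_of_resolventEntry hT.1 p (abs_nonneg z.im) (fun y hy => ?_) hU hf hJU]
    · rfl
    · have hw := im_mul_I_ne_zero ((abs_nonneg z.im).trans_lt hy)
      refine liePoissonBracket_eq_of_isHBracket hT p hz hw ?_ ?_ hχ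
      · intro h
        rw [h] at hy
        simp at hy
        exact absurd hy (not_lt.2 (le_abs_self y))
      · intro h
        rw [h] at hy
        simp at hy
        exact absurd hy (not_lt.2 (le_abs_self y))
  exact (liePoissonBracket_eq_of_resolventEntry hT.1 p le_rfl (fun y hy =>
    ⟨hres _ (Or.inl ⟨rfl, rfl⟩), hres _ (Or.inr ⟨rfl, rfl⟩)⟩) hU hg hJU).symm

lemma isTodaBracket_iff (T : Bracket N) :
    IsTodaBracket T ↔ T = hamBracket (contDiffOn_const (c := (1 : ℝ))) :=
  Iff.trans ⟨IsTodaBracket.isHBracket, IsHBracket.isTodaBracket⟩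
    (isHBracket_iff (contDiffOn_const (c := (1 : ℝ))) T)

end Toda

end

end

end AblowitzLadik

/-! ### Assembly of the proposition -/

theorem proposition6p2 (h : Circle → ℝ) (h_smooth : ContMDiff (𝓡 1) 𝓘(ℝ, ℝ) ∞ h)
    (h_odd : ∀ z : Circle, h z⁻¹ = -h z) :
    (∀ θ : ℝ, hTransform h (2 * Real.cos θ) = 2 * Real.sin θ * h (Circle.exp θ)) ∧
    (∀ (n : ℕ) (z w : ℂ), z.im ≠ 0 → w.im ≠ 0 → z ≠ w →
      (∃ Φ, IsInvariantExtension n (fun μ => mFun (szegoMeasure μ) z) Φ) ∧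
      ∀ Φ Ψ : Measure ℂ → ℂ,
        IsInvariantExtension n (fun μ => mFun (szegoMeasure μ) z) Φ →
        IsInvariantExtension n (fun μ => mFun (szegoMeasure μ) w) Ψ →
        ∀ c ∈ circleDomain n, conjMeasure (circleMeasure c) = circleMeasure c →
          probBracket n h Φ Ψ c =
            bracketRHS (mFunH (hTransform h) (szegoMeasure (circleMeasure c)))
              (szegoMeasure (circleMeasure c)) z w) ∧
    (∀ (N : ℕ) [NeZero N],
      (∃! B : Bracket N, IsHBracket (hTransform h) B) ∧
      (∃! T : Bracket N, IsTodaBracket T) ∧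
      ∀ B T : Bracket N, IsHBracket (hTransform h) B → IsTodaBracket T → Compatible B T) ∧
    (IsTrigPolynomial h →
      ∃ P : Polynomial ℝ, (∀ t ∈ Set.Icc (-2 : ℝ) 2, hTransform h t = P.eval t) ∧
        ∀ (N : ℕ) [NeZero N],
          (∀ k : ℕ, ∃! K : Bracket N, IsFaybusovichGekhtmanBracket k K) ∧
          ∀ (B : Bracket N) (K : ℕ → Bracket N), IsHBracket (hTransform h) B →
            (∀ k, IsFaybusovichGekhtmanBracket k (K k)) →
            B = ∑ k ∈ Finset.range (P.natDegree + 1), P.coeff k • K k) := by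
  have hH := contDiffOn_hTransform h_smooth
  have hpow : ∀ k : ℕ, ContDiffOn ℝ ∞ (fun t : ℝ => t ^ k) (Set.Ioo (-2) 2) := fun k => by fun_prop
  refine ⟨hTransform_two_mul_cos h_odd, fun n z w hz hw hzw => ⟨⟨_, isInvariantExtension_mFun n hz⟩,
    fun Φ Ψ hΦ hΨ c hc hinv => probBracket_mFun h_odd hz hw hzw hΦ hΨ hc hinv⟩, fun N _ => ⟨?_, ?_, ?_⟩,
    fun hh => ?_⟩
  · simp only [isHBracket_iff hH]
    exact existsUnique_eq
  · simp only [isTodaBracket_iff]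
    exact existsUnique_eq
  · intro B T hB hT
    -- Both brackets are members of the family `hamBracket`, for `H` and for the constant `1`.
    rw [(isHBracket_iff hH B).1 hB, (isTodaBracket_iff T).1 hT]
    exact compatible_hamBracket hH contDiffOn_const
  · obtain ⟨P, hP⟩ := exists_polynomial_hTransform h_odd hh
    refine ⟨P, hP, fun N _ => ⟨fun k => ?_, fun B K hB hK => ?_⟩⟩
    · simp only [isFaybusovichGekhtmanBracket_iff, isHBracket_iff (hpow k)]
      exact existsUnique_eq
    · rw [(isHBracket_iff hH B).1 hB, hamBracket_polynomial hH hP hpow]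
      refine Finset.sum_congr rfl fun k _ => ?_
      rw [(isHBracket_iff (hpow k) (K k)).1 ((isFaybusovichGekhtmanBracket_iff k (K k)).1 (hK k))]
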